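/- **Setting.** Let $\mathcal X,\mathcal A,\mathcal Z$ be the (measurable) state, action and observation spaces. A model consists of an initial law $b_0$ on $\mathcal X$, a transition model $p_T(dx'\mid x,a)$, two observation densities $p_Z(z\mid x)$ (original) and $q_Z(z\mid x)$ (simplified) with respect to a common $\sigma$-finite reference measure $dz$, and rewards $r_i(x,a)$; the horizon is $L\in\mathbb N$ and the discount factor is $\gamma\in(0,1]$. Write $o_i(z\mid x)$ for the observation density in force at time $i$, where each $o_i$ is either $p_Z$ or $q_Z$ (all $o_i=p_Z$, or all $o_i=q_Z$, or $p_Z$ up to the time of planning and $q_Z$ afterwards). A policy $\pi=(\pi_i)$ maps histories $H_i=(a_0,z_1,\dots,a_{i-1},z_i)$ measurably to actions. For a history $H_t$ put $$o_{1:t}=\prod_{l=1}^t o_l(z_l\mid x_l),\qquad o^H_{1:t}=\mathbb E[o_{1:t}],$$ the expectation being over $x_{0:t}\sim b_0\prod_{l=1}^t p_T(x_l\mid x_{l-1},a_{l-1})$. If $0<o^H_{1:t}<\infty$, the belief $b_t$ is the posterior law of $x_t$ given $H_t$. *POMDP values.* With $r_i(b,a)=\mathbb E_{x\sim b}[r_i(x,a)]$: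 $Q^\pi_{\mathbf P,L}(b_L,a)=r_L(b_L,a)$ and, for $t<L$, $$Q^\pi_{\mathbf P,t}(b_t,a)=r_t(b_t,a)+\gamma\,\mathbb E_{z_{t+1}}\big[Q^\pi_{\mathbf P,t+1}(b_{t+1},\pi_{t+1}(H_{t+1}))\big],$$ where $z_{t+1}$ has its law given $H_t$ and $a$, and $H_{t+1}=(H_t,a,z_{t+1})$. *Particle-belief MDP.* A particle belief $\bar b=\{(x^j,w^j)\}_{j=1}^C$ stands for the law $\sum_j w^j\delta_{x^j}/\sum_j w^j$ (uniform weights if all $w^j=0$). Under action $a$ at time $i$, draw $x$ from $\bar b$, $x'\sim p_T(\cdot\mid x,a)$ and $z\sim o_{i+1}(\cdot\mid x')$; independently draw $y^j\sim p_T(\cdot\mid x^j,a)$ for each $j$; the next particle belief is $\{(y^j,w^j o_{i+1}(z\mid y^j))\}_j$ (sequential importance sampling, no resampling). $Q^\pi_{\mathbf{M_P},t}(\bar b_t,a)$ is the value for this transition, defined by the same recursion with reward $r_i(\bar b,a)$, the policy acting on the history of actions and observations. $\widetilde Q^\pi_{\mathbf{M_P},t}$ is the same with $r$ replaced by a reward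 estimate $\tilde r$. *Random belief trees.* Let $t\le L$ and let $H_t$ be a history with $0<o^H_{1:t}<\infty$. The root particle belief $\bar b_t$ consists of $C$ independent particles: trajectories $x_{0:t}\sim b_0\prod_l p_T(x_l\mid x_{l-1},a_{l-1})$ with state $x_t$ and weight $o_{1:t}$. From every node at a time $<L$, children are drawn independently by the transition above. In the *tree of $(\pi,a)$* every node has $C$ children, for the action $a$ at the root and the action $\pi_i(H_i)$ at every other node. In the *full tree*, for $\mathcal A$ finite, every node has $C$ children for each action. A node at time $i$ carries its history $H_i$, exact belief $b_i$ and particle belief $\bar b_i$. *Assumptions.* (a) $|r_i(x,a)|\le R_{\max,i}$ for $i\le L$; let $V_{\max}=\max_{t\le L}\sum_{i=t}^L\gamma^{i-t}R_{\max,i}>0$. (b) $o_{1:t}\le d\,o^H_{1:t}$ for all $t\le L$, all $a_{0:t-1}$, $z_{1:t}$, and almost every $x_{0:t}\sim b_0\prod_l p_T(x_l\mid x_{l-1},a_{l-1})$, where $0<d<\infty$. (c) The reward estimate $\tilde r_i(x,a)$ from $N_r$ reward samples is random, independent of the tree, bounded by $|\tilde r_i|\le\tilde R_i$, and satisfies $\mathbb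 P(|r_i(x,a)-\tilde r_i(x,a)|\ge\nu)\le\delta_r(\nu,N_r)$ for all $\nu>0$, $i\le L$, $x$, $a$, where $\delta_r(\nu,N_r)\to0$ as $N_r\to\infty$ for each $\nu>0$. ((c) is not needed for the statements about $Q_{\mathbf{M_P}}$.) **Claim.** Let $\varepsilon,\delta>0$, and for constants $\lambda,\nu>0$, $C,N_r,K\in\mathbb N$ put $\alpha_L=\lambda$, $\alpha_t=(1+\gamma)\lambda+\gamma\alpha_{t+1}$, $\beta_L=2\nu$, $\beta_t=2\nu+\gamma\beta_{t+1}$, $k_{\max}=\frac{\lambda}{4V_{\max}d}-\frac1{\sqrt C}$, $\acute k=\min\{k_{\max},\frac{\lambda}{4\sqrt2V_{\max}}\}$. Consider the requirements $$C\ge1,\qquad k_{\max}>0,\qquad \alpha_t+\beta_t\le\varepsilon\ (0\le t\le L),\qquad 5(4KC)^{L+1}\big(e^{-C\acute k^2}+\delta_r(\nu,N_r)\big)\le\delta.\tag{$*$}$$ 1. (Given policy.) There are $\lambda,\nu>0$, $C$, $N_r$ satisfying $(*)$ with $K=1$, such that for every model and choice of observation densities satisfying (a), (b), every $t\le L$ and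 history $H_t$ as above, every policy $\pi$ and every action $a$: with probability at least $1-\delta$, $$|Q^\pi_{\mathbf P,i}(b_i,a_i)-Q^\pi_{\mathbf{M_P},i}(\bar b_i,a_i)|\le\varepsilon$$ at all nodes of the tree of $(\pi,a)$, where $i$ is the time of the node and $a_i$ is its action ($a$ at the root, $\pi_i(H_i)$ elsewhere); in particular the bound holds at the root for $b_t,\bar b_t,a$. For every reward estimate as in (c) the same is true, with probability at least $1-\delta$ over the estimate and the tree, with $\widetilde Q_{\mathbf{M_P}}$ in place of $Q_{\mathbf{M_P}}$. 2. (All policies.) If $\mathcal A$ is finite, there are $\lambda,\nu>0$, $C$, $N_r$ satisfying $(*)$ with $K=|\mathcal A|$, such that for every model and choice of observation densities satisfying (a), (b), and every $t\le L$ and history $H_t$ as above: with probability at least $1-\delta$, $$|Q^\pi_{\mathbf P,i}(b_i,a)-Q^\pi_{\mathbf{M_P},i}(\bar b_i,a)|\le\varepsilon$$ simultaneously for all nodes of the full tree, all policies $\pi$ and all actions $a$; and likewise for $\widetilde Q_{\mathbf{M_P}}$ under (c). The constants are chosen for the given spaces from $L,\gamma,(R_{\max,i}),(\tilde R_i),d,\delta_r,\varepsilon,\delta$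 (and $|\mathcal A|$ in 2) before the model, observation densities, policy, time, history, action and estimate. -/

import Mathlib

open MeasureTheory ProbabilityTheory Filter Topology
open scoped NNReal ENNReal

noncomputable section

namespace PBMDP

/-- A history `(a₀, z₁, …, a_{t-1}, z_t)`: entry `l` is the pair `(a_l, z_{l+1})`. The initial
belief, which is part of the model, is not repeated. -/
abbrev Hist (A Z : Type*) (t : ℕ) := Fin t → A × Z

/-- The history `h` followed by the action `a` and the observation `z`. -/
def Hist.push {A Z : Type*} {t : ℕ} (h : Hist A Z t) (a : A) (z : Z) : Hist A Z (t + 1) :=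
  Fin.snoc (α := fun _ => A × Z) h (a, z)

/-- A particle belief: `C` particles, each with its state and its unnormalized weight. -/
abbrev PBelief (X : Type*) (C : ℕ) := Fin C → X × ℝ≥0

/-- The data of a POMDP together with a simplified observation model: initial belief, transition
model, original and simplified observation densities with respect to a common reference measure
(Lebesgue measure, say), and time dependent state reward. -/
structure Model (X A Z : Type*) [MeasurableSpace X] [MeasurableSpace A] [MeasurableSpace Z] where
  b0 : Measure X
  b0_prob : IsProbabilityMeasure b0
  pT : Kernel (X × A) X
  pT_markov : IsMarkovKernel pT
  vol : Measure Z
  vol_sigmaFinite : SigmaFinite vol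
  pZ : X → Z → ℝ≥0
  measurable_pZ : Measurable (Function.uncurry pZ)
  lintegral_pZ : ∀ x, ∫⁻ z, (pZ x z : ℝ≥0∞) ∂vol = 1
  qZ : X → Z → ℝ≥0
  measurable_qZ : Measurable (Function.uncurry qZ)
  lintegral_qZ : ∀ x, ∫⁻ z, (qZ x z : ℝ≥0∞) ∂vol = 1
  r : ℕ → X → A → ℝ
  measurable_r : ∀ i, Measurable (fun p : X × A => r i p.1 p.2)

/-- Which of the two observation models is in force. -/
inductive ObsChoice
  | original
  | simplified

/-- A (history dependent, deterministic) policy. -/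
structure Policy (A Z : Type*) [MeasurableSpace A] [MeasurableSpace Z] where
  act : (t : ℕ) → Hist A Z t → A
  measurable_act : ∀ t, Measurable (act t)

namespace Model

variable {X A Z : Type*} [MeasurableSpace X] [MeasurableSpace A] [MeasurableSpace Z]

/-- The observation density in force at time `i`. For a constant `σ` this is `p_Z` or `q_Z`
throughout; a `σ` that switches at time `t` describes planning with `q_Z` from a belief that was
inferred with `p_Z` up to time `t`. -/
def obs (M : Model X A Z) (σ : ℕ → ObsChoice) (i : ℕ) : X → Z → ℝ≥0 :=
  match σ i with
  | ObsChoice.original => M.pZ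
  | ObsChoice.simplified => M.qZ

/-! ### The POMDP -/

/-- The unnormalized Bayes filter: `joint σ t h` is the measure
`B ↦ ∫ 1_B(x_t) ∏_{l ≤ t} p(z_l ∣ x_l) d(b₀ τ_{1:t})(x_{0:t})`. -/
def joint (M : Model X A Z) (σ : ℕ → ObsChoice) : (t : ℕ) → Hist A Z t → Measure X
  | 0, _ => M.b0
  | t + 1, h =>
      ((M.joint σ t (Fin.init h)).bind (fun x => M.pT (x, (h (Fin.last t)).1))).withDensity
        (fun x => (M.obs σ (t + 1) x (h (Fin.last t)).2 : ℝ≥0∞))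

/-- The likelihood `∏_{l ≤ t} p(z_l ∣ H_l⁻)` of the observations of `h` given its actions. -/
def evidence (M : Model X A Z) (σ : ℕ → ObsChoice) (t : ℕ) (h : Hist A Z t) : ℝ≥0∞ :=
  M.joint σ t h Set.univ

/-- The belief `b_t`, the conditional law of the state given the history. -/
def belief (M : Model X A Z) (σ : ℕ → ObsChoice) (t : ℕ) (h : Hist A Z t) : Measure X :=
  (M.evidence σ t h)⁻¹ • M.joint σ t h

/-- The law of the observation at time `i` when action `a` is taken from a state with law `b` at
time `i - 1`. -/
def obsLaw (M : Model X A Z) (σ : ℕ → ObsChoice) (i : ℕ) (b : Measure X) (a : A) : Measure Z :=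
  (b.bind (fun x => M.pT (x, a))).bind
    (fun x => M.vol.withDensity (fun z => (M.obs σ i x z : ℝ≥0∞)))

/-- The action value of the POMDP with `n` steps to go at time `t`: take `a`, then follow `π`. -/
def pomdpQAux (M : Model X A Z) (σ : ℕ → ObsChoice) (γ : ℝ) (π : Policy A Z) :
    (n t : ℕ) → Hist A Z t → A → ℝ
  | 0, t, h, a => ∫ x, M.r t x a ∂(M.belief σ t h)
  | n + 1, t, h, a =>
      (∫ x, M.r t x a ∂(M.belief σ t h)) +
        γ * ∫ z, M.pomdpQAux σ γ π n (t + 1) (h.push a z) (π.act (t + 1) (h.push a z))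
          ∂(M.obsLaw σ (t + 1) (M.belief σ t h) a)

/-- `Q_{P,t}^π(b_t, a)` for horizon `L`, where `b_t` is the belief of the history `h`. -/
def pomdpQ (M : Model X A Z) (σ : ℕ → ObsChoice) (L : ℕ) (γ : ℝ) (π : Policy A Z)
    (t : ℕ) (h : Hist A Z t) (a : A) : ℝ :=
  M.pomdpQAux σ γ π (L - t) t h a

/-! ### The particle-belief MDP -/

/-- The law of a pair (state at time `t`, likelihood weight `∏_{l ≤ t} p(z_l ∣ x_l)`) when
`x_{0:t}` has law `b₀ τ_{1:t}`: one particle of sequential importance sampling. -/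
def particleLaw (M : Model X A Z) (σ : ℕ → ObsChoice) :
    (t : ℕ) → Hist A Z t → Measure (X × ℝ≥0)
  | 0, _ => M.b0.map (fun x => (x, 1))
  | t + 1, h =>
      (M.particleLaw σ t (Fin.init h)).bind (fun p =>
        (M.pT (p.1, (h (Fin.last t)).1)).map
          (fun x => (x, p.2 * M.obs σ (t + 1) x (h (Fin.last t)).2)))

/-- The law of the particle belief which sequential importance sampling with `C` independent
particles, without resampling, produces for the history `h`. -/
def sisLaw (M : Model X A Z) (σ : ℕ → ObsChoice) (C t : ℕ) (h : Hist A Z t) :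
    Measure (PBelief X C) :=
  Measure.pi (fun _ => M.particleLaw σ t h)

end Model

/-- The normalized weights; by convention uniform if all weights vanish. -/
def PBelief.normWeight {X : Type*} {C : ℕ} (b : PBelief X C) (j : Fin C) : ℝ≥0 :=
  if ∑ k, (b k).2 = 0 then (C : ℝ≥0)⁻¹ else (b j).2 / ∑ k, (b k).2

/-- The discrete distribution on states that a particle belief represents. -/
def PBelief.toMeasure {X : Type*} [MeasurableSpace X] {C : ℕ} (b : PBelief X C) : Measure X :=
  ∑ j, (PBelief.normWeight b j : ℝ≥0∞) • Measure.dirac (b j).1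

namespace Model

variable {X A Z : Type*} [MeasurableSpace X] [MeasurableSpace A] [MeasurableSpace Z]

/-- The transition of the particle-belief MDP from time `t` to `t + 1`: an observation is
generated from a state that is drawn from the particle belief and propagated; independently, all
particles are propagated; then the weights are multiplied by the observation likelihoods. The
result is the joint law of the observation and the new particle belief. -/
def genPF (M : Model X A Z) (σ : ℕ → ObsChoice) {C : ℕ} (t : ℕ) (b : PBelief X C) (a : A) :
    Measure (Z × PBelief X C) :=
  ((M.obsLaw σ (t + 1) (PBelief.toMeasure b) a).prod
      (Measure.pi (fun j => M.pT ((b j).1, a)))).map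
    (fun p => (p.1, fun j => (p.2 j, (b j).2 * M.obs σ (t + 1) (p.2 j) p.1)))

/-- The action value of the particle-belief MDP with state reward `rr` and with `n` steps to go at
time `t`: take `a`, then follow `π`. -/
def pbmdpQAux (M : Model X A Z) (σ : ℕ → ObsChoice) (γ : ℝ) (rr : ℕ → X → A → ℝ)
    (π : Policy A Z) {C : ℕ} : (n t : ℕ) → Hist A Z t → PBelief X C → A → ℝ
  | 0, t, _, b, a => ∫ x, rr t x a ∂(PBelief.toMeasure b)
  | n + 1, t, h, b, a =>
      (∫ x, rr t x a ∂(PBelief.toMeasure b)) +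
        γ * ∫ p : Z × PBelief X C,
          M.pbmdpQAux σ γ rr π n (t + 1) (h.push a p.1) p.2 (π.act (t + 1) (h.push a p.1))
          ∂(M.genPF σ t b a)

/-- `Q_{M_P,t}^π` at the particle belief `b` and the action `a` for horizon `L`, with state reward
`rr`; the history `h` that led to `b` is what the policy sees. -/
def pbmdpQ (M : Model X A Z) (σ : ℕ → ObsChoice) (L : ℕ) (γ : ℝ) (rr : ℕ → X → A → ℝ)
    (π : Policy A Z) {C : ℕ} (t : ℕ) (h : Hist A Z t) (b : PBelief X C) (a : A) : ℝ :=
  M.pbmdpQAux σ γ rr π (L - t) t h b a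

/-- The normalized observation likelihoods are almost everywhere bounded by `d`:
`∏ p(z_l ∣ x_l) ≤ d ∏ p(z_l ∣ H_l⁻)` for all observations and actions up to each time `t ≤ L`, and
for almost every `x_{0:t}` under the proposal law `b₀ τ_{1:t}`. -/
def LikelihoodRatioBound (M : Model X A Z) (σ : ℕ → ObsChoice) (L : ℕ) (d : ℝ) : Prop :=
  ∀ t ≤ L, ∀ h : Hist A Z t,
    ∀ᵐ p ∂(M.particleLaw σ t h), (p.2 : ℝ≥0∞) ≤ ENNReal.ofReal d * M.evidence σ t h

end Model

/-! ### Belief trees -/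

/-- A node at depth `n` of a belief tree rooted at time `t`, together with its ancestors: the
history of the node, and the particle beliefs at depths `0, …, n` on the path that leads to it. -/
abbrev Node (X A Z : Type*) (C t n : ℕ) := Hist A Z (t + n) × (Fin (n + 1) → PBelief X C)

/-- The history at the ancestor of depth `k`. -/
def Node.hist {X A Z : Type*} {C t n : ℕ} (N : Node X A Z C t n) (k : Fin (n + 1)) :
    Hist A Z (t + k) :=
  fun j => N.1 (Fin.castLE (Nat.add_le_add_left (Nat.lt_succ_iff.mp k.2) t) j)

/-- The particle belief at the ancestor of depth `k`. -/
def Node.pbelief {X A Z : Type*} {C t n : ℕ} (N : Node X A Z C t n) (k : Fin (n + 1)) :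
    PBelief X C :=
  N.2 k

/-- The branching of the tree for a single policy: `C` children of each node, for the action `a` at
the root and the action of the policy at all other nodes. -/
def policyRule {A Z : Type*} [MeasurableSpace A] [MeasurableSpace Z] (C t : ℕ) (π : Policy A Z)
    (a : A) : (n : ℕ) → Hist A Z (t + n) → Fin C → A :=
  fun n h _ => if n = 0 then a else π.act (t + n) h

/-- The branching of the full tree: `C` children of each node for each action. -/
def fullRule (A Z : Type*) (C t : ℕ) : (n : ℕ) → Hist A Z (t + n) → A × Fin C → A :=
  fun _ _ e => e.1

namespace Model

variable {X A Z : Type*} [MeasurableSpace X] [MeasurableSpace A] [MeasurableSpace Z]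

/-- The law of a child, for action `a`, of a node at depth `n`. -/
def childLaw (M : Model X A Z) (σ : ℕ → ObsChoice) {C t n : ℕ} (N : Node X A Z C t n) (a : A) :
    Measure (Node X A Z C t (n + 1)) :=
  (M.genPF σ (t + n) (N.2 (Fin.last n)) a).map
    (fun p => (Hist.push N.1 a p.1, Fin.snoc (α := fun _ => PBelief X C) N.2 p.2))

/-- The law of the random sparse-sampling belief tree of depth `n` whose root is the particle
belief of the history `h`. The edges that leave a node are labelled by `E`, the edge `e` at a node
of depth `m` with history `h'` carries the action `rule m h' e`, and all children of a level are
generated independently given the previous level. The tree is recorded by its leaves, each with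
its ancestors; the leaf `v` is reached along the edges `v 0, …, v (n - 1)`. -/
def treeLaw (M : Model X A Z) (σ : ℕ → ObsChoice) (C t : ℕ) (h : Hist A Z t) {E : Type*}
    [Fintype E] (rule : (n : ℕ) → Hist A Z (t + n) → E → A) :
    (n : ℕ) → Measure ((Fin n → E) → Node X A Z C t n)
  | 0 => (M.sisLaw σ C t h).map (fun b _ => (h, fun _ => b))
  | n + 1 =>
      (M.treeLaw σ C t h rule n).bind (fun T =>
        Measure.pi (fun v : Fin (n + 1) → E =>
          M.childLaw σ (T (Fin.init v)) (rule n (T (Fin.init v)).1 (v (Fin.last n)))))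

/-- The distance of the action values of the POMDP and of the particle-belief MDP with state
reward `rr` at the ancestor of depth `k` of a node. -/
def gap (M : Model X A Z) (σ : ℕ → ObsChoice) (L : ℕ) (γ : ℝ) (rr : ℕ → X → A → ℝ)
    (π : Policy A Z) {C t n : ℕ} (N : Node X A Z C t n) (k : Fin (n + 1)) (a : A) : ℝ :=
  |M.pomdpQ σ L γ π (t + k) (N.hist k) a -
    M.pbmdpQ σ L γ rr π (t + k) (N.hist k) (N.pbelief k) a|

/-- At all nodes of the tree of a single policy, the two action values for the action that is
taken there are `ε`-close. -/
def policyTreeGood (M : Model X A Z) (σ : ℕ → ObsChoice) (L : ℕ) (γ ε : ℝ)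
    (rr : ℕ → X → A → ℝ) (π : Policy A Z) {C t n : ℕ} (a : A)
    (T : (Fin n → Fin C) → Node X A Z C t n) : Prop :=
  ∀ (v : Fin n → Fin C) (k : Fin (n + 1)) (e : Fin C),
    M.gap σ L γ rr π (T v) k (policyRule C t π a k ((T v).hist k) e) ≤ ε

/-- At all nodes of the full tree, the two action values are `ε`-close for all policies and all
actions simultaneously. -/
def fullTreeGood (M : Model X A Z) (σ : ℕ → ObsChoice) (L : ℕ) (γ ε : ℝ)
    (rr : ℕ → X → A → ℝ) {C t n : ℕ}
    (T : (Fin n → A × Fin C) → Node X A Z C t n) : Prop :=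
  ∀ (π : Policy A Z) (v : Fin n → A × Fin C) (k : Fin (n + 1)) (a : A),
    M.gap σ L γ rr π (T v) k a ≤ ε

/-- `est N ω i x a` is an estimate of the reward `r_i(x, a)` from `N` reward samples, with
randomness `ω`; its failure probabilities are bounded by `δr`, and it is bounded by `Rest i`. -/
structure IsRewardEstimator (M : Model X A Z) {Ω : Type*} [MeasurableSpace Ω] (P : Measure Ω)
    (est : ℕ → Ω → ℕ → X → A → ℝ) (L : ℕ) (δr : ℝ → ℕ → ℝ) (Rest : ℕ → ℝ) : Prop where
  measurable_est : ∀ N i, Measurable (fun q : Ω × X × A => est N q.1 i q.2.1 q.2.2)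
  bounded : ∀ N ω, ∀ i ≤ L, ∀ x a, |est N ω i x a| ≤ Rest i
  concentration : ∀ N, ∀ i ≤ L, ∀ x a, ∀ ν : ℝ, 0 < ν →
    P {ω | ν ≤ |M.r i x a - est N ω i x a|} ≤ ENNReal.ofReal (δr ν N)

end Model

/-! ### Constants -/

/-- `V_max = max_{t ≤ L} ∑_{i=t}^{L} γ^{i-t} R_{max,i}`. -/
def Vmax (L : ℕ) (γ : ℝ) (Rmax : ℕ → ℝ) : ℝ :=
  (Finset.range (L + 1)).sup' Finset.nonempty_range_add_one
    (fun t => ∑ i ∈ Finset.Icc t L, γ ^ (i - t) * Rmax i)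

/-- `alpha γ lam n` is `α_{L-n}`, where `α_L = λ` and `α_t = (1 + γ) λ + γ α_{t+1}`. -/
def alpha (γ lam : ℝ) : ℕ → ℝ
  | 0 => lam
  | n + 1 => (1 + γ) * lam + γ * alpha γ lam n

/-- `beta γ ν n` is `β_{L-n}`, where `β_L = 2ν` and `β_t = 2ν + γ β_{t+1}`. -/
def beta (γ ν : ℝ) : ℕ → ℝ
  | 0 => 2 * ν
  | n + 1 => 2 * ν + γ * beta γ ν n

def kmax (V d lam : ℝ) (C : ℕ) : ℝ := lam / (4 * V * d) - 1 / Real.sqrt C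

def kacute (V d lam : ℝ) (C : ℕ) : ℝ := min (kmax V d lam C) (lam / (4 * Real.sqrt 2 * V))

/-- The constants `λ, ν, C, N_r` give precision `ε` and confidence `1 - δ` (`K` is the number of
actions over which the tree branches, `1` for a single policy). -/
structure Admissible (L : ℕ) (γ V d : ℝ) (δr : ℝ → ℕ → ℝ) (K : ℕ) (ε δ lam ν : ℝ) (C Nr : ℕ) :
    Prop where
  lam_pos : 0 < lam
  nu_pos : 0 < ν
  C_pos : 0 < C
  kmax_pos : 0 < kmax V d lam C
  precision : ∀ n ≤ L, alpha γ lam n + beta γ ν n ≤ ε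
  confidence : 5 * (4 * (K : ℝ) * C) ^ (L + 1) *
    (Real.exp (-(C * kacute V d lam C ^ 2)) + δr ν Nr) ≤ δ

/-- The event `S` has (inner) probability at least `p`; no measurability of `S` is presupposed. -/
def HoldsWithProb {Ω : Type*} [MeasurableSpace Ω] (P : Measure Ω) (p : ℝ) (S : Set Ω) : Prop :=
  ∃ G, MeasurableSet G ∧ G ⊆ S ∧ ENNReal.ofReal p ≤ P G

end PBMDP

end

/-! Along a fixed history the particles are independent importance samples of the exact belief: the
weighted law of one particle is the unnormalized Bayes filter (`lintegral_joint`), and propagating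
independent particles with a prescribed observation gives independent particles for the longer
history (`sisLaw_push`). The likelihood ratios are at most `d`, so Hoeffding's inequality controls
three empirical means: the total weight, the weighted reward, and the weighted predictive density of
a prescribed next observation. If they are within `η` of their expectations, the reward of the
particle belief is close to the exact one (`WeightGood.abs_reward_sub_le`), and on the good
observations the particle observation law dominates `1 - 2η` times the exact one
(`WeightGood.smul_obsLaw_le`).

The obstacle is that in the tree, and in the particle-belief MDP itself, the observation is drawn
from the particle belief, so that history and particles are dependent. `lintegral_genPF_sisLaw_le`
removes the dependence by a change of measure: where the total weight is at least half of its
expectation, the density of the observation is at most `2d` times its exact density. Each generation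
costs a factor `2d`; over at most `L` generations this is a constant independent of `C`, and the
exponentially small Hoeffding bound absorbs it.

The value difference is bounded deterministically by a multiple of `η` plus the `excess`, which
charges the full range of the values for every failure now or later
(`abs_pomdpQAux_sub_pbmdpQAux_le`). At a fixed history the expected excess is a constant times the
Hoeffding bound (`lintegral_excess_le`). Markov's inequality makes the excess small at one node, a
decomposition by the first bad node extends this to a path (`treeLaw_not_pathGood_le`), and a union
bound over the leaves to the tree. The excess does not refer to a policy: it sums over a finite
family of selectors. With the constant selectors of a finite action space, one event serves all
policies.

A reward estimate is independent of the tree. Hence its effect at any node is averaged over the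
estimate first, by Tonelli, and Markov's inequality applies again (`lintegral_rewardError_le`,
`prod_not_errorGood_le`).

The accuracy `η` that the argument needs is not tied to `λ`. Both `Admissible` and the smallness of
the failure bounds hold for a large `C`, followed by an `N_r` that is large in terms of `C`
(`exists_admissible`). -/

noncomputable section

namespace PBMDP

/-! ### Measures depending measurably on a parameter -/

section Parameter

variable {α β δ ι : Type*} [MeasurableSpace α] [MeasurableSpace β] [MeasurableSpace δ]

lemma isFiniteKernel_of_le_one {μ : α → Measure β} (hμ : Measurable μ)
    (h1 : ∀ a, μ a Set.univ ≤ 1) : IsFiniteKernel (⟨μ, hμ⟩ : Kernel α β) :=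
  ⟨⟨1, ENNReal.one_lt_top, h1⟩⟩

lemma measurable_lintegral_param {μ : α → Measure β} (hμ : Measurable μ)
    (h1 : ∀ a, μ a Set.univ ≤ 1) {f : α → β → ℝ≥0∞} (hf : Measurable (Function.uncurry f)) :
    Measurable fun a => ∫⁻ b, f a b ∂μ a := by
  have := isFiniteKernel_of_le_one hμ h1
  exact Measurable.lintegral_kernel_prod_right (κ := (⟨μ, hμ⟩ : Kernel α β)) hf

lemma measurable_integral_param {μ : α → Measure β} (hμ : Measurable μ)
    (h1 : ∀ a, μ a Set.univ ≤ 1) {f : α → β → ℝ} (hf : Measurable (Function.uncurry f)) :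
    Measurable fun a => ∫ b, f a b ∂μ a := by
  have := isFiniteKernel_of_le_one hμ h1
  exact (StronglyMeasurable.integral_kernel_prod_right (κ := (⟨μ, hμ⟩ : Kernel α β))
    hf.stronglyMeasurable).measurable

lemma measurable_measure_param {μ : α → Measure β} (hμ : Measurable μ)
    (h1 : ∀ a, μ a Set.univ ≤ 1) {s : α → Set β}
    (hs : MeasurableSet {p : α × β | p.2 ∈ s p.1}) : Measurable fun a => μ a (s a) := by
  have := isFiniteKernel_of_le_one hμ h1
  exact Kernel.measurable_kernel_prodMk_left (κ := (⟨μ, hμ⟩ : Kernel α β)) hs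

lemma measurable_bind_param {μ : α → Measure β} (hμ : Measurable μ)
    (h1 : ∀ a, μ a Set.univ ≤ 1) {κ : α → β → Measure δ} (hκ : Measurable (Function.uncurry κ)) :
    Measurable fun a => (μ a).bind (κ a) := by
  refine Measure.measurable_of_measurable_coe _ fun s hs => ?_
  have h (a) : Measurable (κ a) := hκ.comp measurable_prodMk_left
  simp_rw [fun a => Measure.bind_apply hs (h a).aemeasurable (m := μ a)]
  exact measurable_lintegral_param hμ h1 ((Measure.measurable_coe hs).comp hκ)

lemma measurable_map_param {μ : α → Measure β} (hμ : Measurable μ)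
    (h1 : ∀ a, μ a Set.univ ≤ 1) {f : α → β → δ} (hf : Measurable (Function.uncurry f)) :
    Measurable fun a => (μ a).map (f a) := by
  refine Measure.measurable_of_measurable_coe _ fun s hs => ?_
  have h (a) : Measurable (f a) := hf.comp measurable_prodMk_left
  simp_rw [fun a => Measure.map_apply (μ := μ a) (h a) hs]
  exact measurable_measure_param hμ h1 (s := fun a => f a ⁻¹' s) (hf hs)

lemma measurable_prod_param {μ : α → Measure β} {ν : α → Measure δ} (hμ : Measurable μ)
    (hν : Measurable ν) (h1 : ∀ a, μ a Set.univ ≤ 1) (h2 : ∀ a, ν a Set.univ ≤ 1) :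
    Measurable fun a => (μ a).prod (ν a) := by
  have := isFiniteKernel_of_le_one hμ h1
  have := isFiniteKernel_of_le_one hν h2
  have h := ((⟨μ, hμ⟩ : Kernel α β) ×ₖ (⟨ν, hν⟩ : Kernel α δ)).measurable
  convert h with a
  exact (Kernel.prod_apply (⟨μ, hμ⟩ : Kernel α β) (⟨ν, hν⟩ : Kernel α δ) a).symm

/-- Measurability of a family of probability measures can be tested on a generating π-system; on
boxes the product measure is a finite product of measurable functions. -/
lemma measurable_pi_param [Fintype ι] {μ : ι → α → Measure β}
    (hμ : ∀ i, Measurable (μ i)) (h1 : ∀ i a, IsProbabilityMeasure (μ i a)) :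
    Measurable fun a => Measure.pi (fun i => μ i a) := by
  refine Measurable.measure_of_isPiSystem_of_isProbabilityMeasure generateFrom_pi.symm
    isPiSystem_pi ?_
  rintro _ ⟨s, hs, rfl⟩
  simp_rw [Measure.pi_pi]
  exact Finset.measurable_prod _ fun i _ =>
    (Measure.measurable_coe (hs i (Set.mem_univ i))).comp (hμ i)

lemma measurable_smul_measure {c : α → ℝ≥0∞} (hc : Measurable c) {μ : α → Measure β}
    (hμ : Measurable μ) : Measurable fun a => c a • μ a := by
  refine Measure.measurable_of_measurable_coe _ fun s hs => ?_
  exact hc.mul ((Measure.measurable_coe hs).comp hμ)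

lemma isProbabilityMeasure_bind {μ : Measure β} [IsProbabilityMeasure μ] {κ : β → Measure δ}
    (hκ : Measurable κ) (h1 : ∀ b, IsProbabilityMeasure (κ b)) :
    IsProbabilityMeasure (μ.bind κ) := by
  constructor
  rw [Measure.bind_apply MeasurableSet.univ hκ.aemeasurable]
  simp

lemma lintegral_prod_eval_pi [Fintype ι] {μ : ι → Measure β} [∀ i, IsProbabilityMeasure (μ i)]
    {f : ι → β → ℝ≥0∞} (hf : ∀ i, Measurable (f i)) :
    ∫⁻ x, ∏ i, f i (x i) ∂(Measure.pi μ) = ∏ i, ∫⁻ y, f i y ∂(μ i) := by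
  rw [lintegral_prod_eq_prod_lintegral_of_indepFun Finset.univ (fun i (x : ι → β) => f i (x i))
    (iIndepFun_pi fun i => (hf i).aemeasurable) fun i => (hf i).comp (measurable_pi_apply i)]
  refine Finset.prod_congr rfl fun i _ => ?_
  rw [← (measurePreserving_eval μ i).lintegral_comp (hf i)]

/-- Both measures agree on boxes, because the integral of a product of functions of separate
coordinates factorizes. This is what keeps the particles independent when each is propagated by its
own kernel. -/
lemma pi_bind [Fintype ι] {μ : ι → Measure β} [∀ i, IsProbabilityMeasure (μ i)]
    {κ : ι → β → Measure δ} (hκ : ∀ i, Measurable (κ i))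
    (h1 : ∀ i b, IsProbabilityMeasure (κ i b)) :
    Measure.pi (fun i => (μ i).bind (κ i)) =
      (Measure.pi μ).bind (fun x => Measure.pi (fun i => κ i (x i))) := by
  have hp : ∀ i, IsProbabilityMeasure ((μ i).bind (κ i)) := fun i =>
    isProbabilityMeasure_bind (hκ i) (h1 i)
  refine Measure.pi_eq fun s hs => ?_
  have hm : Measurable fun x : ι → β => Measure.pi (fun i => κ i (x i)) :=
    measurable_pi_param (fun i => (hκ i).comp (measurable_pi_apply i)) fun i x => h1 i _
  rw [Measure.bind_apply (MeasurableSet.univ_pi hs) hm.aemeasurable]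
  simp_rw [Measure.pi_pi]
  rw [lintegral_prod_eval_pi (f := fun i b => κ i b (s i))
    fun i => (Measure.measurable_coe (hs i)).comp (hκ i)]
  refine Finset.prod_congr rfl fun i _ => ?_
  rw [Measure.bind_apply (hs i) (hκ i).aemeasurable]

end Parameter

/-! ### Hoeffding's inequality for product measures -/

/-- A variable with values in `[-B, B]` is sub-Gaussian with variance proxy `B²`, and the proxies of
the independent coordinates add up to `C B²`. The bound on `f` is only asked almost everywhere, as
the likelihood ratio bound gives no more. -/
lemma hoeffding_upper {Y : Type*} [MeasurableSpace Y] (μ : Measure Y) [IsProbabilityMeasure μ]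
    {f : Y → ℝ} (hf : Measurable f) {B : ℝ} (hB : 0 < B) (hfB : ∀ᵐ y ∂μ, |f y| ≤ B) (C : ℕ)
    {η : ℝ} (hη : 0 ≤ η) :
    (Measure.pi (fun _ : Fin C => μ)).real
        {y | η * C ≤ ∑ j, (f (y j) - ∫ x, f x ∂μ)} ≤
      Real.exp (-(C * (η ^ 2 / (2 * B ^ 2)))) := by
  have hsub : ∀ i ∈ (Finset.univ : Finset (Fin C)), HasSubgaussianMGF
      (fun y : Fin C → Y => f (y i) - ∫ x, f x ∂μ) ((‖B - -B‖₊ / 2) ^ 2)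
      (Measure.pi (fun _ : Fin C => μ)) := by
    intro i _
    have hmp := measurePreserving_eval (fun _ : Fin C => μ) i
    have h := hasSubgaussianMGF_of_mem_Icc (μ := Measure.pi (fun _ : Fin C => μ))
      (X := fun y : Fin C → Y => f (y i)) (a := -B) (b := B)
      (hf.comp (measurable_pi_apply i)).aemeasurable
      (hmp.quasiMeasurePreserving.ae (hfB.mono fun y hy => abs_le.mp hy))
    have he : ∫ y : Fin C → Y, f (y i) ∂(Measure.pi (fun _ : Fin C => μ)) = ∫ x, f x ∂μ := by
      have := integral_map (μ := Measure.pi (fun _ : Fin C => μ))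
        (measurable_pi_apply i).aemeasurable
        (f := f) hf.aestronglyMeasurable
      rw [← this]
      exact congrArg (fun ν => ∫ x, f x ∂ν) hmp.map_eq
    rwa [he] at h
  have hind : iIndepFun (fun i (y : Fin C → Y) => f (y i) - ∫ x, f x ∂μ)
      (Measure.pi (fun _ : Fin C => μ)) :=
    iIndepFun_pi (X := fun _ y => f y - ∫ x, f x ∂μ) fun i => (hf.sub_const _).aemeasurable
  refine (HasSubgaussianMGF.measure_sum_ge_le_of_iIndepFun hind hsub
    (mul_nonneg hη (Nat.cast_nonneg C))).trans (Real.exp_le_exp.mpr (le_of_eq ?_))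
  rcases Nat.eq_zero_or_pos C with rfl | hC
  · simp
  have hC' : (C : ℝ) ≠ 0 := by positivity
  have : ‖B + B‖ = 2 * B := by rw [Real.norm_of_nonneg (by positivity)]; ring
  simp [this]
  field_simp

/-- Union of the upper tails of `f` and `-f`. The mean is a separate variable `m` so that the events
below can display it as `1` or as an integral over the belief. -/
lemma hoeffding_two_sided {Y : Type*} [MeasurableSpace Y] (μ : Measure Y) [IsProbabilityMeasure μ]
    {f : Y → ℝ} (hf : Measurable f) {B : ℝ} (hB : 0 < B) (hfB : ∀ᵐ y ∂μ, |f y| ≤ B) (C : ℕ)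
    {η : ℝ} (hη : 0 ≤ η) {m : ℝ} (hm : ∫ x, f x ∂μ = m) :
    Measure.pi (fun _ : Fin C => μ) {y | η * C < |∑ j, f (y j) - C * m|} ≤
      ENNReal.ofReal (2 * Real.exp (-(C * (η ^ 2 / (2 * B ^ 2))))) := by
  have h1 := hoeffding_upper μ hf hB hfB C hη
  have h2 := hoeffding_upper μ hf.neg hB (by simpa using hfB) C hη
  simp only [Pi.neg_apply, integral_neg] at h2
  rw [hm] at h1 h2
  rw [← ofReal_measureReal]
  refine ENNReal.ofReal_le_ofReal ?_
  refine (measureReal_mono (s₂ := {y | η * C ≤ ∑ j, (f (y j) - m)} ∪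
    {y | η * C ≤ ∑ j, (-f (y j) - -m)}) ?_).trans ((measureReal_union_le _ _).trans (by linarith))
  intro y hy
  simp only [Set.mem_ofPred_eq, Set.mem_union] at hy ⊢
  simp only [Finset.sum_sub_distrib, Finset.sum_neg_distrib, Finset.sum_const, Finset.card_univ,
    Fintype.card_fin, nsmul_eq_mul]
  rcases lt_abs.mp hy with h | h
  · left; linarith
  · right; linarith

end PBMDP

namespace PBMDP

/-! ### Extending and truncating histories. -/

section Hist

variable {A Z : Type*}

@[simp] lemma Hist.init_push {t : ℕ} (h : Hist A Z t) (a : A) (z : Z) :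
    (Fin.init (h.push a z) : Hist A Z t) = h :=
  Fin.init_snoc (α := fun _ => A × Z) (x := (a, z)) (p := h)

@[simp] lemma Hist.push_last {t : ℕ} (h : Hist A Z t) (a : A) (z : Z) :
    h.push a z (Fin.last t) = (a, z) :=
  Fin.snoc_last (α := fun _ => A × Z) (x := (a, z)) (p := h)

variable [MeasurableSpace A] [MeasurableSpace Z]

lemma measurable_fin_snoc {α Y : Type*} [MeasurableSpace α] [MeasurableSpace Y] {t : ℕ}
    {f : α → Fin t → Y} (hf : Measurable f) {g : α → Y} (hg : Measurable g) :
    Measurable fun x => (Fin.snoc (α := fun _ => Y) (f x) (g x) : Fin (t + 1) → Y) := by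
  refine measurable_pi_lambda _ fun j => ?_
  refine Fin.lastCases ?_ (fun i => ?_) j
  · simpa using hg
  · simpa using (measurable_pi_iff.mp hf) i

lemma Hist.measurable_push {α : Type*} [MeasurableSpace α] {t : ℕ} {f : α → Hist A Z t}
    (hf : Measurable f) {g : α → A} (hg : Measurable g) {k : α → Z} (hk : Measurable k) :
    Measurable fun x => (f x).push (g x) (k x) :=
  measurable_fin_snoc hf (hg.prodMk hk)

lemma Hist.measurable_init {t : ℕ} :
    Measurable fun h : Hist A Z (t + 1) => (Fin.init h : Hist A Z t) :=
  measurable_pi_lambda _ fun i => measurable_pi_apply i.castSucc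

end Hist

namespace Model

variable {X A Z : Type*} [MeasurableSpace X] [MeasurableSpace A] [MeasurableSpace Z]
  (M : Model X A Z) (σ : ℕ → ObsChoice)

instance : IsProbabilityMeasure M.b0 := M.b0_prob
instance : IsMarkovKernel M.pT := M.pT_markov
instance : SigmaFinite M.vol := M.vol_sigmaFinite

/-! ### Observations -/

lemma measurable_obs (i : ℕ) : Measurable (Function.uncurry (M.obs σ i)) := by
  unfold obs
  cases σ i
  · exact M.measurable_pZ
  · exact M.measurable_qZ

lemma lintegral_obs (i : ℕ) (x : X) : ∫⁻ z, (M.obs σ i x z : ℝ≥0∞) ∂M.vol = 1 := by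
  unfold obs
  cases σ i
  · exact M.lintegral_pZ x
  · exact M.lintegral_qZ x

lemma measurable_obs_comp {α : Type*} [MeasurableSpace α] (i : ℕ) {f : α → X} {g : α → Z}
    (hf : Measurable f) (hg : Measurable g) : Measurable fun y => M.obs σ i (f y) (g y) :=
  (M.measurable_obs σ i).comp (hf.prodMk hg)

lemma measurable_pT_comp {α : Type*} [MeasurableSpace α] {f : α → X} {g : α → A}
    (hf : Measurable f) (hg : Measurable g) : Measurable fun y => M.pT (f y, g y) :=
  M.pT.measurable.comp (hf.prodMk hg)

/-- The law of the observation at time `i` emitted from a state. -/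
def emission (i : ℕ) (x : X) : Measure Z :=
  M.vol.withDensity (fun z => (M.obs σ i x z : ℝ≥0∞))

instance (i : ℕ) (x : X) : IsProbabilityMeasure (M.emission σ i x) :=
  ⟨by rw [emission, withDensity_apply _ MeasurableSet.univ, Measure.restrict_univ,
    M.lintegral_obs σ i x]⟩

lemma measurable_emission (i : ℕ) : Measurable (M.emission σ i) := by
  refine Measure.measurable_of_measurable_coe _ fun s hs => ?_
  simp_rw [emission, withDensity_apply _ hs]
  exact Measurable.lintegral_prod_right (ν := M.vol.restrict s)
    (f := fun x z => (M.obs σ i x z : ℝ≥0∞)) (M.measurable_obs σ i).coe_nnreal_ennreal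

lemma lintegral_emission (i : ℕ) (x : X) {F : Z → ℝ≥0∞} (hF : Measurable F) :
    ∫⁻ z, F z ∂(M.emission σ i x) = ∫⁻ z, M.obs σ i x z * F z ∂M.vol :=
  lintegral_withDensity_eq_lintegral_mul _
    (M.measurable_obs_comp σ i measurable_const measurable_id').coe_nnreal_ennreal hF

/-- The density of the observation at time `i` when `a` is taken in state `x`. -/
def obsDens (i : ℕ) (x : X) (a : A) (z : Z) : ℝ≥0∞ :=
  ∫⁻ x', (M.obs σ i x' z : ℝ≥0∞) ∂(M.pT (x, a))

lemma measurable_obsDens (i : ℕ) :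
    Measurable fun p : X × A × Z => M.obsDens σ i p.1 p.2.1 p.2.2 := by
  refine measurable_lintegral_param (μ := fun p : X × A × Z => M.pT (p.1, p.2.1))
    (f := fun (p : X × A × Z) x' => (M.obs σ i x' p.2.2 : ℝ≥0∞))
    (M.measurable_pT_comp measurable_fst measurable_snd.fst) (fun _ => prob_le_one) ?_
  exact (M.measurable_obs_comp σ i measurable_snd
    measurable_fst.snd.snd).coe_nnreal_ennreal

lemma measurable_obsDens_comp {α : Type*} [MeasurableSpace α] (i : ℕ) {f : α → X} {g : α → A}
    {k : α → Z} (hf : Measurable f) (hg : Measurable g) (hk : Measurable k) :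
    Measurable fun y => M.obsDens σ i (f y) (g y) (k y) :=
  (M.measurable_obsDens σ i).comp (hf.prodMk (hg.prodMk hk))

lemma lintegral_obsDens (i : ℕ) (x : X) (a : A) :
    ∫⁻ z, M.obsDens σ i x a z ∂M.vol = 1 := by
  unfold obsDens
  rw [lintegral_lintegral_swap]
  · simp [M.lintegral_obs σ i]
  · exact (M.measurable_obs_comp σ i measurable_snd measurable_fst).coe_nnreal_ennreal.aemeasurable

lemma obsLaw_eq (i : ℕ) (b : Measure X) (a : A) :
    M.obsLaw σ i b a = b.bind fun x => (M.pT (x, a)).bind (M.emission σ i) :=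
  Measure.bind_bind (M.measurable_pT_comp measurable_id' measurable_const).aemeasurable
    (M.measurable_emission σ i).aemeasurable

lemma measurable_pT_bind_emission (i : ℕ) {α : Type*} [MeasurableSpace α] {f : α → X} {g : α → A}
    (hf : Measurable f) (hg : Measurable g) :
    Measurable fun y => (M.pT (f y, g y)).bind (M.emission σ i) :=
  measurable_bind_param (M.measurable_pT_comp hf hg) (fun _ => prob_le_one)
    ((M.measurable_emission σ i).comp measurable_snd)

lemma obsLaw_univ (i : ℕ) (b : Measure X) (a : A) : M.obsLaw σ i b a Set.univ = b Set.univ := by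
  have h (x) : IsProbabilityMeasure ((M.pT (x, a)).bind (M.emission σ i)) :=
    isProbabilityMeasure_bind (M.measurable_emission σ i) fun _ => inferInstance
  rw [obsLaw_eq, Measure.bind_apply MeasurableSet.univ
    (M.measurable_pT_bind_emission σ i measurable_id' measurable_const).aemeasurable]
  simp

instance (i : ℕ) (b : Measure X) [IsProbabilityMeasure b] (a : A) :
    IsProbabilityMeasure (M.obsLaw σ i b a) :=
  ⟨by rw [obsLaw_univ, measure_univ]⟩

instance (i : ℕ) (b : Measure X) [IsFiniteMeasure b] (a : A) :
    IsFiniteMeasure (M.obsLaw σ i b a) :=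
  ⟨by rw [obsLaw_univ]; exact measure_lt_top _ _⟩

lemma measurable_obsLaw (i : ℕ) {α : Type*} [MeasurableSpace α] {b : α → Measure X} {a : α → A}
    (hb : Measurable b) (h1 : ∀ y, b y Set.univ ≤ 1) (ha : Measurable a) :
    Measurable fun y => M.obsLaw σ i (b y) (a y) := by
  simp_rw [obsLaw_eq]
  exact measurable_bind_param hb h1
    (M.measurable_pT_bind_emission σ i measurable_snd (ha.comp measurable_fst))

/-- Tonelli twice, over the propagated state and over the current one. It serves exact and particle
beliefs alike, which makes their observation laws comparable through densities. -/
lemma lintegral_obsLaw (i : ℕ) (b : Measure X) [SFinite b] (a : A) {F : Z → ℝ≥0∞}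
    (hF : Measurable F) :
    ∫⁻ z, F z ∂(M.obsLaw σ i b a) =
      ∫⁻ z, (∫⁻ x, M.obsDens σ i x a z ∂b) * F z ∂M.vol := by
  rw [obsLaw_eq, Measure.lintegral_bind
    (M.measurable_pT_bind_emission σ i measurable_id' measurable_const).aemeasurable
    hF.aemeasurable]
  have h (x) : ∫⁻ z, F z ∂((M.pT (x, a)).bind (M.emission σ i)) =
      ∫⁻ z, M.obsDens σ i x a z * F z ∂M.vol := by
    rw [Measure.lintegral_bind (M.measurable_emission σ i).aemeasurable hF.aemeasurable]
    simp_rw [M.lintegral_emission σ i _ hF]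
    rw [lintegral_lintegral_swap]
    · refine lintegral_congr fun z => ?_
      exact lintegral_mul_const _
        (M.measurable_obs_comp σ i measurable_id' measurable_const).coe_nnreal_ennreal
    · exact ((M.measurable_obs_comp σ i measurable_fst measurable_snd).coe_nnreal_ennreal.mul
        (hF.comp measurable_snd)).aemeasurable
  simp_rw [h]
  rw [lintegral_lintegral_swap]
  · refine lintegral_congr fun z => ?_
    exact lintegral_mul_const _
      (M.measurable_obsDens_comp σ i measurable_id' measurable_const measurable_const)
  · exact ((M.measurable_obsDens_comp σ i measurable_fst measurable_const measurable_snd).mul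
      (hF.comp measurable_snd)).aemeasurable

/-! ### The law of a particle -/

/-- One step of sequential importance sampling for a single particle. -/
def particleStep (i : ℕ) (a : A) (z : Z) (p : X × ℝ≥0) : Measure (X × ℝ≥0) :=
  (M.pT (p.1, a)).map (fun x => (x, p.2 * M.obs σ i x z))

lemma measurable_reweight (i : ℕ) (w : ℝ≥0) (z : Z) :
    Measurable fun x => (x, w * M.obs σ i x z) :=
  measurable_id'.prodMk
    (measurable_const.mul (M.measurable_obs_comp σ i measurable_id' measurable_const))

instance (i : ℕ) (a : A) (z : Z) (p : X × ℝ≥0) :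
    IsProbabilityMeasure (M.particleStep σ i a z p) :=
  Measure.isProbabilityMeasure_map (M.measurable_reweight σ i p.2 z).aemeasurable

lemma measurable_particleStep (i : ℕ) {α : Type*} [MeasurableSpace α] {a : α → A} {z : α → Z}
    {p : α → X × ℝ≥0} (ha : Measurable a) (hz : Measurable z) (hp : Measurable p) :
    Measurable fun y => M.particleStep σ i (a y) (z y) (p y) := by
  refine measurable_map_param (M.measurable_pT_comp hp.fst ha) (fun _ => prob_le_one) ?_
  exact measurable_snd.prodMk ((hp.snd.comp measurable_fst).mul
    (M.measurable_obs_comp σ i measurable_snd (hz.comp measurable_fst)))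

lemma lintegral_particleStep (i : ℕ) (a : A) (z : Z) (p : X × ℝ≥0) {F : X × ℝ≥0 → ℝ≥0∞}
    (hF : Measurable F) :
    ∫⁻ q, F q ∂(M.particleStep σ i a z p) =
      ∫⁻ x, F (x, p.2 * M.obs σ i x z) ∂(M.pT (p.1, a)) :=
  lintegral_map hF (M.measurable_reweight σ i p.2 z)

lemma particleLaw_push (t : ℕ) (h : Hist A Z t) (a : A) (z : Z) :
    M.particleLaw σ (t + 1) (h.push a z) =
      (M.particleLaw σ t h).bind (M.particleStep σ (t + 1) a z) := by
  simp only [particleLaw, Hist.init_push, Hist.push_last]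
  rfl

lemma isProbabilityMeasure_particleLaw (t : ℕ) (h : Hist A Z t) :
    IsProbabilityMeasure (M.particleLaw σ t h) := by
  induction t with
  | zero =>
    exact Measure.isProbabilityMeasure_map (measurable_id'.prodMk measurable_const).aemeasurable
  | succ t ih =>
    have := ih (Fin.init h)
    exact isProbabilityMeasure_bind
      (κ := M.particleStep σ (t + 1) (h (Fin.last t)).1 (h (Fin.last t)).2)
      (M.measurable_particleStep σ _ measurable_const measurable_const measurable_id')
      fun p => inferInstance

instance (t : ℕ) (h : Hist A Z t) : IsProbabilityMeasure (M.particleLaw σ t h) :=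
  M.isProbabilityMeasure_particleLaw σ t h

lemma measurable_particleLaw (t : ℕ) : Measurable (M.particleLaw σ t) := by
  induction t with
  | zero => exact measurable_const
  | succ t ih =>
    exact measurable_bind_param (μ := fun h : Hist A Z (t + 1) => M.particleLaw σ t (Fin.init h))
      (κ := fun h p => M.particleStep σ (t + 1) (h (Fin.last t)).1 (h (Fin.last t)).2 p)
      (ih.comp Hist.measurable_init) (fun _ => prob_le_one)
      (M.measurable_particleStep σ _ (a := fun y : Hist A Z (t + 1) × X × ℝ≥0 => (y.1 _).1)
        (z := fun y : Hist A Z (t + 1) × X × ℝ≥0 => (y.1 _).2)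
        (((measurable_pi_apply _).comp measurable_fst).fst)
        (((measurable_pi_apply _).comp measurable_fst).snd) measurable_snd)

/-- Both sides integrate the product of the likelihoods along a trajectory: the filter carries it as
a density, the particle as its second coordinate. `F` varies in the induction because a filter step
replaces it by the conditional expectation of likelihood times `F`. -/
lemma lintegral_joint (t : ℕ) (h : Hist A Z t) {F : X → ℝ≥0∞} (hF : Measurable F) :
    ∫⁻ x, F x ∂(M.joint σ t h) = ∫⁻ p, p.2 * F p.1 ∂(M.particleLaw σ t h) := by
  induction t generalizing F with
  | zero =>
    simp only [joint, particleLaw]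
    rw [lintegral_map (by fun_prop) (by fun_prop)]
    simp
  | succ t ih =>
    have hm : Measurable fun x => (M.obs σ (t + 1) x (h (Fin.last t)).2 : ℝ≥0∞) :=
      (M.measurable_obs_comp σ _ measurable_id' measurable_const).coe_nnreal_ennreal
    have hpT : Measurable fun x => M.pT (x, (h (Fin.last t)).1) :=
      M.measurable_pT_comp measurable_id' measurable_const
    have hmF := hm.mul hF
    rw [joint, lintegral_withDensity_eq_lintegral_mul _ hm hF,
      Measure.lintegral_bind hpT.aemeasurable hmF.aemeasurable,
      ih _ (measurable_lintegral_param hpT (fun _ => prob_le_one)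
        (f := fun _ x => ((fun x => (M.obs σ (t + 1) x (h (Fin.last t)).2 : ℝ≥0∞)) * F) x)
        (hmF.comp measurable_snd))]
    change _ = ∫⁻ p, _ ∂((M.particleLaw σ t (Fin.init h)).bind
      (M.particleStep σ (t + 1) (h (Fin.last t)).1 (h (Fin.last t)).2))
    rw [Measure.lintegral_bind (M.measurable_particleStep σ _ measurable_const measurable_const
      measurable_id').aemeasurable (by fun_prop)]
    refine lintegral_congr fun p => ?_
    rw [lintegral_particleStep _ _ _ _ _ _ (by fun_prop), ← lintegral_const_mul _ hmF]
    refine lintegral_congr fun x => ?_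
    simp [mul_assoc]

lemma evidence_eq (t : ℕ) (h : Hist A Z t) :
    M.evidence σ t h = ∫⁻ p, (p.2 : ℝ≥0∞) ∂(M.particleLaw σ t h) := by
  have := M.lintegral_joint σ t h (F := fun _ => 1) measurable_const
  simpa [evidence] using this

lemma measurable_evidence (t : ℕ) : Measurable (M.evidence σ t) := by
  have h := measurable_lintegral_param (M.measurable_particleLaw σ t) (fun _ => prob_le_one)
    (f := fun _ p => (p.2 : ℝ≥0∞)) (measurable_snd.snd.coe_nnreal_ennreal)
  exact (funext (M.evidence_eq σ t)) ▸ h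

lemma measurable_joint (t : ℕ) : Measurable (M.joint σ t) := by
  refine Measure.measurable_of_measurable_coe _ fun s hs => ?_
  have h (y) : M.joint σ t y s =
      ∫⁻ p, p.2 * s.indicator (fun _ => 1) p.1 ∂(M.particleLaw σ t y) := by
    rw [← M.lintegral_joint σ t y (measurable_const.indicator hs)]
    simp [lintegral_indicator hs]
  simp_rw [h]
  refine measurable_lintegral_param (M.measurable_particleLaw σ t) (fun _ => prob_le_one)
    (f := fun _ p => p.2 * s.indicator (fun _ => 1) p.1) ?_
  exact measurable_snd.snd.coe_nnreal_ennreal.mul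
    ((measurable_const.indicator hs).comp measurable_snd.fst)

lemma measurable_belief (t : ℕ) : Measurable (M.belief σ t) :=
  measurable_smul_measure (M.measurable_evidence σ t).inv (M.measurable_joint σ t)

lemma belief_univ_le (t : ℕ) (h : Hist A Z t) : M.belief σ t h Set.univ ≤ 1 :=
  ENNReal.inv_mul_le_one _

instance (t : ℕ) (h : Hist A Z t) : IsFiniteMeasure (M.belief σ t h) :=
  ⟨(M.belief_univ_le σ t h).trans_lt ENNReal.one_lt_top⟩

lemma lintegral_belief (t : ℕ) (h : Hist A Z t) {F : X → ℝ≥0∞} (hF : Measurable F) :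
    ∫⁻ x, F x ∂(M.belief σ t h) =
      (M.evidence σ t h)⁻¹ * ∫⁻ p, p.2 * F p.1 ∂(M.particleLaw σ t h) := by
  rw [belief, lintegral_smul_measure, M.lintegral_joint σ t h hF, smul_eq_mul]

/-- The history has positive and finite likelihood. -/
def Nondeg (t : ℕ) (h : Hist A Z t) : Prop :=
  M.evidence σ t h ≠ 0 ∧ M.evidence σ t h ≠ ⊤

lemma isProbabilityMeasure_belief {t : ℕ} {h : Hist A Z t} (hh : M.Nondeg σ t h) :
    IsProbabilityMeasure (M.belief σ t h) :=
  ⟨ENNReal.inv_mul_cancel hh.1 hh.2⟩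

/-- The propagated state is integrated out, leaving a mean over the current particle. This is why
the average in `ObsGood` has expectation one. -/
lemma evidence_push (t : ℕ) (h : Hist A Z t) (a : A) (z : Z) :
    M.evidence σ (t + 1) (h.push a z) =
      ∫⁻ p, p.2 * M.obsDens σ (t + 1) p.1 a z ∂(M.particleLaw σ t h) := by
  rw [evidence_eq, particleLaw_push, Measure.lintegral_bind
    (M.measurable_particleStep σ _ measurable_const measurable_const measurable_id').aemeasurable
    measurable_snd.coe_nnreal_ennreal.aemeasurable]
  refine lintegral_congr fun p => ?_
  rw [lintegral_particleStep _ _ _ _ _ _ measurable_snd.coe_nnreal_ennreal, obsDens,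
    ← lintegral_const_mul _
      (M.measurable_obs_comp σ _ measurable_id' measurable_const).coe_nnreal_ennreal]
  simp

lemma measurable_evidence_push (t : ℕ) (h : Hist A Z t) (a : A) :
    Measurable fun z => M.evidence σ (t + 1) (h.push a z) :=
  (M.measurable_evidence σ _).comp (Hist.measurable_push measurable_const measurable_const
    measurable_id')

/-- The exact predictive density appears as a ratio of consecutive evidences; the predictive density
of a particle belief is compared with this ratio. -/
lemma lintegral_obsLaw_belief (t : ℕ) (h : Hist A Z t) (a : A) {F : Z → ℝ≥0∞}
    (hF : Measurable F) :
    ∫⁻ z, F z ∂(M.obsLaw σ (t + 1) (M.belief σ t h) a) =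
      ∫⁻ z, (M.evidence σ t h)⁻¹ * M.evidence σ (t + 1) (h.push a z) * F z ∂M.vol := by
  rw [lintegral_obsLaw _ _ _ _ _ hF]
  refine lintegral_congr fun z => ?_
  rw [M.lintegral_belief σ t h
    (M.measurable_obsDens_comp σ _ measurable_id' measurable_const measurable_const),
    M.evidence_push σ t h a z]

lemma lintegral_evidence_push (t : ℕ) (h : Hist A Z t) (a : A) :
    ∫⁻ z, M.evidence σ (t + 1) (h.push a z) ∂M.vol = M.evidence σ t h := by
  simp_rw [evidence_push]
  have hm := M.measurable_obsDens σ (t + 1)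
  rw [lintegral_lintegral_swap]
  · rw [evidence_eq]
    refine lintegral_congr fun p => ?_
    rw [lintegral_const_mul _
      (M.measurable_obsDens_comp σ _ measurable_const measurable_const measurable_id'),
      M.lintegral_obsDens, mul_one]
  · exact (measurable_snd.snd.coe_nnreal_ennreal.mul (M.measurable_obsDens_comp σ _
      measurable_snd.fst measurable_const measurable_fst)).aemeasurable

/-- Observations of zero evidence have zero predictive density. Those of infinite evidence are
already null for the reference measure, since the evidence integrates to the finite evidence of `h`.
Inductions over time can thus stay among nondegenerate histories. -/
lemma ae_nondeg_push {t : ℕ} {h : Hist A Z t} (hh : M.Nondeg σ t h) (a : A) :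
    ∀ᵐ z ∂(M.obsLaw σ (t + 1) (M.belief σ t h) a), M.Nondeg σ (t + 1) (h.push a z) := by
  have hm := M.measurable_evidence_push σ t h a
  have hfin : ∀ᵐ z ∂M.vol, M.evidence σ (t + 1) (h.push a z) < ⊤ :=
    ae_lt_top hm (by rw [M.lintegral_evidence_push]; exact hh.2)
  set S : Set Z := {z | M.Nondeg σ (t + 1) (h.push a z)} with hS
  have hSm : MeasurableSet S :=
    (hm (measurableSet_singleton 0)).compl.inter (hm (measurableSet_singleton ⊤)).compl
  rw [ae_iff]
  change M.obsLaw σ (t + 1) (M.belief σ t h) a Sᶜ = 0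
  rw [← lintegral_indicator_one hSm.compl, M.lintegral_obsLaw_belief σ t h a
    (measurable_one.indicator hSm.compl)]
  refine lintegral_eq_zero_of_ae_eq_zero ?_
  filter_upwards [hfin] with z hz
  by_cases hz0 : M.evidence σ (t + 1) (h.push a z) = 0
  · simp [hz0]
  · have : z ∉ Sᶜ := fun hzS => hzS ⟨hz0, hz.ne⟩
    simp [this]

/-! ### The likelihood ratio bound -/

lemma LikelihoodRatioBound.weight_le {M : Model X A Z} {σ : ℕ → ObsChoice} {L : ℕ} {d : ℝ}
    (hM : M.LikelihoodRatioBound σ L d) {t : ℕ} (ht : t ≤ L) (h : Hist A Z t) :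
    ∀ᵐ p ∂(M.particleLaw σ t h), (p.2 : ℝ≥0∞) ≤ ENNReal.ofReal d * M.evidence σ t h :=
  hM t ht h

/-- The bound at time `t + 1`, along the history extended by `(a, z)`, is disintegrated over the
last step and then averaged over the propagated state. -/
lemma LikelihoodRatioBound.weight_mul_obsDens_le {M : Model X A Z} {σ : ℕ → ObsChoice} {L : ℕ}
    {d : ℝ} (hM : M.LikelihoodRatioBound σ L d) {t : ℕ} (ht : t + 1 ≤ L) (h : Hist A Z t) (a : A)
    (z : Z) :
    ∀ᵐ p ∂(M.particleLaw σ t h), (p.2 : ℝ≥0∞) * M.obsDens σ (t + 1) p.1 a z ≤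
      ENNReal.ofReal d * M.evidence σ (t + 1) (h.push a z) := by
  have h1 := hM (t + 1) ht (h.push a z)
  rw [particleLaw_push] at h1
  have h2 := Measure.ae_ae_of_ae_bind (M.measurable_particleStep σ _ measurable_const
    measurable_const measurable_id').aemeasurable h1
  filter_upwards [h2] with p hp
  have h3 := ae_of_ae_map (M.measurable_reweight σ (t + 1) p.2 z).aemeasurable hp
  rw [obsDens, ← lintegral_const_mul _
    (M.measurable_obs_comp σ _ measurable_id' measurable_const).coe_nnreal_ennreal]
  calc ∫⁻ x, (p.2 : ℝ≥0∞) * M.obs σ (t + 1) x z ∂(M.pT (p.1, a))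
      ≤ ∫⁻ _, ENNReal.ofReal d * M.evidence σ (t + 1) (h.push a z) ∂(M.pT (p.1, a)) := by
        refine lintegral_mono_ae (h3.mono fun x hx => ?_)
        simpa using hx
    _ = _ := by simp

end Model

end PBMDP

namespace PBMDP

/-! ### Particle beliefs -/

namespace PBelief

variable {X : Type*} {C : ℕ}

lemma sum_normWeight [NeZero C] (b : PBelief X C) : ∑ j, PBelief.normWeight b j = 1 := by
  unfold normWeight
  split_ifs with h
  · simp [NeZero.ne C]
  · rw [← Finset.sum_div, div_self h]

variable [MeasurableSpace X]

lemma measurable_totalWeight : Measurable fun b : PBelief X C => ∑ k, (b k).2 :=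
  Finset.measurable_sum _ fun k _ => (measurable_pi_apply k).snd

lemma measurable_normWeight (j : Fin C) :
    Measurable fun b : PBelief X C => PBelief.normWeight b j :=
  Measurable.ite (measurable_totalWeight (measurableSet_singleton 0)) measurable_const
    ((measurable_pi_apply j).snd.div measurable_totalWeight)

lemma lintegral_toMeasure (b : PBelief X C) {F : X → ℝ≥0∞} (hF : Measurable F) :
    ∫⁻ x, F x ∂(PBelief.toMeasure b) = ∑ j, PBelief.normWeight b j * F (b j).1 := by
  rw [toMeasure, lintegral_finsetSum_measure]
  refine Finset.sum_congr rfl fun j _ => ?_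
  rw [lintegral_smul_measure, lintegral_dirac' _ hF, smul_eq_mul]

lemma integral_toMeasure (b : PBelief X C) {f : X → ℝ} (hf : Measurable f) :
    ∫ x, f x ∂(PBelief.toMeasure b) = ∑ j, (PBelief.normWeight b j : ℝ) * f (b j).1 := by
  have hi (j : Fin C) : Integrable f
      ((PBelief.normWeight b j : ℝ≥0∞) • Measure.dirac (b j).1) :=
    (integrable_dirac' hf.stronglyMeasurable (by simp)).smul_measure ENNReal.coe_ne_top
  rw [toMeasure, integral_finsetSum_measure fun j _ => hi j]
  refine Finset.sum_congr rfl fun j _ => ?_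
  rw [integral_smul_measure, integral_dirac' _ _ hf.stronglyMeasurable]
  simp

lemma measurable_toMeasure : Measurable (PBelief.toMeasure : PBelief X C → Measure X) := by
  refine Measure.measurable_of_measurable_coe _ fun s hs => ?_
  have h (b : PBelief X C) : PBelief.toMeasure b s =
      ∑ j, PBelief.normWeight b j * s.indicator (fun _ => (1 : ℝ≥0∞)) (b j).1 := by
    rw [← lintegral_toMeasure b (measurable_const.indicator hs)]
    simp [lintegral_indicator hs]
  simp_rw [h]
  exact Finset.measurable_sum _ fun j _ => (measurable_normWeight j).coe_nnreal_ennreal.mul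
    ((measurable_const.indicator hs).comp (measurable_pi_apply j).fst)

instance [NeZero C] (b : PBelief X C) : IsProbabilityMeasure (PBelief.toMeasure b) := by
  constructor
  have := lintegral_toMeasure b (F := fun _ => 1) measurable_const
  rw [lintegral_one] at this
  rw [this]
  simp_rw [mul_one]
  exact_mod_cast sum_normWeight b

end PBelief

namespace Model

variable {X A Z : Type*} [MeasurableSpace X] [MeasurableSpace A] [MeasurableSpace Z]
  (M : Model X A Z) (σ : ℕ → ObsChoice) {C : ℕ}

/-- One step of sequential importance sampling for a particle belief. -/
def beliefStep (i : ℕ) (a : A) (z : Z) (b : PBelief X C) : Measure (PBelief X C) :=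
  Measure.pi fun j => M.particleStep σ i a z (b j)

instance (i : ℕ) (a : A) (z : Z) (b : PBelief X C) :
    IsProbabilityMeasure (M.beliefStep σ i a z b) := by
  unfold beliefStep; infer_instance

lemma measurable_beliefStep (i : ℕ) {α : Type*} [MeasurableSpace α] {a : α → A} {z : α → Z}
    {b : α → PBelief X C} (ha : Measurable a) (hz : Measurable z) (hb : Measurable b) :
    Measurable fun y => M.beliefStep σ i (a y) (z y) (b y) :=
  measurable_pi_param (fun j => M.measurable_particleStep σ i ha hz (measurable_pi_iff.mp hb j))
    fun _ _ => inferInstance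

instance (t : ℕ) (h : Hist A Z t) : IsProbabilityMeasure (M.sisLaw σ C t h) := by
  unfold sisLaw; infer_instance

lemma measurable_sisLaw (t : ℕ) : Measurable (M.sisLaw σ C t) :=
  measurable_pi_param (fun _ => M.measurable_particleLaw σ t) fun _ _ => inferInstance

/-- Given the observation each particle moves on its own, and without resampling nothing couples
them; so `pi_bind` applies. -/
lemma sisLaw_push (t : ℕ) (h : Hist A Z t) (a : A) (z : Z) :
    M.sisLaw σ C (t + 1) (h.push a z) =
      (M.sisLaw σ C t h).bind (M.beliefStep σ (t + 1) a z) := by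
  simp_rw [sisLaw, particleLaw_push]
  exact pi_bind (fun _ => M.measurable_particleStep σ _ measurable_const measurable_const
    measurable_id') fun _ _ => inferInstance

/-! ### The transition of the particle-belief MDP -/

lemma measurable_genPF_map (t : ℕ) :
    Measurable fun p : PBelief X C × Z × (Fin C → X) =>
      (p.2.1, fun j => (p.2.2 j, (p.1 j).2 * M.obs σ (t + 1) (p.2.2 j) p.2.1)) := by
  refine measurable_snd.fst.prodMk (measurable_pi_lambda _ fun j => ?_)
  have h : Measurable fun p : PBelief X C × Z × (Fin C → X) => p.2.2 j :=
    (measurable_pi_apply j).comp measurable_snd.snd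
  exact h.prodMk ((((measurable_pi_apply j).comp measurable_fst).snd).mul
    (M.measurable_obs_comp σ _ h measurable_snd.fst))

lemma genPF_map_fst (t : ℕ) (b : PBelief X C) (a : A) :
    (M.genPF σ t b a).map Prod.fst = M.obsLaw σ (t + 1) (PBelief.toMeasure b) a := by
  have hg := (M.measurable_genPF_map (C := C) σ t).comp (measurable_prodMk_left (x := b))
  refine (Measure.map_map measurable_fst hg).trans ?_
  change ((M.obsLaw σ (t + 1) (PBelief.toMeasure b) a).prod _).map Prod.fst = _
  exact measurePreserving_fst.map_eq

lemma lintegral_beliefStep_sisLaw (t : ℕ) (h : Hist A Z t) (a : A) (z : Z)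
    {F : PBelief X C → ℝ≥0∞} (hF : Measurable F) :
    ∫⁻ b, ∫⁻ b', F b' ∂(M.beliefStep σ (t + 1) a z b) ∂(M.sisLaw σ C t h) =
      ∫⁻ b', F b' ∂(M.sisLaw σ C (t + 1) (h.push a z)) := by
  rw [sisLaw_push, Measure.lintegral_bind
    (M.measurable_beliefStep σ _ measurable_const measurable_const measurable_id').aemeasurable
    hF.aemeasurable]

/-- The observation is independent of the propagated states and reweighting is deterministic. So,
given `z`, the new particles result from an ordinary sampling step with that `z`, although the law
of `z` depends on the particles. -/
lemma lintegral_genPF (t : ℕ) (b : PBelief X C) (a : A) {F : Z × PBelief X C → ℝ≥0∞}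
    (hF : Measurable F) :
    ∫⁻ q, F q ∂(M.genPF σ t b a) =
      ∫⁻ z, ∫⁻ b', F (z, b') ∂(M.beliefStep σ (t + 1) a z b)
        ∂(M.obsLaw σ (t + 1) (PBelief.toMeasure b) a) := by
  have hg : Measurable fun p : Z × (Fin C → X) =>
      (p.1, fun j => (p.2 j, (b j).2 * M.obs σ (t + 1) (p.2 j) p.1)) :=
    (M.measurable_genPF_map (C := C) σ t).comp (measurable_prodMk_left (x := b))
  rw [genPF, lintegral_map hF hg,
    lintegral_prod _ (show Measurable fun p => F _ from hF.comp hg).aemeasurable]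
  refine lintegral_congr fun z => ?_
  have hm (j : Fin C) : Measurable fun x => (x, (b j).2 * M.obs σ (t + 1) x z) :=
    M.measurable_reweight σ _ _ z
  simp only [beliefStep, particleStep]
  rw [← Measure.pi_map_pi fun j => (hm j).aemeasurable]
  exact (lintegral_map (show Measurable fun b' => F (z, b') from hF.comp measurable_prodMk_left)
      (measurable_pi_lambda _ fun j => (hm j).comp (measurable_pi_apply j))).symm

variable [NeZero C]

instance (t : ℕ) (b : PBelief X C) (a : A) : IsProbabilityMeasure (M.genPF σ t b a) :=
  Measure.isProbabilityMeasure_map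
    ((M.measurable_genPF_map σ t).comp measurable_prodMk_left).aemeasurable

lemma measurable_genPF (t : ℕ) {α : Type*} [MeasurableSpace α] {b : α → PBelief X C} {a : α → A}
    (hb : Measurable b) (ha : Measurable a) : Measurable fun y => M.genPF σ t (b y) (a y) := by
  have h1 : Measurable fun y => M.obsLaw σ (t + 1) (PBelief.toMeasure (b y)) (a y) :=
    M.measurable_obsLaw σ (t + 1) (PBelief.measurable_toMeasure.comp hb)
      (fun y => prob_le_one (μ := PBelief.toMeasure (b y))) ha
  have h2 : Measurable fun y => Measure.pi fun j => M.pT ((b y j).1, a y) :=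
    measurable_pi_param (fun j => M.measurable_pT_comp (measurable_pi_iff.mp hb j).fst ha)
      fun _ _ => inferInstance
  refine measurable_map_param (measurable_prod_param h1 h2 (fun _ => prob_le_one)
    fun _ => prob_le_one) (fun _ => prob_le_one) ?_
  exact (M.measurable_genPF_map σ t).comp
    ((hb.comp measurable_fst).prodMk (measurable_snd.fst.prodMk measurable_snd.snd))

/-- Where the total weight is at least half of its expectation, the generative transition is
dominated by `2 d` times a transition in which the observation has its exact law. -/
lemma lintegral_genPF_sisLaw_le {L : ℕ} {d : ℝ} (hM : M.LikelihoodRatioBound σ L d) {t : ℕ}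
    (ht : t + 1 ≤ L) {h : Hist A Z t} (hh : M.Nondeg σ t h) (a : A) {S : Set (PBelief X C)}
    (hSm : MeasurableSet S)
    (hS : ∀ b ∈ S, (C : ℝ≥0∞) * M.evidence σ t h ≤ 2 * ((∑ j, (b j).2 : ℝ≥0) : ℝ≥0∞))
    {F : Z × PBelief X C → ℝ≥0∞} (hF : Measurable F) :
    ∫⁻ b in S, ∫⁻ q, F q ∂(M.genPF σ t b a) ∂(M.sisLaw σ C t h) ≤
      2 * ENNReal.ofReal d * ∫⁻ z, ∫⁻ b', F (z, b') ∂(M.sisLaw σ C (t + 1) (h.push a z))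
        ∂(M.obsLaw σ (t + 1) (M.belief σ t h) a) := by
  have hC0 : (C : ℝ≥0∞) ≠ 0 := by exact_mod_cast NeZero.ne C
  have hCt : (C : ℝ≥0∞) ≠ ⊤ := ENNReal.natCast_ne_top C
  set I : PBelief X C → Z → ℝ≥0∞ := fun b z => ∫⁻ b', F (z, b') ∂(M.beliefStep σ (t + 1) a z b)
    with hI
  have hIm : Measurable (Function.uncurry I) :=
    measurable_lintegral_param (f := fun (p : PBelief X C × Z) b' => F (p.2, b'))
      (M.measurable_beliefStep σ _ measurable_const measurable_snd measurable_fst)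
      (fun _ => prob_le_one) (hF.comp (measurable_fst.snd.prodMk measurable_snd))
  set D : PBelief X C → Z → ℝ≥0∞ := fun b z =>
    ∑ j, (PBelief.normWeight b j : ℝ≥0∞) * M.obsDens σ (t + 1) (b j).1 a z with hD
  have hDm : Measurable (Function.uncurry D) := by
    refine Finset.measurable_sum _ fun j _ => ?_
    exact ((PBelief.measurable_normWeight j).comp measurable_fst).coe_nnreal_ennreal.mul
      (M.measurable_obsDens_comp σ _ ((measurable_pi_apply j).comp measurable_fst).fst
        measurable_const measurable_snd)
  have h1 (b : PBelief X C) : ∫⁻ q, F q ∂(M.genPF σ t b a) = ∫⁻ z, D b z * I b z ∂M.vol := by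
    rw [M.lintegral_genPF σ t b a hF, M.lintegral_obsLaw σ _ _ _
      (show Measurable (I b) from hIm.comp measurable_prodMk_left)]
    refine lintegral_congr fun z => ?_
    rw [PBelief.lintegral_toMeasure b
      (M.measurable_obsDens_comp σ _ measurable_id' measurable_const measurable_const)]
  -- The change of measure: each of the `C` numerators is at most `d` times the new evidence, and on
  -- `S` the total weight is at least `C / 2` times the old one.
  have h2 (z : Z) : ∀ᵐ b ∂(M.sisLaw σ C t h), b ∈ S →
      D b z ≤ 2 * ENNReal.ofReal d *
        ((M.evidence σ t h)⁻¹ * M.evidence σ (t + 1) (h.push a z)) := by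
    have h3 : ∀ᵐ b ∂(M.sisLaw σ C t h), ∀ j, ((b j).2 : ℝ≥0∞) *
        M.obsDens σ (t + 1) (b j).1 a z ≤
          ENNReal.ofReal d * M.evidence σ (t + 1) (h.push a z) := by
      rw [ae_all_iff]
      intro j
      exact (measurePreserving_eval (fun _ : Fin C => M.particleLaw σ t h)
        j).quasiMeasurePreserving.ae (hM.weight_mul_obsDens_le ht h a z)
    filter_upwards [h3] with b hb hbS
    have hw := hS b hbS
    set w : ℝ≥0 := ∑ j, (b j).2 with hwdef
    have hw0 : w ≠ 0 := by
      rintro h0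
      rw [h0] at hw
      simp [hC0, hh.1] at hw
    have hw0' : (w : ℝ≥0∞) ≠ 0 := by exact_mod_cast hw0
    have hinv : (w : ℝ≥0∞)⁻¹ ≤ 2 * ((C : ℝ≥0∞)⁻¹ * (M.evidence σ t h)⁻¹) := by
      rw [← ENNReal.mul_inv (Or.inl hC0) (Or.inl hCt), ENNReal.inv_le_iff_inv_le,
        ENNReal.mul_inv (by simp) (by simp), inv_inv]
      calc _ ≤ (2 : ℝ≥0∞)⁻¹ * (2 * w) := by gcongr
        _ = w := by rw [← mul_assoc, ENNReal.inv_mul_cancel (by simp) (by simp), one_mul]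
    calc D b z = ∑ j, (w : ℝ≥0∞)⁻¹ * (((b j).2 : ℝ≥0∞) * M.obsDens σ (t + 1) (b j).1 a z) := by
          refine Finset.sum_congr rfl fun j _ => ?_
          rw [PBelief.normWeight, if_neg hw0, ENNReal.coe_div hw0, ENNReal.div_eq_inv_mul,
            mul_assoc]
      _ ≤ ∑ _j : Fin C, (2 * ((C : ℝ≥0∞)⁻¹ * (M.evidence σ t h)⁻¹)) *
            (ENNReal.ofReal d * M.evidence σ (t + 1) (h.push a z)) := by
          exact Finset.sum_le_sum fun j _ => mul_le_mul' hinv (hb j)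
      _ = (C * (C : ℝ≥0∞)⁻¹) * (2 * ENNReal.ofReal d *
            ((M.evidence σ t h)⁻¹ * M.evidence σ (t + 1) (h.push a z))) := by
          rw [Finset.sum_const, Finset.card_univ, Fintype.card_fin, nsmul_eq_mul]
          ring
      _ = _ := by rw [ENNReal.mul_inv_cancel hC0 hCt, one_mul]
  have hJm : Measurable fun z => ∫⁻ b', F (z, b') ∂(M.sisLaw σ C (t + 1) (h.push a z)) :=
    measurable_lintegral_param (μ := fun z => M.sisLaw σ C (t + 1) (h.push a z))
      (f := fun z b' => F (z, b')) ((M.measurable_sisLaw σ _).comp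
      (Hist.measurable_push measurable_const measurable_const measurable_id'))
      (fun _ => prob_le_one) hF
  simp_rw [h1]
  -- With the observation fixed, the integral over the particles comes first. Once the density is
  -- bounded by a constant in `b`, the restriction to `S` can be dropped, and what remains is one
  -- sampling step from `sisLaw`.
  rw [lintegral_lintegral_swap (hDm.mul hIm).aemeasurable, M.lintegral_obsLaw_belief σ t h a hJm,
    ← lintegral_const_mul _ (show Measurable fun z => (M.evidence σ t h)⁻¹ *
      M.evidence σ (t + 1) (h.push a z) * _ from
        ((M.measurable_evidence_push σ t h a).const_mul _).mul hJm)]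
  refine lintegral_mono fun z => ?_
  calc ∫⁻ b in S, D b z * I b z ∂(M.sisLaw σ C t h)
      ≤ ∫⁻ b in S, 2 * ENNReal.ofReal d *
        ((M.evidence σ t h)⁻¹ * M.evidence σ (t + 1) (h.push a z)) * I b z
          ∂(M.sisLaw σ C t h) := by
        refine setLIntegral_mono_ae' hSm ?_
        filter_upwards [h2 z] with b hb hbS
        gcongr
        exact hb hbS
    _ ≤ ∫⁻ b, 2 * ENNReal.ofReal d *
        ((M.evidence σ t h)⁻¹ * M.evidence σ (t + 1) (h.push a z)) * I b z
          ∂(M.sisLaw σ C t h) := setLIntegral_le_lintegral _ _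
    _ = _ := by
        rw [lintegral_const_mul _
            (show Measurable fun b => I b z from hIm.comp measurable_prodMk_right),
          hI,
          M.lintegral_beliefStep_sisLaw σ t h a z
            (show Measurable fun b' => F (z, b') from hF.comp measurable_prodMk_left)]
        simp only [mul_assoc]

end Model

end PBMDP

namespace PBMDP

/-! ### Bounded integrands, and bounds for the action values. -/

lemma abs_integral_le_of_abs_le {α : Type*} [MeasurableSpace α] {μ : Measure α}
    (hμ : μ Set.univ ≤ 1) {f : α → ℝ} {W : ℝ} (hW : 0 ≤ W) (hf : ∀ x, |f x| ≤ W) :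
    |∫ x, f x ∂μ| ≤ W := by
  have hfin : IsFiniteMeasure μ := ⟨hμ.trans_lt ENNReal.one_lt_top⟩
  refine (norm_integral_le_of_norm_le_const (μ := μ) (f := f) (C := W)
    (Eventually.of_forall hf)).trans ?_
  refine mul_le_of_le_one_right hW ?_
  exact ENNReal.toReal_le_of_le_ofReal zero_le_one (by simpa using hμ)

lemma integrable_of_abs_le {α : Type*} [MeasurableSpace α] {μ : Measure α} [IsFiniteMeasure μ]
    {f : α → ℝ} (hm : Measurable f) {W : ℝ} (hf : ∀ x, |f x| ≤ W) : Integrable f μ :=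
  Integrable.of_bound hm.aestronglyMeasurable W (Eventually.of_forall hf)

/-- Shifting `f` by `W` gives a function with values in `[0, 2W]`, against which the domination can
be integrated. What it misses is a fraction `c` of the mass on `S` and the mass outside `S`, each at
a price of at most `2W`. -/
lemma integral_le_add_of_smul_restrict_le {α : Type*} [MeasurableSpace α] {μ ν : Measure α}
    [IsProbabilityMeasure μ] [IsProbabilityMeasure ν] {S : Set α} (hSm : MeasurableSet S) {c : ℝ}
    (hc0 : 0 ≤ c) (hc1 : c ≤ 1) (hS : ENNReal.ofReal (1 - c) • μ.restrict S ≤ ν) {f : α → ℝ}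
    (hm : Measurable f) {W : ℝ} (hf : ∀ x, |f x| ≤ W) :
    ∫ x, f x ∂μ ≤ ∫ x, f x ∂ν + 2 * W * (c + μ.real Sᶜ) := by
  set g : α → ℝ := fun x => f x + W with hg
  have hgm : Measurable g := hm.add_const W
  have hg0 : ∀ x, 0 ≤ g x := fun x => by have := (abs_le.mp (hf x)).1; simp only [hg]; linarith
  have hg2 : ∀ x, g x ≤ 2 * W := fun x => by
    have := (abs_le.mp (hf x)).2; simp only [hg]; linarith
  have hgabs : ∀ x, |g x| ≤ 2 * W := fun x => by rw [abs_of_nonneg (hg0 x)]; exact hg2 x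
  have h1 : ∫ x, g x ∂(ENNReal.ofReal (1 - c) • μ.restrict S) ≤ ∫ x, g x ∂ν :=
    integral_mono_measure hS (Eventually.of_forall hg0) (integrable_of_abs_le hgm hgabs)
  rw [integral_smul_measure, ENNReal.toReal_ofReal (by linarith), smul_eq_mul] at h1
  have h2 : ∫ x, g x ∂μ = ∫ x in S, g x ∂μ + ∫ x in Sᶜ, g x ∂μ :=
    (integral_add_compl hSm (integrable_of_abs_le hgm hgabs)).symm
  have h3 : ∫ x in Sᶜ, g x ∂μ ≤ 2 * W * μ.real Sᶜ := by
    have h := norm_setIntegral_le_of_norm_le_const (μ := μ) (s := Sᶜ) (f := g) (C := 2 * W)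
      (measure_lt_top _ _) (fun x _ => hgabs x)
    exact (le_abs_self _).trans h
  have h4 : ∫ x in S, g x ∂μ ≤ 2 * W := by
    refine (le_abs_self _).trans (abs_integral_le_of_abs_le ?_ ?_ hgabs)
    · rw [Measure.restrict_apply_univ]; exact prob_le_one
    · obtain ⟨x⟩ : Nonempty α := μ.nonempty_of_neZero
      exact (hg0 x).trans (hg2 x)
  have h5 : ∫ x, g x ∂μ = ∫ x, f x ∂μ + W := by
    rw [integral_add (integrable_of_abs_le hm hf) (integrable_const _)]; simp
  have h6 : ∫ x, g x ∂ν = ∫ x, f x ∂ν + W := by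
    rw [integral_add (integrable_of_abs_le hm hf) (integrable_const _)]; simp
  nlinarith [mul_le_mul_of_nonneg_left h4 hc0]

/-- If `ν` dominates `(1 - c) μ` on `S`, then the expectations of a bounded function under `μ` and
`ν` are close. -/
lemma abs_integral_sub_le_of_smul_restrict_le {α : Type*} [MeasurableSpace α] {μ ν : Measure α}
    [IsProbabilityMeasure μ] [IsProbabilityMeasure ν] {S : Set α} (hSm : MeasurableSet S) {c : ℝ}
    (hc0 : 0 ≤ c) (hc1 : c ≤ 1) (hS : ENNReal.ofReal (1 - c) • μ.restrict S ≤ ν) {f : α → ℝ}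
    (hm : Measurable f) {W : ℝ} (hf : ∀ x, |f x| ≤ W) :
    |∫ x, f x ∂μ - ∫ x, f x ∂ν| ≤ 2 * W * (c + μ.real Sᶜ) := by
  have h1 := integral_le_add_of_smul_restrict_le hSm hc0 hc1 hS hm hf
  have h2 := integral_le_add_of_smul_restrict_le hSm hc0 hc1 hS hm.neg (W := W)
    (fun x => by simpa using hf x)
  simp only [Pi.neg_apply, integral_neg] at h2
  rw [abs_le]
  constructor <;> linarith

namespace Model

variable {X A Z : Type*} [MeasurableSpace X] [MeasurableSpace A] [MeasurableSpace Z]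
  (M : Model X A Z) (σ : ℕ → ObsChoice)

/-! ### Measurability and boundedness of the action values -/

lemma measurable_pomdpQAux (γ : ℝ) (π : Policy A Z) (n t : ℕ) :
    Measurable fun p : Hist A Z t × A => M.pomdpQAux σ γ π n t p.1 p.2 := by
  have h0 (t : ℕ) : Measurable fun p : Hist A Z t × A => ∫ x, M.r t x p.2 ∂(M.belief σ t p.1) :=
    measurable_integral_param ((M.measurable_belief σ t).comp measurable_fst)
      (fun p => M.belief_univ_le σ t p.1)
      (f := fun p x => M.r t x p.2)
      ((M.measurable_r t).comp (measurable_snd.prodMk measurable_fst.snd))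
  induction n generalizing t with
  | zero => exact h0 t
  | succ n ih =>
    have hpush : Measurable fun q : (Hist A Z t × A) × Z => q.1.1.push q.1.2 q.2 :=
      Hist.measurable_push measurable_fst.fst measurable_fst.snd measurable_snd
    refine (h0 t).add (Measurable.const_mul ?_ γ)
    refine measurable_integral_param
      (M.measurable_obsLaw σ (t + 1) ((M.measurable_belief σ t).comp measurable_fst)
        (fun p => M.belief_univ_le σ t p.1) measurable_snd)
      (fun p => by rw [obsLaw_univ]; exact M.belief_univ_le σ t p.1)
      (f := fun (p : Hist A Z t × A) z => M.pomdpQAux σ γ π n (t + 1) (p.1.push p.2 z)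
        (π.act (t + 1) (p.1.push p.2 z))) ?_
    exact (ih (t + 1)).comp (hpush.prodMk ((π.measurable_act _).comp hpush))

/-- A crude count of `n + 1` rewards with `γ ≤ 1` is enough: the argument only needs a range that is
fixed before the model. -/
lemma abs_pomdpQAux_le {γ : ℝ} (hγ0 : 0 ≤ γ) (hγ1 : γ ≤ 1) {L : ℕ} {R : ℝ} (hR : 0 ≤ R)
    (hr : ∀ i ≤ L, ∀ x a, |M.r i x a| ≤ R) (π : Policy A Z) (n t : ℕ) (htn : t + n ≤ L)
    (h : Hist A Z t) (a : A) : |M.pomdpQAux σ γ π n t h a| ≤ (n + 1) * R := by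
  induction n generalizing t a with
  | zero =>
    simpa [pomdpQAux] using
      abs_integral_le_of_abs_le (M.belief_univ_le σ t h) hR fun x => hr t (by omega) x a
  | succ n ih =>
    rw [pomdpQAux]
    have h1 := abs_integral_le_of_abs_le (M.belief_univ_le σ t h) hR
      fun x => hr t (by omega) x a
    have hn : 0 ≤ ((n : ℝ) + 1) * R := by positivity
    have h2 := abs_integral_le_of_abs_le
      (μ := M.obsLaw σ (t + 1) (M.belief σ t h) a)
      (by rw [obsLaw_univ]; exact M.belief_univ_le σ t h) hn
      fun z => ih (t + 1) (by omega) (h.push a z) (π.act (t + 1) (h.push a z))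
    refine (abs_add_le _ _).trans ?_
    rw [abs_mul, abs_of_nonneg hγ0]
    push_cast
    nlinarith [mul_le_mul hγ1 h2 (abs_nonneg _) zero_le_one]

variable {C : ℕ} [NeZero C]

lemma measurable_pbmdpQAux (γ : ℝ) {rr : ℕ → X → A → ℝ}
    (hrr : ∀ i, Measurable fun p : X × A => rr i p.1 p.2) (π : Policy A Z) (n t : ℕ) :
    Measurable fun p : Hist A Z t × PBelief X C × A =>
      M.pbmdpQAux σ γ rr π n t p.1 p.2.1 p.2.2 := by
  have h0 (t : ℕ) : Measurable fun p : Hist A Z t × PBelief X C × A =>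
      ∫ x, rr t x p.2.2 ∂(PBelief.toMeasure p.2.1) :=
    measurable_integral_param (PBelief.measurable_toMeasure.comp measurable_snd.fst)
      (fun p => prob_le_one (μ := PBelief.toMeasure p.2.1))
      (f := fun (p : Hist A Z t × PBelief X C × A) x => rr t x p.2.2)
      ((hrr t).comp (measurable_snd.prodMk measurable_fst.snd.snd))
  induction n generalizing t with
  | zero => exact h0 t
  | succ n ih =>
    have hpush : Measurable fun q : (Hist A Z t × PBelief X C × A) × Z × PBelief X C =>
        q.1.1.push q.1.2.2 q.2.1 :=
      Hist.measurable_push measurable_fst.fst measurable_fst.snd.snd measurable_snd.fst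
    refine (h0 t).add (Measurable.const_mul ?_ γ)
    refine measurable_integral_param
      (M.measurable_genPF σ t measurable_snd.fst measurable_snd.snd) (fun p => prob_le_one)
      (f := fun (p : Hist A Z t × PBelief X C × A) (q : Z × PBelief X C) =>
        M.pbmdpQAux σ γ rr π n (t + 1) (p.1.push p.2.2 q.1) q.2
          (π.act (t + 1) (p.1.push p.2.2 q.1))) ?_
    exact (ih (t + 1)).comp (hpush.prodMk (measurable_snd.snd.prodMk
      ((π.measurable_act _).comp hpush)))

lemma abs_pbmdpQAux_le {γ : ℝ} (hγ0 : 0 ≤ γ) (hγ1 : γ ≤ 1) {L : ℕ} {R : ℝ} (hR : 0 ≤ R)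
    {rr : ℕ → X → A → ℝ} (hr : ∀ i ≤ L, ∀ x a, |rr i x a| ≤ R) (π : Policy A Z) (n t : ℕ)
    (htn : t + n ≤ L) (h : Hist A Z t) (b : PBelief X C) (a : A) :
    |M.pbmdpQAux σ γ rr π n t h b a| ≤ (n + 1) * R := by
  have h1 (t : ℕ) (ht : t ≤ L) (b : PBelief X C) (a : A) :
      |∫ x, rr t x a ∂(PBelief.toMeasure b)| ≤ R :=
    abs_integral_le_of_abs_le prob_le_one hR fun x => hr t ht x a
  induction n generalizing t b a with
  | zero => simpa [pbmdpQAux] using h1 t (by omega) b a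
  | succ n ih =>
    rw [pbmdpQAux]
    have h1 := h1 t (by omega) b a
    have hn : 0 ≤ ((n : ℝ) + 1) * R := by positivity
    have h2 := abs_integral_le_of_abs_le (μ := M.genPF σ t b a) prob_le_one hn
      fun q => ih (t + 1) (by omega) (h.push a q.1) q.2 (π.act (t + 1) (h.push a q.1))
    refine (abs_add_le _ _).trans ?_
    rw [abs_mul, abs_of_nonneg hγ0]
    push_cast
    nlinarith [mul_le_mul hγ1 h2 (abs_nonneg _) zero_le_one]

end Model

end PBMDP

namespace PBMDP

namespace Model

variable {X A Z : Type*} [MeasurableSpace X] [MeasurableSpace A] [MeasurableSpace Z]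
  (M : Model X A Z) (σ : ℕ → ObsChoice) {C : ℕ}

lemma measurableSet_nondeg (t : ℕ) : MeasurableSet {h : Hist A Z t | M.Nondeg σ t h} :=
  ((M.measurable_evidence σ t) (measurableSet_singleton 0)).compl.inter
    ((M.measurable_evidence σ t) (measurableSet_singleton ⊤)).compl

/-! ### Concentration events -/

/-- The normalized total weight of the particles is within `η` of its expectation `1`. -/
def WeightGood (η : ℝ) (t : ℕ) (h : Hist A Z t) (b : PBelief X C) : Prop :=
  M.Nondeg σ t h ∧ |∑ j, ((b j).2 : ℝ) / (M.evidence σ t h).toReal - C * 1| ≤ η * C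

/-- The weighted mean reward of the particles is within `η` of the reward of the belief. -/
def RewardGood (η : ℝ) (t : ℕ) (h : Hist A Z t) (b : PBelief X C) (a : A) : Prop :=
  |∑ j, ((b j).2 : ℝ) / (M.evidence σ t h).toReal * M.r t (b j).1 a -
    C * ∫ x, M.r t x a ∂(M.belief σ t h)| ≤ η * C

/-- The weighted mean density of the observation `z`, normalized by its exact density, is within
`η` of its expectation `1`. -/
def ObsGood (η : ℝ) (t : ℕ) (h : Hist A Z t) (b : PBelief X C) (a : A) (z : Z) : Prop :=
  M.Nondeg σ (t + 1) (h.push a z) ∧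
    |∑ j, (((b j).2 : ℝ≥0∞) * M.obsDens σ (t + 1) (b j).1 a z /
      M.evidence σ (t + 1) (h.push a z)).toReal - C * 1| ≤ η * C

lemma measurableSet_weightGood (η : ℝ) (t : ℕ) :
    MeasurableSet {p : Hist A Z t × PBelief X C | M.WeightGood σ η t p.1 p.2} := by
  refine MeasurableSet.inter (s₂ := {p : Hist A Z t × PBelief X C |
    |∑ j, ((p.2 j).2 : ℝ) / (M.evidence σ t p.1).toReal - C * 1| ≤ η * C})
    (measurable_fst (M.measurableSet_nondeg σ t)) ?_
  refine measurableSet_le (Measurable.abs ?_) measurable_const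
  refine Measurable.sub_const (Finset.measurable_sum _ fun j _ => ?_) _
  exact (((measurable_pi_apply j).comp measurable_snd).snd.coe_nnreal_real).div
    ((M.measurable_evidence σ t).comp measurable_fst).ennreal_toReal

lemma measurableSet_rewardGood (η : ℝ) (t : ℕ) :
    MeasurableSet {p : Hist A Z t × PBelief X C × A | M.RewardGood σ η t p.1 p.2.1 p.2.2} := by
  refine measurableSet_le (Measurable.abs (Measurable.sub (Finset.measurable_sum _ fun j _ => ?_)
    (Measurable.const_mul ?_ _))) measurable_const
  · have hj : Measurable fun p : Hist A Z t × PBelief X C × A => p.2.1 j :=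
      (measurable_pi_apply j).comp measurable_snd.fst
    exact ((hj.snd.coe_nnreal_real).div
      ((M.measurable_evidence σ t).comp measurable_fst).ennreal_toReal).mul
        ((M.measurable_r t).comp (hj.fst.prodMk measurable_snd.snd))
  · exact measurable_integral_param ((M.measurable_belief σ t).comp measurable_fst)
      (fun p => M.belief_univ_le σ t p.1)
      (f := fun (p : Hist A Z t × PBelief X C × A) x => M.r t x p.2.2)
      ((M.measurable_r t).comp (measurable_snd.prodMk measurable_fst.snd.snd))

lemma measurableSet_obsGood (η : ℝ) (t : ℕ) :
    MeasurableSet {p : (Hist A Z t × PBelief X C × A) × Z |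
      M.ObsGood σ η t p.1.1 p.1.2.1 p.1.2.2 p.2} := by
  have hpush : Measurable fun p : (Hist A Z t × PBelief X C × A) × Z =>
      p.1.1.push p.1.2.2 p.2 :=
    Hist.measurable_push measurable_fst.fst measurable_fst.snd.snd measurable_snd
  refine MeasurableSet.inter (s₂ := {p : (Hist A Z t × PBelief X C × A) × Z |
    |∑ j, (((p.1.2.1 j).2 : ℝ≥0∞) * M.obsDens σ (t + 1) (p.1.2.1 j).1 p.1.2.2 p.2 /
      M.evidence σ (t + 1) (p.1.1.push p.1.2.2 p.2)).toReal - C * 1| ≤ η * C})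
    (hpush (M.measurableSet_nondeg σ (t + 1))) ?_
  refine measurableSet_le (Measurable.abs ?_) measurable_const
  refine Measurable.sub_const (Finset.measurable_sum _ fun j _ => ?_) _
  have hj : Measurable fun p : (Hist A Z t × PBelief X C × A) × Z => p.1.2.1 j :=
    (measurable_pi_apply j).comp measurable_fst.snd.fst
  exact ((hj.snd.coe_nnreal_ennreal.mul (M.measurable_obsDens_comp σ (t + 1) hj.fst
    measurable_fst.snd.snd measurable_snd)).div
      ((M.measurable_evidence σ _).comp hpush)).ennreal_toReal

lemma measurableSet_obsGood_right (η : ℝ) (t : ℕ) (h : Hist A Z t) (b : PBelief X C) (a : A) :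
    MeasurableSet {z | M.ObsGood σ η t h b a z} :=
  (measurable_prodMk_left (x := (h, b, a))) (M.measurableSet_obsGood σ η t)

variable {M σ} in
lemma WeightGood.bounds {η : ℝ} {t : ℕ} {h : Hist A Z t} {b : PBelief X C}
    (hg : M.WeightGood σ η t h b) :
    (1 - η) * C * (M.evidence σ t h).toReal ≤ ((∑ j, (b j).2 : ℝ≥0) : ℝ) ∧
      ((∑ j, (b j).2 : ℝ≥0) : ℝ) ≤ (1 + η) * C * (M.evidence σ t h).toReal := by
  have hpos : 0 < (M.evidence σ t h).toReal := ENNReal.toReal_pos hg.1.1 hg.1.2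
  have h2 := abs_le.mp hg.2
  rw [← Finset.sum_div] at h2
  push_cast
  constructor
  · rw [← le_div_iff₀ hpos]; linarith [h2.1]
  · rw [← div_le_iff₀ hpos]; linarith [h2.2]

variable {M σ} in
-- Supplies the hypothesis of the change of measure `lintegral_genPF_sisLaw_le`: a deviation of at
-- most one half leaves at least half of the expected weight.
lemma WeightGood.le_two_mul {η : ℝ} (hη : η ≤ 1 / 2) {t : ℕ} {h : Hist A Z t}
    {b : PBelief X C} (hg : M.WeightGood σ η t h b) :
    (C : ℝ≥0∞) * M.evidence σ t h ≤ 2 * ((∑ j, (b j).2 : ℝ≥0) : ℝ≥0∞) := by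
  have h1 := hg.bounds.1
  have h2 : (0 : ℝ) ≤ C * (M.evidence σ t h).toReal := by positivity
  rw [← ENNReal.toReal_le_toReal (ENNReal.mul_ne_top (by simp) hg.1.2)
    (ENNReal.mul_ne_top (by simp) (by simp))]
  simp only [ENNReal.toReal_mul, ENNReal.toReal_natCast, ENNReal.toReal_ofNat,
    ENNReal.coe_toReal]
  nlinarith

variable [NeZero C]

variable {M σ} in
-- The particle reward is a self-normalized ratio `V / U`. With exact mean `m` one has `m - V / U =
-- (m (U - C) - (V - C m)) / U`; both deviations are controlled and `U ≥ C / 2`.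
lemma WeightGood.abs_reward_sub_le {η : ℝ} (hη : η ≤ 1 / 2) {R : ℝ} {t : ℕ}
    (hr : ∀ x a, |M.r t x a| ≤ R) (hR : 0 ≤ R) {h : Hist A Z t}
    {b : PBelief X C} (hg : M.WeightGood σ η t h b) {a : A} (hr' : M.RewardGood σ η t h b a) :
    |∫ x, M.r t x a ∂(M.belief σ t h) - ∫ x, M.r t x a ∂(PBelief.toMeasure b)| ≤
      2 * η * (1 + R) := by
  have hC : (0 : ℝ) < C := by exact_mod_cast Nat.pos_of_ne_zero (NeZero.ne C)
  have hpos : 0 < (M.evidence σ t h).toReal := ENNReal.toReal_pos hg.1.1 hg.1.2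
  have hm := abs_integral_le_of_abs_le (M.belief_univ_le σ t h) hR fun x => hr x a
  have hw := hg.2
  set e := (M.evidence σ t h).toReal with he
  set m := ∫ x, M.r t x a ∂(M.belief σ t h) with hmdef
  set U : ℝ := ∑ j, ((b j).2 : ℝ) / e with hU
  unfold RewardGood at hr'
  rw [← he, ← hmdef] at hr'
  set V : ℝ := ∑ j, ((b j).2 : ℝ) / e * M.r t (b j).1 a with hV
  have hU' : (C : ℝ) / 2 ≤ U := by
    have := (abs_le.mp hw).1
    nlinarith
  have hU0 : 0 < U := by linarith
  have hw0 : ∑ k, (b k).2 ≠ 0 := by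
    intro h0
    have : U = ((∑ k, (b k).2 : ℝ≥0) : ℝ) / e := by rw [hU, ← Finset.sum_div]; push_cast; rfl
    rw [this, h0] at hU0
    simp at hU0
  have hint : ∫ x, M.r t x a ∂(PBelief.toMeasure b) = V / U := by
    have hrm : Measurable fun x => M.r t x a :=
      (M.measurable_r t).comp (measurable_id'.prodMk measurable_const)
    rw [PBelief.integral_toMeasure b hrm, hV, Finset.sum_div]
    refine Finset.sum_congr rfl fun j _ => ?_
    rw [PBelief.normWeight, if_neg hw0, hU, ← Finset.sum_div]
    push_cast
    have : (∑ k, ((b k).2 : ℝ)) ≠ 0 := by exact_mod_cast hw0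
    field_simp
  rw [hint, show m - V / U = (m * U - V) / U by field_simp, abs_div, abs_of_pos hU0,
    div_le_iff₀ hU0]
  have h1 : |m * U - V| ≤ η * C + R * (η * C) := by
    have : m * U - V = m * (U - C * 1) - (V - C * m) := by ring
    rw [this]
    refine (abs_sub _ _).trans ?_
    rw [abs_mul]
    linarith [mul_le_mul hm hw (abs_nonneg _) hR]
  have hη0 : 0 ≤ η := by
    have := (abs_nonneg _).trans hw
    by_contra hneg
    nlinarith
  nlinarith [mul_nonneg hη0 (by linarith : (0 : ℝ) ≤ 1 + R)]

variable {M σ} in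
-- A comparison of densities: at a good observation the numerator is at least `(1 - η) C` times the
-- new evidence, the total weight is at most `(1 + η) C` times the old one, and `(1 - 2η)(1 + η) ≤ 1
-- - η`. One-sided domination suffices, as both laws are probabilities.
lemma WeightGood.smul_obsLaw_le {η : ℝ} (hη : η ≤ 1 / 2) {t : ℕ} {h : Hist A Z t}
    {b : PBelief X C} (hg : M.WeightGood σ η t h b) (a : A) :
    ENNReal.ofReal (1 - 2 * η) • (M.obsLaw σ (t + 1) (M.belief σ t h) a).restrict
        {z | M.ObsGood σ η t h b a z} ≤
      M.obsLaw σ (t + 1) (PBelief.toMeasure b) a := by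
  have hC : (0 : ℝ) < C := by exact_mod_cast Nat.pos_of_ne_zero (NeZero.ne C)
  have hSm := M.measurableSet_obsGood_right σ η t h b a
  set S := {z | M.ObsGood σ η t h b a z} with hS
  have hη0 : 0 ≤ η := by
    have := (abs_nonneg _).trans hg.2
    by_contra hneg
    nlinarith
  have he0 := hg.1.1
  have het := hg.1.2
  set e := M.evidence σ t h with hedef
  have hpos : 0 < e.toReal := ENNReal.toReal_pos he0 het
  have hb := hg.bounds
  set w : ℝ≥0 := ∑ k, (b k).2 with hw
  have hw0 : w ≠ 0 := by
    rintro h0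
    rw [h0] at hb
    have : 0 < (1 - η) * C * e.toReal := mul_pos (mul_pos (by linarith) hC) hpos
    simp only [NNReal.coe_zero] at hb
    linarith [hb.1]
  have hw0' : (0 : ℝ) < w := by exact_mod_cast pos_iff_ne_zero.mpr hw0
  refine Measure.le_iff.mpr fun s hs => ?_
  rw [Measure.smul_apply, Measure.restrict_apply hs, smul_eq_mul,
    ← lintegral_indicator_one (hs.inter hSm), ← lintegral_indicator_one hs,
    M.lintegral_obsLaw_belief σ t h a (measurable_one.indicator (hs.inter hSm)),
    M.lintegral_obsLaw σ _ _ _ (measurable_one.indicator hs),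
    ← lintegral_const_mul' _ _ ENNReal.ofReal_ne_top]
  refine lintegral_mono fun z => ?_
  by_cases hz : z ∈ s ∩ S
  swap
  · simp [hz]
  simp only [Set.indicator_of_mem hz, Set.indicator_of_mem hz.1, Pi.one_apply, mul_one]
  obtain ⟨⟨hn0, hnt⟩, hsum⟩ := hz.2
  rw [PBelief.lintegral_toMeasure b
    (M.measurable_obsDens_comp σ _ measurable_id' measurable_const measurable_const)]
  set e' := M.evidence σ (t + 1) (h.push a z) with he'
  set q : Fin C → ℝ≥0∞ := fun j => ((b j).2 : ℝ≥0∞) * M.obsDens σ (t + 1) (b j).1 a z with hq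
  -- An infinite summand becomes zero under `toReal`; this only weakens the left side, so it is
  -- harmless in a lower bound.
  have hq1 : ENNReal.ofReal ((1 - η) * C) * e' ≤ ∑ j, q j := by
    calc ENNReal.ofReal ((1 - η) * C) * e' ≤ ENNReal.ofReal (∑ j, (q j / e').toReal) * e' := by
          gcongr
          have := (abs_le.mp hsum).1
          linarith
      _ ≤ (∑ j, q j / e') * e' := by
          gcongr
          rw [ENNReal.ofReal_sum_of_nonneg fun _ _ => ENNReal.toReal_nonneg]
          exact Finset.sum_le_sum fun j _ => ENNReal.ofReal_toReal_le
      _ = ∑ j, q j := by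
          rw [Finset.sum_mul]
          exact Finset.sum_congr rfl fun j _ => ENNReal.div_mul_cancel hn0 hnt
  have hD : ∑ j, (PBelief.normWeight b j : ℝ≥0∞) * M.obsDens σ (t + 1) (b j).1 a z =
      (w : ℝ≥0∞)⁻¹ * ∑ j, q j := by
    rw [Finset.mul_sum]
    refine Finset.sum_congr rfl fun j _ => ?_
    rw [PBelief.normWeight, if_neg hw0, ENNReal.coe_div hw0, ENNReal.div_eq_inv_mul, mul_assoc]
  rw [hD]
  have hkey : ENNReal.ofReal (1 - 2 * η) * e⁻¹ ≤ (w : ℝ≥0∞)⁻¹ * ENNReal.ofReal ((1 - η) * C) := by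
    rw [← ENNReal.ofReal_toReal het, ← ENNReal.ofReal_inv_of_pos hpos,
      ← ENNReal.ofReal_coe_nnreal, ← ENNReal.ofReal_inv_of_pos hw0',
      ← ENNReal.ofReal_mul (by linarith), ← ENNReal.ofReal_mul (by positivity)]
    refine ENNReal.ofReal_le_ofReal ?_
    rw [← div_eq_mul_inv, ← div_eq_inv_mul, div_le_div_iff₀ hpos hw0']
    calc (1 - 2 * η) * w ≤ (1 - 2 * η) * ((1 + η) * C * e.toReal) :=
          mul_le_mul_of_nonneg_left hb.2 (by linarith)
      _ = ((1 - 2 * η) * (1 + η)) * (C * e.toReal) := by ring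
      _ ≤ (1 - η) * (C * e.toReal) := by
          refine mul_le_mul_of_nonneg_right ?_ (by positivity)
          nlinarith
      _ = _ := by ring
  calc ENNReal.ofReal (1 - 2 * η) * (e⁻¹ * e') = ENNReal.ofReal (1 - 2 * η) * e⁻¹ * e' := by
        rw [mul_assoc]
    _ ≤ (w : ℝ≥0∞)⁻¹ * ENNReal.ofReal ((1 - η) * C) * e' := by gcongr
    _ ≤ _ := by rw [mul_assoc]; gcongr

end Model

end PBMDP

namespace PBMDP

/-! ### The excess and the deterministic bound for the value difference. -/

lemma ofReal_abs_integral_le {α : Type*} [MeasurableSpace α] (μ : Measure α) (f : α → ℝ) :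
    ENNReal.ofReal |∫ x, f x ∂μ| ≤ ∫⁻ x, ENNReal.ofReal |f x| ∂μ := by
  have h := enorm_integral_le_lintegral_enorm (μ := μ) f
  simpa only [Real.enorm_eq_ofReal_abs] using h

namespace Model

variable {X A Z : Type*} [MeasurableSpace X] [MeasurableSpace A] [MeasurableSpace Z]
  (M : Model X A Z) (σ : ℕ → ObsChoice) {C : ℕ} {ι : Type*} [Fintype ι]

open Classical in
/-- A bound, up to a small constant, for the distance of the two action values that holds for all
policies whose actions are among those that the selectors `s` propose. -/
def excess (η : ℝ) (B : ℝ≥0∞) (s : ι → (t : ℕ) → Hist A Z t → A) :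
    (n t : ℕ) → Hist A Z t → PBelief X C → A → ℝ≥0∞
  | 0, t, h, b, a =>
      if M.WeightGood σ η t h b then (if M.RewardGood σ η t h b a then 0 else B) else B
  | n + 1, t, h, b, a =>
      if M.WeightGood σ η t h b then
        (if M.RewardGood σ η t h b a then 0 else B) +
          B * M.obsLaw σ (t + 1) (M.belief σ t h) a {z | M.ObsGood σ η t h b a z}ᶜ +
          ∑ k, ∫⁻ q : Z × PBelief X C, excess η B s n (t + 1) (h.push a q.1) q.2
            (s k (t + 1) (h.push a q.1)) ∂(M.genPF σ t b a)
      else B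

lemma le_excess_of_not_weightGood {η : ℝ} {B : ℝ≥0∞} {s : ι → (t : ℕ) → Hist A Z t → A}
    {n t : ℕ} {h : Hist A Z t} {b : PBelief X C} {a : A} (hg : ¬ M.WeightGood σ η t h b) :
    B ≤ M.excess σ η B s n t h b a := by
  cases n <;> simp [excess, hg]

variable [NeZero C]

lemma measurable_excess (η : ℝ) (B : ℝ≥0∞) {s : ι → (t : ℕ) → Hist A Z t → A}
    (hs : ∀ k t, Measurable (s k t)) (n t : ℕ) :
    Measurable fun p : Hist A Z t × PBelief X C × A =>
      M.excess σ η B s n t p.1 p.2.1 p.2.2 := by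
  classical
  have hW (t : ℕ) : MeasurableSet {p : Hist A Z t × PBelief X C × A |
      M.WeightGood σ η t p.1 p.2.1} :=
    (measurable_fst.prodMk measurable_snd.fst) (M.measurableSet_weightGood σ η t)
  have hR (t : ℕ) : Measurable fun p : Hist A Z t × PBelief X C × A =>
      if M.RewardGood σ η t p.1 p.2.1 p.2.2 then 0 else B :=
    Measurable.ite (M.measurableSet_rewardGood σ η t) measurable_const measurable_const
  induction n generalizing t with
  | zero =>
    simp only [excess]
    exact Measurable.ite (hW t) (hR t) measurable_const
  | succ n ih =>
    simp only [excess]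
    refine Measurable.ite (hW t) (((hR t).add (Measurable.const_mul ?_ B)).add
      (Finset.measurable_sum _ fun k _ => ?_)) measurable_const
    · refine measurable_measure_param
        (M.measurable_obsLaw σ (t + 1) ((M.measurable_belief σ t).comp measurable_fst)
          (fun p => M.belief_univ_le σ t p.1) measurable_snd.snd)
        (fun p => by rw [obsLaw_univ]; exact M.belief_univ_le σ t p.1)
        (s := fun p : Hist A Z t × PBelief X C × A =>
          {z | M.ObsGood σ η t p.1 p.2.1 p.2.2 z}ᶜ) ?_
      exact (M.measurableSet_obsGood σ η t).compl
    · have hpush : Measurable fun q : (Hist A Z t × PBelief X C × A) × Z × PBelief X C =>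
          q.1.1.push q.1.2.2 q.2.1 :=
        Hist.measurable_push measurable_fst.fst measurable_fst.snd.snd measurable_snd.fst
      refine measurable_lintegral_param
        (M.measurable_genPF σ t measurable_snd.fst measurable_snd.snd) (fun p => prob_le_one)
        (f := fun (p : Hist A Z t × PBelief X C × A) (q : Z × PBelief X C) =>
          M.excess σ η B s n (t + 1) (p.1.push p.2.2 q.1) q.2
            (s k (t + 1) (p.1.push p.2.2 q.1))) ?_
      exact (ih (t + 1)).comp (hpush.prodMk (measurable_snd.snd.prodMk
        ((hs k _).comp hpush)))

/-- The two action values differ by at most a small constant plus the excess. -/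
lemma abs_pomdpQAux_sub_pbmdpQAux_le {γ : ℝ} (hγ0 : 0 ≤ γ) (hγ1 : γ ≤ 1) {L : ℕ} {R : ℝ}
    (hR : 0 ≤ R) (hr : ∀ i ≤ L, ∀ x a, |M.r i x a| ≤ R) {η : ℝ} (hη0 : 0 ≤ η) (hη : η ≤ 1 / 2)
    {s : ι → (t : ℕ) → Hist A Z t → A} (hs : ∀ k t, Measurable (s k t)) {π : Policy A Z}
    (hπ : ∀ t h, ∃ k, π.act t h = s k t h) {W : ℝ} (hW : (L + 1) * R ≤ W) (n t : ℕ)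
    (htn : t + n ≤ L) (h : Hist A Z t) (b : PBelief X C) (a : A) :
    ENNReal.ofReal |M.pomdpQAux σ γ π n t h a - M.pbmdpQAux σ γ M.r π n t h b a| ≤
      ENNReal.ofReal ((n + 1) * (η * (2 * (1 + R) + 4 * W))) +
        M.excess σ η (ENNReal.ofReal (2 * W)) s n t h b a := by
  classical
  have hW0 : 0 ≤ W := le_trans (by positivity) hW
  have hQW (n : ℕ) (hn : n ≤ L) : ((n : ℝ) + 1) * R ≤ W := by
    refine le_trans ?_ hW
    gcongr
  set c := η * (2 * (1 + R) + 4 * W) with hc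
  have hc0 : 0 ≤ c := by positivity
  set B := ENNReal.ofReal (2 * W) with hB
  induction n generalizing t b a with
  | zero =>
    simp only [pomdpQAux, pbmdpQAux, excess]
    have hrt := hr t (by omega)
    have h1 := abs_integral_le_of_abs_le (M.belief_univ_le σ t h) hR fun x => hrt x a
    have h2 := abs_integral_le_of_abs_le (μ := PBelief.toMeasure b) prob_le_one hR
      fun x => hrt x a
    have hRW : 2 * R ≤ 2 * W := by have := hQW 0 (by omega); norm_num at this; linarith
    have hbig : ENNReal.ofReal |∫ x, M.r t x a ∂(M.belief σ t h) -
        ∫ x, M.r t x a ∂(PBelief.toMeasure b)| ≤ B :=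
      ENNReal.ofReal_le_ofReal ((abs_sub _ _).trans (by linarith))
    split_ifs with hg hrg
    · refine le_add_right (ENNReal.ofReal_le_ofReal ?_)
      have := hg.abs_reward_sub_le hη hrt hR hrg
      refine this.trans ?_
      rw [hc]
      push_cast
      nlinarith [mul_nonneg hη0 hW0]
    · exact le_add_left hbig
    · exact le_add_left hbig
  | succ n ih =>
    have hrt := hr t (by omega)
    by_cases hg : M.WeightGood σ η t h b
    -- With a bad weight nothing is compared: both values are at most `W` in absolute value, and the
    -- excess is `B = 2W`.
    swap
    · refine le_add_left (le_trans ?_ (M.le_excess_of_not_weightGood σ hg))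
      refine ENNReal.ofReal_le_ofReal ((abs_sub _ _).trans ?_)
      have h1 := M.abs_pomdpQAux_le σ hγ0 hγ1 hR hr π (n + 1) t htn h a
      have h2 := M.abs_pbmdpQAux_le σ hγ0 hγ1 hR hr π (n + 1) t htn h b a
      have := hQW (n + 1) (by omega)
      linarith
    have hbel := M.isProbabilityMeasure_belief σ hg.1
    set μ := M.obsLaw σ (t + 1) (M.belief σ t h) a with hμ
    set S := {z | M.ObsGood σ η t h b a z} with hSdef
    have hpz : Measurable fun z : Z => h.push a z :=
      Hist.measurable_push measurable_const measurable_const measurable_id'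
    have hpq : Measurable fun q : Z × PBelief X C => h.push a q.1 := hpz.comp measurable_fst
    set f : Z → ℝ := fun z => M.pomdpQAux σ γ π n (t + 1) (h.push a z)
      (π.act (t + 1) (h.push a z)) with hf
    have hfm : Measurable f :=
      (M.measurable_pomdpQAux σ γ π n (t + 1)).comp (hpz.prodMk ((π.measurable_act _).comp hpz))
    have hfW : ∀ z, |f z| ≤ W := fun z =>
      (M.abs_pomdpQAux_le σ hγ0 hγ1 hR hr π n (t + 1) (by omega) _ _).trans (hQW n (by omega))
    set g : Z × PBelief X C → ℝ := fun q => M.pbmdpQAux σ γ M.r π n (t + 1) (h.push a q.1) q.2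
      (π.act (t + 1) (h.push a q.1)) with hgdef
    have hgm : Measurable g := (M.measurable_pbmdpQAux σ γ M.measurable_r π n (t + 1)).comp
      (hpq.prodMk (measurable_snd.prodMk ((π.measurable_act _).comp hpq)))
    have hgW : ∀ q, |g q| ≤ W := fun q =>
      (M.abs_pbmdpQAux_le σ hγ0 hγ1 hR hr π n (t + 1) (by omega) _ _ _).trans (hQW n (by omega))
    have hreward : ENNReal.ofReal |∫ x, M.r t x a ∂(M.belief σ t h) -
        ∫ x, M.r t x a ∂(PBelief.toMeasure b)| ≤ ENNReal.ofReal (2 * η * (1 + R)) +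
          if M.RewardGood σ η t h b a then 0 else B := by
      split_ifs with hrg
      · exact le_add_right (ENNReal.ofReal_le_ofReal (hg.abs_reward_sub_le hη hrt hR hrg))
      · refine le_add_left (ENNReal.ofReal_le_ofReal ((abs_sub _ _).trans ?_))
        have h1 := abs_integral_le_of_abs_le (M.belief_univ_le σ t h) hR fun x => hrt x a
        have h2 := abs_integral_le_of_abs_le (μ := PBelief.toMeasure b) prob_le_one hR
          fun x => hrt x a
        have hRW : 2 * R ≤ 2 * W := by have := hQW 0 (by omega); norm_num at this; linarith
        linarith
    -- The exact continuation value is integrated against the particle observation law in place of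
    -- the exact one; the domination has defect `c = 2η`.
    have hobs : ENNReal.ofReal |∫ z, f z ∂μ -
        ∫ z, f z ∂(M.obsLaw σ (t + 1) (PBelief.toMeasure b) a)| ≤
          ENNReal.ofReal (4 * η * W) + B * μ Sᶜ := by
      have h1 := abs_integral_sub_le_of_smul_restrict_le
        (M.measurableSet_obsGood_right σ η t h b a) (by linarith) (by linarith)
        (hg.smul_obsLaw_le hη a) hfm hfW
      rw [hB, ← ofReal_measureReal (μ := μ), ← ENNReal.ofReal_mul (by linarith),
        ← ENNReal.ofReal_add (by positivity) (by positivity)]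
      exact ENNReal.ofReal_le_ofReal (h1.trans (by linarith))
    -- The particle observation law is the first marginal of `genPF`, so both continuation values
    -- can be compared under `genPF`. The action of `π` is proposed by some selector, whose term is
    -- dominated by the sum over all of them; this removes `π` from the bound.
    have hfut : ENNReal.ofReal |∫ z, f z ∂(M.obsLaw σ (t + 1) (PBelief.toMeasure b) a) -
        ∫ q, g q ∂(M.genPF σ t b a)| ≤ ENNReal.ofReal ((n + 1) * c) +
          ∑ k, ∫⁻ q : Z × PBelief X C, M.excess σ η B s n (t + 1) (h.push a q.1) q.2
            (s k (t + 1) (h.push a q.1)) ∂(M.genPF σ t b a) := by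
      rw [← M.genPF_map_fst σ t b a, integral_map measurable_fst.aemeasurable
        hfm.aestronglyMeasurable, ← integral_sub (f := fun q : Z × PBelief X C => f q.1)
          (integrable_of_abs_le (hfm.comp measurable_fst) fun q => hfW q.1)
          (integrable_of_abs_le hgm hgW)]
      refine (ofReal_abs_integral_le _ _).trans ?_
      have hem (k : ι) : Measurable fun q : Z × PBelief X C =>
          M.excess σ η B s n (t + 1) (h.push a q.1) q.2 (s k (t + 1) (h.push a q.1)) :=
        (M.measurable_excess σ η B hs n (t + 1)).comp
          (hpq.prodMk (measurable_snd.prodMk ((hs k _).comp hpq)))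
      rw [← lintegral_finsetSum _ fun k _ => hem k]
      calc ∫⁻ q, ENNReal.ofReal |f q.1 - g q| ∂(M.genPF σ t b a)
          ≤ ∫⁻ q, (ENNReal.ofReal ((n + 1) * c) + ∑ k, M.excess σ η B s n (t + 1)
              (h.push a q.1) q.2 (s k (t + 1) (h.push a q.1))) ∂(M.genPF σ t b a) := by
            refine lintegral_mono fun q => ?_
            refine (ih (t + 1) (by omega) (h.push a q.1) q.2 _).trans ?_
            gcongr
            obtain ⟨k, hk⟩ := hπ (t + 1) (h.push a q.1)
            rw [hk]
            exact Finset.single_le_sum (f := fun k => M.excess σ η B s n (t + 1)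
              (h.push a q.1) q.2 (s k (t + 1) (h.push a q.1))) (fun _ _ => zero_le)
              (Finset.mem_univ k)
        _ = _ := by
            rw [lintegral_add_left measurable_const]
            simp
    have hsplit : ENNReal.ofReal |M.pomdpQAux σ γ π (n + 1) t h a -
        M.pbmdpQAux σ γ M.r π (n + 1) t h b a| ≤
        ENNReal.ofReal |∫ x, M.r t x a ∂(M.belief σ t h) -
          ∫ x, M.r t x a ∂(PBelief.toMeasure b)| +
        ENNReal.ofReal |∫ z, f z ∂μ - ∫ z, f z ∂(M.obsLaw σ (t + 1) (PBelief.toMeasure b) a)| +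
        ENNReal.ofReal |∫ z, f z ∂(M.obsLaw σ (t + 1) (PBelief.toMeasure b) a) -
          ∫ q, g q ∂(M.genPF σ t b a)| := by
      rw [← ENNReal.ofReal_add (abs_nonneg _) (abs_nonneg _),
        ← ENNReal.ofReal_add (by positivity) (abs_nonneg _)]
      refine ENNReal.ofReal_le_ofReal ?_
      simp only [pomdpQAux, pbmdpQAux]
      change |(_ + γ * ∫ z, f z ∂μ) - (_ + γ * ∫ q, g q ∂(M.genPF σ t b a))| ≤ _
      generalize (∫ x, M.r t x a ∂(M.belief σ t h)) = r1
      generalize (∫ x, M.r t x a ∂(PBelief.toMeasure b)) = r2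
      generalize (∫ z, f z ∂μ) = v1
      generalize (∫ z, f z ∂(M.obsLaw σ (t + 1) (PBelief.toMeasure b) a)) = v2
      generalize (∫ q, g q ∂(M.genPF σ t b a)) = v3
      have e : r1 + γ * v1 - (r2 + γ * v3) = (r1 - r2) + γ * ((v1 - v2) + (v2 - v3)) := by ring
      rw [e]
      refine (abs_add_le _ _).trans ?_
      rw [abs_mul, abs_of_nonneg hγ0]
      have h1 := abs_add_le (v1 - v2) (v2 - v3)
      have h2 := mul_le_of_le_one_left (abs_nonneg ((v1 - v2) + (v2 - v3))) hγ1
      linarith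
    refine hsplit.trans ((add_le_add (add_le_add hreward hobs) hfut).trans (le_of_eq ?_))
    rw [excess, if_pos hg]
    -- The reward error `2η(1 + R)` and the observation error `4ηW` of this level make up exactly
    -- one more `c`.
    have e : ENNReal.ofReal (((n + 1 : ℕ) + 1 : ℝ) * c) = ENNReal.ofReal (2 * η * (1 + R)) +
        ENNReal.ofReal (4 * η * W) + ENNReal.ofReal ((n + 1) * c) := by
      rw [← ENNReal.ofReal_add (by positivity) (by positivity),
        ← ENNReal.ofReal_add (by positivity) (by positivity)]
      congr 1
      rw [hc]
      push_cast
      ring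
    rw [e]
    ring

end Model

end PBMDP

namespace PBMDP

namespace Model

variable {X A Z : Type*} [MeasurableSpace X] [MeasurableSpace A] [MeasurableSpace Z]
  (M : Model X A Z) (σ : ℕ → ObsChoice) {C : ℕ}

/-! ### Failure probabilities and expected excess at a fixed history. -/

lemma joint_eq_map (t : ℕ) (h : Hist A Z t) :
    M.joint σ t h =
      ((M.particleLaw σ t h).withDensity fun p => (p.2 : ℝ≥0∞)).map Prod.fst := by
  refine Measure.ext_of_lintegral _ fun F hF => ?_
  have hF' : Measurable fun p : X × ℝ≥0 => F p.1 := hF.comp measurable_fst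
  rw [M.lintegral_joint σ t h hF, lintegral_map hF measurable_fst,
    lintegral_withDensity_eq_lintegral_mul _ measurable_snd.coe_nnreal_ennreal hF']
  rfl

/-- Turns an exact expectation into the mean of a function of one particle, which is the form that
Hoeffding's inequality takes. -/
lemma integral_belief (t : ℕ) (h : Hist A Z t) {f : X → ℝ} (hf : Measurable f) :
    ∫ x, f x ∂(M.belief σ t h) =
      ∫ p, (p.2 : ℝ) / (M.evidence σ t h).toReal * f p.1 ∂(M.particleLaw σ t h) := by
  rw [belief, integral_smul_measure, joint_eq_map,
    integral_map measurable_fst.aemeasurable hf.aestronglyMeasurable,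
    integral_withDensity_eq_integral_smul measurable_snd, smul_eq_mul, ← integral_const_mul,
    ENNReal.toReal_inv]
  refine integral_congr_ae (Eventually.of_forall fun p => ?_)
  simp only [NNReal.smul_def, smul_eq_mul]
  ring

/-- The bound that Hoeffding's inequality gives for the probability of a deviation. -/
def hoeffdingBound (C : ℕ) (η D : ℝ) : ℝ≥0∞ :=
  ENNReal.ofReal (2 * Real.exp (-(C * (η ^ 2 / (2 * D ^ 2)))))

variable {M σ} {L : ℕ} {d R : ℝ}

lemma LikelihoodRatioBound.abs_weight_le (hM : M.LikelihoodRatioBound σ L d) {t : ℕ}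
    (ht : t ≤ L) {h : Hist A Z t} (hh : M.Nondeg σ t h) (hd : 0 ≤ d) :
    ∀ᵐ p ∂(M.particleLaw σ t h), |(p.2 : ℝ) / (M.evidence σ t h).toReal| ≤ d := by
  have hpos : 0 < (M.evidence σ t h).toReal := ENNReal.toReal_pos hh.1 hh.2
  filter_upwards [hM.weight_le ht h] with p hp
  rw [abs_of_nonneg (by positivity), div_le_iff₀ hpos]
  have := ENNReal.toReal_mono (ENNReal.mul_ne_top ENNReal.ofReal_ne_top hh.2) hp
  simpa [ENNReal.toReal_mul, hd] using this

/-- The normalized weight has mean one and is at most `d`. The larger range `d * R` lets all three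
events share one bound. -/
lemma sisLaw_not_weightGood_le (hM : M.LikelihoodRatioBound σ L d) (hd : 0 < d) (hR : 1 ≤ R)
    {η : ℝ} (hη : 0 ≤ η) {t : ℕ} (ht : t ≤ L) {h : Hist A Z t} (hh : M.Nondeg σ t h) :
    M.sisLaw σ C t h {b | ¬ M.WeightGood σ η t h b} ≤ hoeffdingBound C η (d * R) := by
  have hb : ∀ᵐ p ∂(M.particleLaw σ t h), |(p.2 : ℝ) / (M.evidence σ t h).toReal| ≤ d * R :=
    (hM.abs_weight_le ht hh hd.le).mono fun p hp => hp.trans (le_mul_of_one_le_right hd.le hR)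
  have hm : ∫ p, (p.2 : ℝ) / (M.evidence σ t h).toReal ∂(M.particleLaw σ t h) = 1 := by
    have h1 := M.integral_belief σ t h (f := fun _ => 1) measurable_const
    have := M.isProbabilityMeasure_belief σ hh
    simpa using h1.symm
  refine (measure_mono fun b hb => ?_).trans (hoeffding_two_sided (M.particleLaw σ t h)
    (f := fun p => (p.2 : ℝ) / (M.evidence σ t h).toReal)
    (measurable_snd.coe_nnreal_real.div_const _) (mul_pos hd (by linarith)) hb C hη hm)
  by_contra hc
  exact hb ⟨hh, not_lt.mp hc⟩

lemma sisLaw_not_rewardGood_le (hM : M.LikelihoodRatioBound σ L d) (hd : 0 < d) (hR : 1 ≤ R)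
    {η : ℝ} (hη : 0 ≤ η) {t : ℕ} (ht : t ≤ L) (hr : ∀ x a, |M.r t x a| ≤ R) {h : Hist A Z t}
    (hh : M.Nondeg σ t h) (a : A) :
    M.sisLaw σ C t h {b | ¬ M.RewardGood σ η t h b a} ≤ hoeffdingBound C η (d * R) := by
  have hrm : Measurable fun x => M.r t x a :=
    (M.measurable_r t).comp (measurable_id'.prodMk measurable_const)
  have hb : ∀ᵐ p ∂(M.particleLaw σ t h),
      |(p.2 : ℝ) / (M.evidence σ t h).toReal * M.r t p.1 a| ≤ d * R :=
    (hM.abs_weight_le ht hh hd.le).mono fun p hp => by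
      rw [abs_mul]
      exact mul_le_mul hp (hr p.1 a) (abs_nonneg _) hd.le
  refine (measure_mono fun b hb => ?_).trans (hoeffding_two_sided (M.particleLaw σ t h)
    (f := fun p => (p.2 : ℝ) / (M.evidence σ t h).toReal * M.r t p.1 a)
    ((measurable_snd.coe_nnreal_real.div_const _).mul (hrm.comp measurable_fst))
    (mul_pos hd (by linarith)) hb C hη (M.integral_belief σ t h hrm).symm)
  by_contra hc
  exact hb (not_lt.mp hc)

/-- The observation is fixed and the propagated states are integrated out, so each summand depends
on one current particle. Its mean is one by `evidence_push`, its bound is `weight_mul_obsDens_le`.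
-/
lemma sisLaw_not_obsGood_le (hM : M.LikelihoodRatioBound σ L d) (hd : 0 < d) (hR : 1 ≤ R)
    {η : ℝ} (hη : 0 ≤ η) {t : ℕ} (ht : t + 1 ≤ L) {h : Hist A Z t} (a : A) {z : Z}
    (hh : M.Nondeg σ (t + 1) (h.push a z)) :
    M.sisLaw σ C t h {b | ¬ M.ObsGood σ η t h b a z} ≤ hoeffdingBound C η (d * R) := by
  set e := M.evidence σ (t + 1) (h.push a z) with he
  have hfm : Measurable fun p : X × ℝ≥0 =>
      (p.2 : ℝ≥0∞) * M.obsDens σ (t + 1) p.1 a z / e :=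
    (measurable_snd.coe_nnreal_ennreal.mul
      (M.measurable_obsDens_comp σ _ measurable_fst measurable_const measurable_const)).div_const _
  have hle : ∀ᵐ p ∂(M.particleLaw σ t h),
      (p.2 : ℝ≥0∞) * M.obsDens σ (t + 1) p.1 a z / e ≤ ENNReal.ofReal d :=
    (hM.weight_mul_obsDens_le ht h a z).mono fun p hp => ENNReal.div_le_of_le_mul hp
  have hb : ∀ᵐ p ∂(M.particleLaw σ t h),
      |((p.2 : ℝ≥0∞) * M.obsDens σ (t + 1) p.1 a z / e).toReal| ≤ d * R :=
    hle.mono fun p hp => by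
      rw [abs_of_nonneg ENNReal.toReal_nonneg]
      exact (ENNReal.toReal_le_of_le_ofReal hd.le hp).trans (le_mul_of_one_le_right hd.le hR)
  have hm : ∫ p, ((p.2 : ℝ≥0∞) * M.obsDens σ (t + 1) p.1 a z / e).toReal
      ∂(M.particleLaw σ t h) = 1 := by
    rw [integral_toReal hfm.aemeasurable (hle.mono fun p hp => hp.trans_lt ENNReal.ofReal_lt_top)]
    simp_rw [div_eq_mul_inv]
    rw [lintegral_mul_const' _ _ (ENNReal.inv_ne_top.mpr hh.1), ← M.evidence_push σ t h a z,
      ENNReal.mul_inv_cancel hh.1 hh.2, ENNReal.toReal_one]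
  refine (measure_mono fun b hb => ?_).trans (hoeffding_two_sided (M.particleLaw σ t h)
    hfm.ennreal_toReal (mul_pos hd (by linarith)) hb C hη hm)
  by_contra hc
  exact hb ⟨hh, not_lt.mp hc⟩

/-- The factors in the bound for the expected excess. -/
def excessConst (B D : ℝ≥0∞) (K : ℕ) : ℕ → ℝ≥0∞
  | 0 => 2 * B
  | n + 1 => 3 * B + K * (2 * D * excessConst B D K n)

lemma lintegral_ite_zero_le {α : Type*} [MeasurableSpace α] (μ : Measure α) {p : α → Prop}
    [DecidablePred p] (hp : MeasurableSet {x | p x}) (B : ℝ≥0∞) :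
    ∫⁻ x, (if p x then 0 else B) ∂μ = B * μ {x | ¬ p x} := by
  change _ = B * μ {x | p x}ᶜ
  rw [← lintegral_indicator_const hp.compl]
  refine lintegral_congr fun x => ?_
  by_cases hx : p x <;> simp [Set.indicator, hx]

variable {ι : Type*} [Fintype ι] [NeZero C]

/-- Each of the three failures costs `B` times a Hoeffding probability. Future excess is only
charged where the weight is good, and there the change of measure leads to importance sampling along
the extended history, where the induction hypothesis holds. -/
lemma lintegral_excess_le (hM : M.LikelihoodRatioBound σ L d) (hd : 0 < d) (hR : 1 ≤ R)
    (hr : ∀ i ≤ L, ∀ x a, |M.r i x a| ≤ R) {η : ℝ} (hη0 : 0 ≤ η) (hη : η ≤ 1 / 2) (B : ℝ≥0∞)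
    {s : ι → (t : ℕ) → Hist A Z t → A} (hs : ∀ k t, Measurable (s k t)) (n t : ℕ)
    (htn : t + n ≤ L) {h : Hist A Z t} (hh : M.Nondeg σ t h) (a : A) :
    ∫⁻ b, M.excess σ η B s n t h b a ∂(M.sisLaw σ C t h) ≤
      hoeffdingBound C η (d * R) * excessConst B (ENNReal.ofReal d) (Fintype.card ι) n := by
  classical
  have hWm (t : ℕ) (h : Hist A Z t) : MeasurableSet {b : PBelief X C | M.WeightGood σ η t h b} :=
    (measurable_prodMk_left (x := h)) (M.measurableSet_weightGood σ η t)
  have hRm (t : ℕ) (h : Hist A Z t) (a : A) :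
      MeasurableSet {b : PBelief X C | M.RewardGood σ η t h b a} :=
    (measurable_const.prodMk (measurable_id'.prodMk measurable_const) :
      Measurable fun b : PBelief X C => (h, b, a)) (M.measurableSet_rewardGood σ η t)
  have hWi (t : ℕ) (h : Hist A Z t) : Measurable fun b : PBelief X C =>
      if M.WeightGood σ η t h b then 0 else B :=
    Measurable.ite (hWm t h) measurable_const measurable_const
  have hRi (t : ℕ) (h : Hist A Z t) (a : A) : Measurable fun b : PBelief X C =>
      if M.RewardGood σ η t h b a then 0 else B :=
    Measurable.ite (hRm t h a) measurable_const measurable_const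
  set q := hoeffdingBound C η (d * R) with hq
  induction n generalizing t a with
  | zero =>
    calc ∫⁻ b, M.excess σ η B s 0 t h b a ∂(M.sisLaw σ C t h)
        ≤ ∫⁻ b, ((if M.WeightGood σ η t h b then 0 else B) +
            (if M.RewardGood σ η t h b a then 0 else B)) ∂(M.sisLaw σ C t h) := by
          refine lintegral_mono fun b => ?_
          simp only [excess]
          split_ifs <;> simp
      _ = B * M.sisLaw σ C t h {b | ¬ M.WeightGood σ η t h b} +
            B * M.sisLaw σ C t h {b | ¬ M.RewardGood σ η t h b a} := by
          rw [lintegral_add_left (hWi t h), lintegral_ite_zero_le _ (hWm t h),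
            lintegral_ite_zero_le _ (hRm t h a)]
      _ ≤ B * q + B * q := by
          gcongr
          · exact sisLaw_not_weightGood_le hM hd hR hη0 (by omega) hh
          · exact sisLaw_not_rewardGood_le hM hd hR hη0 (by omega) (hr t (by omega)) hh a
      _ = _ := by rw [excessConst]; ring
  | succ n ih =>
    set μ := M.obsLaw σ (t + 1) (M.belief σ t h) a with hμ
    have hbel := M.isProbabilityMeasure_belief σ hh
    have hOm : MeasurableSet {p : PBelief X C × Z | M.ObsGood σ η t h p.1 a p.2} :=
      ((measurable_const.prodMk (measurable_fst.prodMk measurable_const)).prodMk measurable_snd :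
        Measurable fun p : PBelief X C × Z => ((h, p.1, a), p.2)) (M.measurableSet_obsGood σ η t)
    have hO : Measurable fun b : PBelief X C => μ {z | M.ObsGood σ η t h b a z}ᶜ :=
      measurable_measure_prodMk_left hOm.compl
    -- Here the observation has its exact law, which does not depend on the particles. Tonelli
    -- therefore allows Hoeffding's inequality for each fixed observation.
    have hOle : ∫⁻ b, μ {z | M.ObsGood σ η t h b a z}ᶜ ∂(M.sisLaw σ C t h) ≤ q := by
      have e1 : ∫⁻ b, μ {z | M.ObsGood σ η t h b a z}ᶜ ∂(M.sisLaw σ C t h) =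
          ∫⁻ z, M.sisLaw σ C t h {b | ¬ M.ObsGood σ η t h b a z} ∂μ :=
        (Measure.prod_apply hOm.compl).symm.trans (Measure.prod_apply_symm hOm.compl)
      rw [e1]
      calc ∫⁻ z, M.sisLaw σ C t h {b | ¬ M.ObsGood σ η t h b a z} ∂μ ≤ ∫⁻ _, q ∂μ := by
            refine lintegral_mono_ae ?_
            filter_upwards [M.ae_nondeg_push σ hh a] with z hz
            exact sisLaw_not_obsGood_le hM hd hR hη0 (by omega) a hz
        _ = q := by simp
    have hpq : Measurable fun q : Z × PBelief X C => h.push a q.1 :=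
      Hist.measurable_push measurable_const measurable_const measurable_fst
    set F : ι → Z × PBelief X C → ℝ≥0∞ := fun k q =>
      M.excess σ η B s n (t + 1) (h.push a q.1) q.2 (s k (t + 1) (h.push a q.1)) with hF
    have hFm (k : ι) : Measurable (F k) :=
      (M.measurable_excess σ η B hs n (t + 1)).comp
        (hpq.prodMk (measurable_snd.prodMk ((hs k _).comp hpq)))
    have hFi (k : ι) : Measurable fun b : PBelief X C => ∫⁻ q, F k q ∂(M.genPF σ t b a) :=
      measurable_lintegral_param (M.measurable_genPF σ t measurable_id' measurable_const)
        (fun _ => prob_le_one) (f := fun _ q => F k q) ((hFm k).comp measurable_snd)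
    -- The factor `2d` of the change of measure; degenerate extensions of the history form a null
    -- set for the exact law.
    have hFle (k : ι) : ∫⁻ b in {b | M.WeightGood σ η t h b}, ∫⁻ q, F k q ∂(M.genPF σ t b a)
        ∂(M.sisLaw σ C t h) ≤ 2 * ENNReal.ofReal d *
          (q * excessConst B (ENNReal.ofReal d) (Fintype.card ι) n) := by
      refine (M.lintegral_genPF_sisLaw_le σ hM (by omega) hh a (hWm t h)
        (fun b hb => hb.le_two_mul hη) (hFm k)).trans ?_
      gcongr
      calc _ ≤ ∫⁻ _, q * excessConst B (ENNReal.ofReal d) (Fintype.card ι) n ∂μ := by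
            refine lintegral_mono_ae ?_
            filter_upwards [M.ae_nondeg_push σ hh a] with z hz
            exact ih (t + 1) (by omega) hz (s k (t + 1) (h.push a z))
        _ = _ := by simp
    calc ∫⁻ b, M.excess σ η B s (n + 1) t h b a ∂(M.sisLaw σ C t h)
        ≤ ∫⁻ b, ((if M.WeightGood σ η t h b then 0 else B) +
            (if M.RewardGood σ η t h b a then 0 else B) +
            B * μ {z | M.ObsGood σ η t h b a z}ᶜ +
            ({b | M.WeightGood σ η t h b} : Set (PBelief X C)).indicator
              (fun b => ∑ k, ∫⁻ q, F k q ∂(M.genPF σ t b a)) b) ∂(M.sisLaw σ C t h) := by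
          refine lintegral_mono fun b => ?_
          simp only [excess]
          by_cases hg : M.WeightGood σ η t h b
          · simp [Set.indicator, hg, hF, hμ]
          · simp only [if_neg hg]
            rw [add_assoc, add_assoc]
            exact le_self_add
      _ = B * M.sisLaw σ C t h {b | ¬ M.WeightGood σ η t h b} +
            B * M.sisLaw σ C t h {b | ¬ M.RewardGood σ η t h b a} +
            B * ∫⁻ b, μ {z | M.ObsGood σ η t h b a z}ᶜ ∂(M.sisLaw σ C t h) +
            ∑ k, ∫⁻ b in {b | M.WeightGood σ η t h b}, ∫⁻ q, F k q ∂(M.genPF σ t b a)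
              ∂(M.sisLaw σ C t h) := by
          have h1 : Measurable fun b : PBelief X C =>
              (if M.WeightGood σ η t h b then 0 else B) +
                (if M.RewardGood σ η t h b a then 0 else B) := (hWi t h).add (hRi t h a)
          have h2 : Measurable fun b : PBelief X C =>
              (if M.WeightGood σ η t h b then 0 else B) +
                (if M.RewardGood σ η t h b a then 0 else B) +
                B * μ {z | M.ObsGood σ η t h b a z}ᶜ := h1.add (hO.const_mul B)
          rw [lintegral_add_left h2, lintegral_add_left h1,
            lintegral_add_left (hWi t h), lintegral_ite_zero_le _ (hWm t h),
            lintegral_ite_zero_le _ (hRm t h a), lintegral_const_mul _ hO,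
            lintegral_indicator (hWm t h), lintegral_finsetSum _ fun k _ => hFi k]
      _ ≤ B * q + B * q + B * q + ∑ _k : ι, 2 * ENNReal.ofReal d *
            (q * excessConst B (ENNReal.ofReal d) (Fintype.card ι) n) := by
          gcongr with k _
          · exact sisLaw_not_weightGood_le hM hd hR hη0 (by omega) hh
          · exact sisLaw_not_rewardGood_le hM hd hR hη0 (by omega) (hr t (by omega)) hh a
          · exact hFle k
      _ = _ := by
          rw [excessConst, Finset.sum_const, Finset.card_univ, nsmul_eq_mul]
          ring

end Model

end PBMDP

namespace PBMDP

/-! ### Nodes -/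

namespace Node

variable {X A Z : Type*} {C t n : ℕ}

/-- The child of a node for the action `a`, the observation `z` and the particle belief `b`. -/
def child (N : Node X A Z C t n) (a : A) (z : Z) (b : PBelief X C) : Node X A Z C t (n + 1) :=
  (Hist.push N.1 a z, Fin.snoc (α := fun _ => PBelief X C) N.2 b)

lemma hist_child_castSucc (N : Node X A Z C t n) (a : A) (z : Z) (b : PBelief X C)
    (k : Fin (n + 1)) : (N.child a z b).hist k.castSucc = N.hist k := by
  funext j
  have hj : (j : ℕ) < t + n := lt_of_lt_of_le j.2 (by
    have := k.2
    have e : ((k.castSucc : Fin (n + 1 + 1)) : ℕ) = k := rfl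
    omega)
  exact Fin.snoc_castSucc (α := fun _ => A × Z) (x := (a, z)) (p := N.1) ⟨j, hj⟩

lemma pbelief_child_castSucc (N : Node X A Z C t n) (a : A) (z : Z) (b : PBelief X C)
    (k : Fin (n + 1)) : (N.child a z b).pbelief k.castSucc = N.pbelief k :=
  Fin.snoc_castSucc (α := fun _ => PBelief X C) (x := b) (p := N.2) k

lemma child_snd_last (N : Node X A Z C t n) (a : A) (z : Z) (b : PBelief X C) :
    (N.child a z b).2 (Fin.last (n + 1)) = b :=
  Fin.snoc_last (α := fun _ => PBelief X C) (x := b) (p := N.2)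

/-- All strict ancestors of a node satisfy `good`. -/
def AncestorsGood (good : (m : ℕ) → Hist A Z (t + m) → PBelief X C → Prop)
    (N : Node X A Z C t n) : Prop :=
  ∀ k : Fin (n + 1), (k : ℕ) < n → good k (N.hist k) (N.pbelief k)

/-- A node and all its ancestors satisfy `good`. -/
def PathGood (good : (m : ℕ) → Hist A Z (t + m) → PBelief X C → Prop)
    (N : Node X A Z C t n) : Prop :=
  ∀ k : Fin (n + 1), good k (N.hist k) (N.pbelief k)

variable {good : (m : ℕ) → Hist A Z (t + m) → PBelief X C → Prop}

lemma pathGood_iff (N : Node X A Z C t n) :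
    N.PathGood good ↔ N.AncestorsGood good ∧ good n N.1 (N.2 (Fin.last n)) := by
  constructor
  · exact fun h => ⟨fun k _ => h k, h (Fin.last n)⟩
  · rintro ⟨h1, h2⟩ k
    rcases lt_or_eq_of_le (Nat.lt_succ_iff.mp k.2) with hk | hk
    · exact h1 k hk
    · obtain rfl : k = Fin.last n := Fin.ext hk
      exact h2

/-- The strict ancestors of a child are the parent and its ancestors. So the event does not involve
the randomness of the child, and inductions over depth can shift it back one generation. -/
lemma ancestorsGood_child (N : Node X A Z C t n) (a : A) (z : Z) (b : PBelief X C) :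
    (N.child a z b).AncestorsGood good ↔ N.PathGood good := by
  constructor
  · intro h k
    have h1 := h k.castSucc k.2
    rw [hist_child_castSucc, pbelief_child_castSucc] at h1
    exact h1
  · intro h k hk
    have h1 := h ⟨k, hk⟩
    rw [← hist_child_castSucc N a z b, ← pbelief_child_castSucc N a z b] at h1
    exact h1

variable [MeasurableSpace X] [MeasurableSpace A] [MeasurableSpace Z]

lemma measurable_child {α : Type*} [MeasurableSpace α] {N : α → Node X A Z C t n} {a : α → A}
    {z : α → Z} {b : α → PBelief X C} (hN : Measurable N) (ha : Measurable a) (hz : Measurable z)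
    (hb : Measurable b) : Measurable fun y => (N y).child (a y) (z y) (b y) :=
  (Hist.measurable_push hN.fst ha hz).prodMk (measurable_fin_snoc hN.snd hb)

lemma measurable_hist (k : Fin (n + 1)) :
    Measurable fun N : Node X A Z C t n => N.hist k :=
  measurable_pi_lambda _ fun _ => (measurable_pi_apply _).comp measurable_fst

lemma measurable_pbelief (k : Fin (n + 1)) :
    Measurable fun N : Node X A Z C t n => N.pbelief k :=
  (measurable_pi_apply _).comp measurable_snd

lemma measurableSet_ancestorsGood
    (hgood : ∀ m, MeasurableSet {p : Hist A Z (t + m) × PBelief X C | good m p.1 p.2}) :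
    MeasurableSet {N : Node X A Z C t n | N.AncestorsGood good} := by
  have : {N : Node X A Z C t n | N.AncestorsGood good} = ⋂ k : Fin (n + 1),
      {N | (k : ℕ) < n → good k (N.hist k) (N.pbelief k)} := by
    ext N; simp [AncestorsGood]
  rw [this]
  refine MeasurableSet.iInter fun k => ?_
  by_cases hk : (k : ℕ) < n
  · simp only [hk, true_imp_iff]
    exact ((measurable_hist k).prodMk (measurable_pbelief k)) (hgood k)
  · simp [hk]

lemma measurableSet_pathGood
    (hgood : ∀ m, MeasurableSet {p : Hist A Z (t + m) × PBelief X C | good m p.1 p.2}) :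
    MeasurableSet {N : Node X A Z C t n | N.PathGood good} := by
  have : {N : Node X A Z C t n | N.PathGood good} = ⋂ k : Fin (n + 1),
      {N | good k (N.hist k) (N.pbelief k)} := by
    ext N; simp [PathGood]
  rw [this]
  exact MeasurableSet.iInter fun k => ((measurable_hist k).prodMk (measurable_pbelief k)) (hgood k)

end Node

namespace Model

variable {X A Z : Type*} [MeasurableSpace X] [MeasurableSpace A] [MeasurableSpace Z]
  (M : Model X A Z) (σ : ℕ → ObsChoice) {C t n : ℕ}

/-! ### The law of the tree -/

lemma measurable_childLaw_map (N : Node X A Z C t n) (a : A) :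
    Measurable fun p : Z × PBelief X C => N.child a p.1 p.2 :=
  Node.measurable_child measurable_const measurable_const measurable_fst measurable_snd

lemma lintegral_childLaw (N : Node X A Z C t n) (a : A) {F : Node X A Z C t (n + 1) → ℝ≥0∞}
    (hF : Measurable F) :
    ∫⁻ N', F N' ∂(M.childLaw σ N a) =
      ∫⁻ q, F (N.child a q.1 q.2) ∂(M.genPF σ (t + n) (N.2 (Fin.last n)) a) :=
  lintegral_map hF (measurable_childLaw_map N a)

lemma measurable_root {E : Type*} (h : Hist A Z t) :
    Measurable fun (b : PBelief X C) (_ : Fin 0 → E) =>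
      ((h, fun _ => b) : Node X A Z C t 0) :=
  measurable_pi_lambda _ fun _ => measurable_const.prodMk
    (measurable_pi_lambda _ fun _ => measurable_id')

variable {E : Type*} [Fintype E] {rule : (n : ℕ) → Hist A Z (t + n) → E → A}

/-- The law of one generation of the tree, given the previous one. -/
def generationLaw (rule : (n : ℕ) → Hist A Z (t + n) → E → A) (n : ℕ)
    (T : (Fin n → E) → Node X A Z C t n) :
    Measure ((Fin (n + 1) → E) → Node X A Z C t (n + 1)) :=
  Measure.pi fun v : Fin (n + 1) → E =>
    M.childLaw σ (T (Fin.init v)) (rule n (T (Fin.init v)).1 (v (Fin.last n)))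

lemma treeLaw_succ (h : Hist A Z t) (n : ℕ) :
    M.treeLaw σ C t h rule (n + 1) =
      (M.treeLaw σ C t h rule n).bind (M.generationLaw σ rule n) := rfl

variable [NeZero C]

instance (N : Node X A Z C t n) (a : A) : IsProbabilityMeasure (M.childLaw σ N a) :=
  Measure.isProbabilityMeasure_map (measurable_childLaw_map N a).aemeasurable

lemma measurable_childLaw {α : Type*} [MeasurableSpace α] {N : α → Node X A Z C t n} {a : α → A}
    (hN : Measurable N) (ha : Measurable a) :
    Measurable fun y => M.childLaw σ (N y) (a y) := by
  refine measurable_map_param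
    (M.measurable_genPF σ (t + n) (measurable_pi_iff.mp hN.snd (Fin.last n)) ha)
    (fun _ => prob_le_one) (f := fun y p => (N y).child (a y) p.1 p.2) ?_
  exact Node.measurable_child (hN.comp measurable_fst) (ha.comp measurable_fst)
    measurable_snd.fst measurable_snd.snd

lemma measurable_generationLaw (hrule : ∀ n e, Measurable fun h => rule n h e) :
    Measurable (M.generationLaw (C := C) σ rule n) :=
  measurable_pi_param (fun v => M.measurable_childLaw σ (measurable_pi_apply (Fin.init v))
    ((hrule n (v (Fin.last n))).comp (measurable_pi_apply (Fin.init v)).fst))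
    fun _ _ => inferInstance

lemma isProbabilityMeasure_treeLaw (hrule : ∀ n e, Measurable fun h => rule n h e)
    (h : Hist A Z t) (n : ℕ) : IsProbabilityMeasure (M.treeLaw σ C t h rule n) := by
  induction n with
  | zero => exact Measure.isProbabilityMeasure_map (measurable_root h).aemeasurable
  | succ n ih =>
    exact isProbabilityMeasure_bind (M.measurable_generationLaw σ hrule) fun _ => inferInstance

/-- Given the previous generation, the children are a product measure whose `v`-th marginal is a
single child law. Statements about one path thus never see the siblings. -/
lemma lintegral_treeLaw_succ (hrule : ∀ n e, Measurable fun h => rule n h e) (h : Hist A Z t)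
    (v : Fin (n + 1) → E) {F : Node X A Z C t (n + 1) → ℝ≥0∞} (hF : Measurable F) :
    ∫⁻ T, F (T v) ∂(M.treeLaw σ C t h rule (n + 1)) =
      ∫⁻ T, ∫⁻ N', F N' ∂(M.childLaw σ (T (Fin.init v))
        (rule n (T (Fin.init v)).1 (v (Fin.last n)))) ∂(M.treeLaw σ C t h rule n) := by
  have hFv : Measurable fun T : (Fin (n + 1) → E) → Node X A Z C t (n + 1) => F (T v) :=
    hF.comp (measurable_pi_apply v)
  rw [treeLaw_succ, Measure.lintegral_bind (M.measurable_generationLaw σ hrule).aemeasurable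
    hFv.aemeasurable]
  refine lintegral_congr fun T => ?_
  exact (measurePreserving_eval (fun v : Fin (n + 1) → E =>
    M.childLaw σ (T (Fin.init v)) (rule n (T (Fin.init v)).1 (v (Fin.last n)))) v).lintegral_comp hF

variable {good : (m : ℕ) → Hist A Z (t + m) → PBelief X C → Prop}

/-- On a path whose nodes carry enough weight, expectations are bounded by the corresponding
expectations for sequential importance sampling along a fixed history. -/
lemma lintegral_treeLaw_ancestorsGood_le {L : ℕ} {d : ℝ} (hM : M.LikelihoodRatioBound σ L d)
    {η : ℝ} (hη : η ≤ 1 / 2) (hrule : ∀ n e, Measurable fun h => rule n h e)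
    (hgood : ∀ m, MeasurableSet {p : Hist A Z (t + m) × PBelief X C | good m p.1 p.2})
    (hweight : ∀ m h b, good m h b → M.WeightGood σ η (t + m) h b)
    {h : Hist A Z t} (hh : M.Nondeg σ t h) (n : ℕ) (hn : t + n ≤ L) (v : Fin n → E)
    {F : Hist A Z (t + n) × PBelief X C → ℝ≥0∞} (hF : Measurable F) {τ : ℝ≥0∞}
    (hτ : ∀ h', M.Nondeg σ (t + n) h' → ∫⁻ b, F (h', b) ∂(M.sisLaw σ C (t + n) h') ≤ τ) :
    ∫⁻ T, {N : Node X A Z C t n | N.AncestorsGood good}.indicator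
        (fun N => F (N.1, N.2 (Fin.last n))) (T v) ∂(M.treeLaw σ C t h rule n) ≤
      (2 * ENNReal.ofReal d) ^ n * τ := by
  induction n generalizing τ with
  | zero =>
    have hFm : Measurable fun N : Node X A Z C t 0 => F (N.1, N.2 (Fin.last 0)) :=
      hF.comp (measurable_fst.prodMk ((measurable_pi_apply _).comp measurable_snd))
    calc ∫⁻ T, {N : Node X A Z C t 0 | N.AncestorsGood good}.indicator
          (fun N => F (N.1, N.2 (Fin.last 0))) (T v) ∂(M.treeLaw σ C t h rule 0)
        ≤ ∫⁻ T, F ((T v).1, (T v).2 (Fin.last 0)) ∂(M.treeLaw σ C t h rule 0) :=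
          lintegral_mono fun T => Set.indicator_le_self _ _ _
      _ = ∫⁻ b, F (h, b) ∂(M.sisLaw σ C t h) :=
          lintegral_map (hFm.comp (measurable_pi_apply v)) (measurable_root h)
      _ ≤ _ := by simpa using hτ h hh
  | succ n ih =>
    have hSm : MeasurableSet {N : Node X A Z C t (n + 1) | N.AncestorsGood good} :=
      Node.measurableSet_ancestorsGood hgood
    have hFm : Measurable fun N : Node X A Z C t (n + 1) => F (N.1, N.2 (Fin.last (n + 1))) :=
      hF.comp (measurable_fst.prodMk ((measurable_pi_apply _).comp measurable_snd))
    have hr := hrule n (v (Fin.last n))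
    have hpush : Measurable fun p : (Hist A Z (t + n) × PBelief X C) × Z × PBelief X C =>
        Hist.push p.1.1 (rule n p.1.1 (v (Fin.last n))) p.2.1 :=
      Hist.measurable_push measurable_fst.fst (hr.comp measurable_fst.fst) measurable_snd.fst
    -- The last generation is integrated out: `F'` is the expected `F` at a child, cut off at bad
    -- parents. The cutoff ensures the weight condition, so `F'` satisfies the same hypothesis with
    -- `τ` multiplied by `2d`.
    set F' : Hist A Z (t + n) × PBelief X C → ℝ≥0∞ :=
      {p : Hist A Z (t + n) × PBelief X C | good n p.1 p.2}.indicator fun p =>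
        ∫⁻ q, F (Hist.push p.1 (rule n p.1 (v (Fin.last n))) q.1, q.2)
          ∂(M.genPF σ (t + n) p.2 (rule n p.1 (v (Fin.last n)))) with hF'
    have hF'm : Measurable F' := by
      refine Measurable.indicator ?_ (hgood n)
      refine measurable_lintegral_param
        (M.measurable_genPF σ (t + n) measurable_snd (hr.comp measurable_fst))
        (fun _ => prob_le_one) (f := fun (p : Hist A Z (t + n) × PBelief X C)
          (q : Z × PBelief X C) => F (Hist.push p.1 (rule n p.1 (v (Fin.last n))) q.1, q.2)) ?_
      exact hF.comp (hpush.prodMk measurable_snd.snd)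
    have hF'τ : ∀ h', M.Nondeg σ (t + n) h' →
        ∫⁻ b, F' (h', b) ∂(M.sisLaw σ C (t + n) h') ≤ 2 * ENNReal.ofReal d * τ := by
      intro h' hh'
      have hGm : MeasurableSet {b : PBelief X C | good n h' b} :=
        (measurable_prodMk_left (x := h')) (hgood n)
      have hbel := M.isProbabilityMeasure_belief σ hh'
      set a := rule n h' (v (Fin.last n)) with ha
      have e : ∫⁻ b, F' (h', b) ∂(M.sisLaw σ C (t + n) h') =
          ∫⁻ b in {b | good n h' b}, ∫⁻ q, F (Hist.push h' a q.1, q.2)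
            ∂(M.genPF σ (t + n) b a) ∂(M.sisLaw σ C (t + n) h') := by
        rw [← lintegral_indicator hGm]
        rfl
      have hFz : Measurable fun q : Z × PBelief X C => F (Hist.push h' a q.1, q.2) :=
        hF.comp ((Hist.measurable_push measurable_const measurable_const
          measurable_fst).prodMk measurable_snd)
      rw [e]
      refine (M.lintegral_genPF_sisLaw_le σ hM hn hh' a hGm
        (fun b hb => (hweight n h' b hb).le_two_mul hη) hFz).trans ?_
      gcongr
      calc _ ≤ ∫⁻ _, τ ∂(M.obsLaw σ (t + n + 1) (M.belief σ (t + n) h') a) := by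
            refine lintegral_mono_ae ?_
            filter_upwards [M.ae_nondeg_push σ hh' a] with z hz
            exact hτ _ hz
        _ = τ := by simp
    rw [M.lintegral_treeLaw_succ σ hrule h v (hFm.indicator hSm), pow_succ, mul_assoc]
    refine le_trans (lintegral_mono fun T => ?_) (ih (by omega) (Fin.init v) hF'm hF'τ)
    set N := T (Fin.init v) with hN
    rw [M.lintegral_childLaw σ N _ (hFm.indicator hSm)]
    -- A bad node on the path up to the parent is a strict ancestor of the child, so the indicator
    -- on the left vanishes in that case.
    by_cases hP : N.PathGood good
    · have h1 := (Node.pathGood_iff N).mp hP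
      rw [Set.indicator_of_mem (show N ∈ {N : Node X A Z C t n | N.AncestorsGood good} from h1.1),
        hF', Set.indicator_of_mem (show (N.1, N.2 (Fin.last n)) ∈
          {p : Hist A Z (t + n) × PBelief X C | good n p.1 p.2} from h1.2)]
      refine lintegral_mono fun q => (Set.indicator_le_self _ _ _).trans (le_of_eq ?_)
      simp only [Node.child_snd_last]
      rfl
    · refine le_trans (le_of_eq ?_) (zero_le)
      refine lintegral_eq_zero_of_ae_eq_zero (Eventually.of_forall fun q => ?_)
      exact Set.indicator_of_notMem (fun hmem => hP ((Node.ancestorsGood_child _ _ _ _).mp hmem)) _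

/-- Decomposition by the depth `l` of the first bad node. All earlier nodes carry enough weight, so
failure at depth `l` costs `(2d)^l` times the failure probability at a fixed history. -/
lemma treeLaw_not_pathGood_le {L : ℕ} {d : ℝ} (hM : M.LikelihoodRatioBound σ L d)
    {η : ℝ} (hη : η ≤ 1 / 2) (hrule : ∀ n e, Measurable fun h => rule n h e)
    (hgood : ∀ m, MeasurableSet {p : Hist A Z (t + m) × PBelief X C | good m p.1 p.2})
    (hweight : ∀ m h b, good m h b → M.WeightGood σ η (t + m) h b)
    {h : Hist A Z t} (hh : M.Nondeg σ t h) {τ : ℝ≥0∞}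
    (hτ : ∀ m, t + m ≤ L → ∀ h', M.Nondeg σ (t + m) h' →
      M.sisLaw σ C (t + m) h' {b | ¬ good m h' b} ≤ τ) (n : ℕ) (hn : t + n ≤ L)
    (v : Fin n → E) :
    M.treeLaw σ C t h rule n {T | ¬ (T v).PathGood good} ≤
      (∑ l ∈ Finset.range (n + 1), (2 * ENNReal.ofReal d) ^ l) * τ := by
  have hlast (n : ℕ) (hn : t + n ≤ L) (v : Fin n → E) :
      M.treeLaw σ C t h rule n
        {T | (T v).AncestorsGood good ∧ ¬ good n (T v).1 ((T v).2 (Fin.last n))} ≤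
      (2 * ENNReal.ofReal d) ^ n * τ := by
    set F : Hist A Z (t + n) × PBelief X C → ℝ≥0∞ :=
      {p : Hist A Z (t + n) × PBelief X C | good n p.1 p.2}ᶜ.indicator 1 with hF
    have hFm : Measurable F := measurable_one.indicator (hgood n).compl
    have hA : MeasurableSet {N : Node X A Z C t n | N.AncestorsGood good} :=
      Node.measurableSet_ancestorsGood hgood
    have hG : MeasurableSet {N : Node X A Z C t n | ¬ good n N.1 (N.2 (Fin.last n))} :=
      (measurable_fst.prodMk ((measurable_pi_apply _).comp measurable_snd) :
        Measurable fun N : Node X A Z C t n => (N.1, N.2 (Fin.last n))) (hgood n).compl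
    refine le_trans (le_of_eq ?_) (M.lintegral_treeLaw_ancestorsGood_le σ hM hη hrule hgood
      hweight hh n hn v hFm (τ := τ) fun h' hh' => ?_)
    · change M.treeLaw σ C t h rule n ((fun T => T v) ⁻¹'
        ({N : Node X A Z C t n | N.AncestorsGood good} ∩
          {N : Node X A Z C t n | ¬ good n N.1 (N.2 (Fin.last n))})) = _
      rw [← lintegral_indicator_one ((measurable_pi_apply v) (hA.inter hG))]
      refine lintegral_congr fun T => ?_
      by_cases h1 : (T v).AncestorsGood good <;>
        by_cases h2 : good n (T v).1 ((T v).2 (Fin.last n)) <;>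
          simp [Set.indicator, h1, h2, hF]
    · refine le_trans (le_of_eq ?_) (hτ n hn h' hh')
      exact lintegral_indicator_one (s := {b | ¬ good n h' b})
        ((measurable_prodMk_left (x := h')) (hgood n).compl)
  have hsub (n : ℕ) (v : Fin n → E) : {T : (Fin n → E) → Node X A Z C t n |
      ¬ (T v).PathGood good} ⊆ {T | ¬ (T v).AncestorsGood good} ∪
        {T | (T v).AncestorsGood good ∧ ¬ good n (T v).1 ((T v).2 (Fin.last n))} := by
    intro T hT
    by_cases h1 : (T v).AncestorsGood good
    · exact Or.inr ⟨h1, fun h2 => hT ((Node.pathGood_iff _).mpr ⟨h1, h2⟩)⟩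
    · exact Or.inl h1
  induction n with
  | zero =>
    refine (measure_mono (hsub 0 v)).trans ((measure_union_le _ _).trans ?_)
    have h0 : {T : (Fin 0 → E) → Node X A Z C t 0 | ¬ (T v).AncestorsGood good} = ∅ := by
      ext T
      simp [Node.AncestorsGood]
    rw [h0, measure_empty, zero_add]
    simpa using hlast 0 hn v
  | succ n ih =>
    refine (measure_mono (hsub (n + 1) v)).trans ((measure_union_le _ _).trans ?_)
    rw [Finset.sum_range_succ, add_mul]
    -- Failure at a strict ancestor of the leaf `v` is failure on the path to its parent, one
    -- generation earlier; only failure at the leaf itself is new.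
    refine add_le_add (le_trans (le_of_eq ?_) (ih (by omega) (Fin.init v))) (hlast (n + 1) hn v)
    have hA : MeasurableSet {N : Node X A Z C t (n + 1) | ¬ N.AncestorsGood good} :=
      (Node.measurableSet_ancestorsGood hgood).compl
    have hP : MeasurableSet {N : Node X A Z C t n | ¬ N.PathGood good} :=
      (Node.measurableSet_pathGood hgood).compl
    have hA1 := measurable_one (α := ℝ≥0∞).indicator hA
    change M.treeLaw σ C t h rule (n + 1)
      ((fun T => T v) ⁻¹' {N : Node X A Z C t (n + 1) | ¬ N.AncestorsGood good}) =
      M.treeLaw σ C t h rule n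
        ((fun T => T (Fin.init v)) ⁻¹' {N : Node X A Z C t n | ¬ N.PathGood good})
    rw [← lintegral_indicator_one ((measurable_pi_apply v) hA),
      ← lintegral_indicator_one ((measurable_pi_apply (Fin.init v)) hP)]
    refine (M.lintegral_treeLaw_succ σ hrule h v hA1).trans (lintegral_congr fun T => ?_)
    rw [M.lintegral_childLaw σ _ _ hA1]
    by_cases hPT : (T (Fin.init v)).PathGood good
    · simp [Set.indicator, Node.ancestorsGood_child, hPT]
    · simp [Set.indicator, Node.ancestorsGood_child, hPT]

end Model

end PBMDP

namespace PBMDP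

namespace Model

variable {X A Z : Type*} [MeasurableSpace X] [MeasurableSpace A] [MeasurableSpace Z]
  (M : Model X A Z) (σ : ℕ → ObsChoice) {C : ℕ} {ι : Type*} [Fintype ι]

/-! ### Reward estimates -/

/-- A bound for the change of the action value of the particle-belief MDP when the reward changes
by at most `e`, for all policies whose actions are among those that the selectors `s` propose. -/
def rewardError (e : ℕ → X → A → ℝ≥0∞) (s : ι → (t : ℕ) → Hist A Z t → A) :
    (n t : ℕ) → Hist A Z t → PBelief X C → A → ℝ≥0∞
  | 0, t, _, b, a => ∫⁻ x, e t x a ∂(PBelief.toMeasure b)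
  | n + 1, t, h, b, a =>
      (∫⁻ x, e t x a ∂(PBelief.toMeasure b)) +
        ∑ k, ∫⁻ q : Z × PBelief X C, rewardError e s n (t + 1) (h.push a q.1) q.2
          (s k (t + 1) (h.push a q.1)) ∂(M.genPF σ t b a)

/-- The number of rewards that enter the reward error. -/
def branchSum (K : ℕ) : ℕ → ℝ≥0∞
  | 0 => 1
  | n + 1 => 1 + K * branchSum K n

variable [NeZero C] {Ω : Type*} [MeasurableSpace Ω]

lemma measurable_rewardError {e : Ω → ℕ → X → A → ℝ≥0∞}
    (he : ∀ i, Measurable fun q : Ω × X × A => e q.1 i q.2.1 q.2.2)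
    {s : ι → (t : ℕ) → Hist A Z t → A} (hs : ∀ k t, Measurable (s k t)) (n t : ℕ) :
    Measurable fun p : Ω × Hist A Z t × PBelief X C × A =>
      M.rewardError σ (e p.1) s n t p.2.1 p.2.2.1 p.2.2.2 := by
  have h0 (t : ℕ) : Measurable fun p : Ω × Hist A Z t × PBelief X C × A =>
      ∫⁻ x, e p.1 t x p.2.2.2 ∂(PBelief.toMeasure p.2.2.1) :=
    measurable_lintegral_param (PBelief.measurable_toMeasure.comp measurable_snd.snd.fst)
      (fun p => prob_le_one (μ := PBelief.toMeasure p.2.2.1))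
      (f := fun (p : Ω × Hist A Z t × PBelief X C × A) x => e p.1 t x p.2.2.2)
      ((he t).comp (measurable_fst.fst.prodMk
        (measurable_snd.prodMk measurable_fst.snd.snd.snd)))
  induction n generalizing t with
  | zero => exact h0 t
  | succ n ih =>
    refine (h0 t).add (Finset.measurable_sum _ fun k _ => ?_)
    have hpush : Measurable fun q : (Ω × Hist A Z t × PBelief X C × A) × Z × PBelief X C =>
        q.1.2.1.push q.1.2.2.2 q.2.1 :=
      Hist.measurable_push measurable_fst.snd.fst measurable_fst.snd.snd.snd measurable_snd.fst
    refine measurable_lintegral_param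
      (M.measurable_genPF σ t measurable_snd.snd.fst measurable_snd.snd.snd)
      (fun p => prob_le_one)
      (f := fun (p : Ω × Hist A Z t × PBelief X C × A) (q : Z × PBelief X C) =>
        M.rewardError σ (e p.1) s n (t + 1) (p.2.1.push p.2.2.2 q.1) q.2
          (s k (t + 1) (p.2.1.push p.2.2.2 q.1))) ?_
    exact (ih (t + 1)).comp (measurable_fst.fst.prodMk (hpush.prodMk
      (measurable_snd.snd.prodMk ((hs k _).comp hpush))))

/-- The transitions do not depend on `ω`, so Tonelli averages every state reward error over the
estimate first. Only an error bound for each fixed state and action is needed, and it holds at every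
particle belief, with no condition on its weight. -/
lemma lintegral_rewardError_le (P : Measure Ω) [IsProbabilityMeasure P]
    {e : Ω → ℕ → X → A → ℝ≥0∞}
    (he : ∀ i, Measurable fun q : Ω × X × A => e q.1 i q.2.1 q.2.2) {L : ℕ} {κ : ℝ≥0∞}
    (hκ : ∀ i ≤ L, ∀ x a, ∫⁻ ω, e ω i x a ∂P ≤ κ)
    {s : ι → (t : ℕ) → Hist A Z t → A} (hs : ∀ k t, Measurable (s k t)) (n t : ℕ)
    (htn : t + n ≤ L) (h : Hist A Z t) (b : PBelief X C) (a : A) :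
    ∫⁻ ω, M.rewardError σ (e ω) s n t h b a ∂P ≤ κ * branchSum (Fintype.card ι) n := by
  have hem (t : ℕ) (a : A) : Measurable fun p : Ω × X => e p.1 t p.2 a :=
    (he t).comp (measurable_fst.prodMk (measurable_snd.prodMk measurable_const))
  have h0 (t : ℕ) (ht : t ≤ L) (b : PBelief X C) (a : A) :
      ∫⁻ ω, ∫⁻ x, e ω t x a ∂(PBelief.toMeasure b) ∂P ≤ κ := by
    rw [lintegral_lintegral_swap (hem t a).aemeasurable]
    calc _ ≤ ∫⁻ _, κ ∂(PBelief.toMeasure b) := lintegral_mono fun x => hκ t ht x a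
      _ = κ := by simp
  induction n generalizing t b a with
  | zero => simpa [rewardError, branchSum] using h0 t (by omega) b a
  | succ n ih =>
    have hpush : Measurable fun q : Ω × Z × PBelief X C => h.push a q.2.1 :=
      Hist.measurable_push measurable_const measurable_const measurable_snd.fst
    have hm (k : ι) : Measurable fun q : Ω × Z × PBelief X C =>
        M.rewardError σ (e q.1) s n (t + 1) (h.push a q.2.1) q.2.2
          (s k (t + 1) (h.push a q.2.1)) :=
      (M.measurable_rewardError σ he hs n (t + 1)).comp (measurable_fst.prodMk
        (hpush.prodMk (measurable_snd.snd.prodMk ((hs k _).comp hpush))))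
    simp only [rewardError, branchSum]
    rw [lintegral_add_left (hem t a).lintegral_prod_right',
      lintegral_finsetSum _ fun k _ => (hm k).lintegral_prod_right', mul_add, mul_one]
    refine add_le_add (h0 t (by omega) b a) ?_
    calc _ ≤ ∑ _k : ι, κ * branchSum (Fintype.card ι) n := by
          refine Finset.sum_le_sum fun k _ => ?_
          rw [lintegral_lintegral_swap (hm k).aemeasurable]
          refine (lintegral_mono (g := fun _ => κ * branchSum (Fintype.card ι) n)
            fun q : Z × PBelief X C => ih (t + 1) (by omega) (h.push a q.1) q.2
              (s k (t + 1) (h.push a q.1))).trans (le_of_eq ?_)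
          simp
      _ = _ := by
          rw [Finset.sum_const, Finset.card_univ, nsmul_eq_mul]
          ring

/-- Both values use the same transitions and policy, so only reward differences accumulate, with
discount at most one; the sum over selectors again replaces the policy's action. -/
lemma abs_pbmdpQAux_sub_le {γ : ℝ} (hγ0 : 0 ≤ γ) (hγ1 : γ ≤ 1) {L : ℕ} {R : ℝ} (hR : 0 ≤ R)
    {r₁ r₂ : ℕ → X → A → ℝ} (hr₁ : ∀ i ≤ L, ∀ x a, |r₁ i x a| ≤ R)
    (hr₂ : ∀ i ≤ L, ∀ x a, |r₂ i x a| ≤ R)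
    (hm₁ : ∀ i, Measurable fun p : X × A => r₁ i p.1 p.2)
    (hm₂ : ∀ i, Measurable fun p : X × A => r₂ i p.1 p.2)
    {s : ι → (t : ℕ) → Hist A Z t → A} (hs : ∀ k t, Measurable (s k t)) {π : Policy A Z}
    (hπ : ∀ t h, ∃ k, π.act t h = s k t h) (n t : ℕ) (htn : t + n ≤ L) (h : Hist A Z t)
    (b : PBelief X C) (a : A) :
    ENNReal.ofReal |M.pbmdpQAux σ γ r₁ π n t h b a - M.pbmdpQAux σ γ r₂ π n t h b a| ≤
      M.rewardError σ (fun i x a => ENNReal.ofReal |r₁ i x a - r₂ i x a|) s n t h b a := by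
  set e : ℕ → X → A → ℝ≥0∞ := fun i x a => ENNReal.ofReal |r₁ i x a - r₂ i x a| with he
  -- The two rewards are deterministic here; `Unit` plays the role of the randomness in
  -- `measurable_rewardError`.
  have hem (i : ℕ) : Measurable fun q : Unit × X × A => e i q.2.1 q.2.2 :=
    (continuous_abs.measurable.comp (((hm₁ i).sub (hm₂ i)).comp measurable_snd)).ennreal_ofReal
  have h0 (t : ℕ) (ht : t ≤ L) (b : PBelief X C) (a : A) :
      ENNReal.ofReal |∫ x, r₁ t x a ∂(PBelief.toMeasure b) -
        ∫ x, r₂ t x a ∂(PBelief.toMeasure b)| ≤ ∫⁻ x, e t x a ∂(PBelief.toMeasure b) := by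
    have hx : Measurable fun x : X => (x, a) := measurable_id'.prodMk measurable_const
    rw [← integral_sub (f := fun x => r₁ t x a) (g := fun x => r₂ t x a)
      (integrable_of_abs_le ((hm₁ t).comp hx) fun x => hr₁ t ht x a)
      (integrable_of_abs_le ((hm₂ t).comp hx) fun x => hr₂ t ht x a)]
    exact ofReal_abs_integral_le _ _
  induction n generalizing t b a with
  | zero => exact h0 t (by omega) b a
  | succ n ih =>
    have hpush : Measurable fun q : Z × PBelief X C => h.push a q.1 :=
      Hist.measurable_push measurable_const measurable_const measurable_fst
    have hg {rr : ℕ → X → A → ℝ} (hm : ∀ i, Measurable fun p : X × A => rr i p.1 p.2)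
        (hr : ∀ i ≤ L, ∀ x a, |rr i x a| ≤ R) :
        Integrable (fun q : Z × PBelief X C => M.pbmdpQAux σ γ rr π n (t + 1) (h.push a q.1) q.2
          (π.act (t + 1) (h.push a q.1))) (M.genPF σ t b a) :=
      integrable_of_abs_le ((M.measurable_pbmdpQAux σ γ hm π n (t + 1)).comp
        (hpush.prodMk (measurable_snd.prodMk ((π.measurable_act _).comp hpush))))
        fun q => M.abs_pbmdpQAux_le σ hγ0 hγ1 hR hr π n (t + 1) (by omega) _ _ _
    have hem' (k : ι) : Measurable fun q : Z × PBelief X C =>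
        M.rewardError σ e s n (t + 1) (h.push a q.1) q.2 (s k (t + 1) (h.push a q.1)) :=
      (M.measurable_rewardError (Ω := Unit) σ (e := fun _ => e) hem hs n (t + 1)).comp
        ((measurable_const (a := ())).prodMk
          (hpush.prodMk (measurable_snd.prodMk ((hs k _).comp hpush))))
    have hfut : ENNReal.ofReal |∫ q : Z × PBelief X C, M.pbmdpQAux σ γ r₁ π n (t + 1)
          (h.push a q.1) q.2 (π.act (t + 1) (h.push a q.1)) ∂(M.genPF σ t b a) -
        ∫ q : Z × PBelief X C, M.pbmdpQAux σ γ r₂ π n (t + 1) (h.push a q.1) q.2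
          (π.act (t + 1) (h.push a q.1)) ∂(M.genPF σ t b a)| ≤
        ∑ k, ∫⁻ q : Z × PBelief X C, M.rewardError σ e s n (t + 1) (h.push a q.1) q.2
            (s k (t + 1) (h.push a q.1)) ∂(M.genPF σ t b a) := by
      rw [← integral_sub (hg hm₁ hr₁) (hg hm₂ hr₂), ← lintegral_finsetSum _ fun k _ => hem' k]
      refine (ofReal_abs_integral_le _ _).trans (lintegral_mono fun q => ?_)
      refine (ih (t + 1) (by omega) (h.push a q.1) q.2 _).trans ?_
      obtain ⟨k, hk⟩ := hπ (t + 1) (h.push a q.1)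
      rw [hk]
      exact Finset.single_le_sum (f := fun k => M.rewardError σ e s n (t + 1)
        (h.push a q.1) q.2 (s k (t + 1) (h.push a q.1))) (fun _ _ => zero_le)
        (Finset.mem_univ k)
    refine le_trans ?_ (add_le_add (h0 t (by omega) b a) hfut)
    rw [← ENNReal.ofReal_add (abs_nonneg _) (abs_nonneg _)]
    refine ENNReal.ofReal_le_ofReal ?_
    simp only [pbmdpQAux]
    rw [add_sub_add_comm, ← mul_sub]
    refine (abs_add_le _ _).trans ?_
    refine add_le_add le_rfl ?_
    rw [abs_mul, abs_of_nonneg hγ0]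
    exact mul_le_of_le_one_left (abs_nonneg _) hγ1

/-- Split at the threshold `ν`: below it the error is at most `ν`, above it at most `2R`, which has
small probability. The estimator's boundedness turns its tail bound into a bound in mean. -/
lemma IsRewardEstimator.lintegral_abs_sub_le {M : Model X A Z} {P : Measure Ω}
    [IsProbabilityMeasure P] {est : ℕ → Ω → ℕ → X → A → ℝ} {L : ℕ} {δr : ℝ → ℕ → ℝ}
    {Rest : ℕ → ℝ} (hest : M.IsRewardEstimator P est L δr Rest) {R : ℝ}
    (hr : ∀ i ≤ L, ∀ x a, |M.r i x a| ≤ R) (hRest : ∀ i ≤ L, Rest i ≤ R) {ν : ℝ} (hν : 0 < ν)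
    (N i : ℕ) (hi : i ≤ L) (x : X) (a : A) :
    ∫⁻ ω, ENNReal.ofReal |M.r i x a - est N ω i x a| ∂P ≤
      ENNReal.ofReal ν + ENNReal.ofReal (2 * R) * ENNReal.ofReal (δr ν N) := by
  have hm : Measurable fun ω => |M.r i x a - est N ω i x a| := by
    have h1 : Measurable fun ω => est N ω i x a :=
      (hest.measurable_est N i).comp
        (measurable_id'.prodMk (measurable_const (a := (x, a))))
    exact continuous_abs.measurable.comp (measurable_const.sub h1)
  have hS : MeasurableSet {ω | ν ≤ |M.r i x a - est N ω i x a|} :=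
    measurableSet_le measurable_const hm
  calc ∫⁻ ω, ENNReal.ofReal |M.r i x a - est N ω i x a| ∂P
      ≤ ∫⁻ ω, (ENNReal.ofReal ν + {ω | ν ≤ |M.r i x a - est N ω i x a|}.indicator
          (fun _ => ENNReal.ofReal (2 * R)) ω) ∂P := by
        refine lintegral_mono fun ω => ?_
        by_cases hω : ν ≤ |M.r i x a - est N ω i x a|
        · rw [Set.indicator_of_mem (show ω ∈ {ω | ν ≤ |M.r i x a - est N ω i x a|} from hω)]
          refine le_add_left (ENNReal.ofReal_le_ofReal ((abs_sub _ _).trans ?_))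
          linarith [hr i hi x a, (hest.bounded N ω i hi x a).trans (hRest i hi)]
        · exact le_add_right (ENNReal.ofReal_le_ofReal (not_le.mp hω).le)
    _ = ENNReal.ofReal ν + ENNReal.ofReal (2 * R) *
          P {ω | ν ≤ |M.r i x a - est N ω i x a|} := by
        rw [lintegral_add_left measurable_const, lintegral_indicator_const hS]
        simp
    _ ≤ _ := by
        gcongr
        exact hest.concentration N i hi x a ν hν

end Model

end PBMDP

namespace PBMDP

/-! ### Constants -/

/-- The recursion is largest at `γ = 1`, where it adds `2λ` per step. -/
lemma alpha_le {γ lam : ℝ} (hγ0 : 0 ≤ γ) (hγ1 : γ ≤ 1) (hl : 0 ≤ lam) (n : ℕ) :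
    0 ≤ alpha γ lam n ∧ alpha γ lam n ≤ (2 * n + 1) * lam := by
  induction n with
  | zero => simp [alpha, hl]
  | succ n ih =>
    obtain ⟨h0, h1⟩ := ih
    simp only [alpha]
    push_cast
    constructor
    · positivity
    · nlinarith [mul_le_of_le_one_left h0 hγ1, mul_le_of_le_one_left hl hγ1]

lemma beta_le {γ ν : ℝ} (hγ0 : 0 ≤ γ) (hγ1 : γ ≤ 1) (hν : 0 ≤ ν) (n : ℕ) :
    0 ≤ beta γ ν n ∧ beta γ ν n ≤ (2 * n + 2) * ν := by
  induction n with
  | zero => simp [beta, hν]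
  | succ n ih =>
    obtain ⟨h0, h1⟩ := ih
    simp only [beta]
    push_cast
    constructor
    · positivity
    · nlinarith [mul_le_of_le_one_left h0 hγ1]

lemma tendsto_natCast_pow_mul_exp_neg (n : ℕ) {κ : ℝ} (hκ : 0 < κ) (c : ℝ) :
    Tendsto (fun C : ℕ => c * ((C : ℝ) ^ n * Real.exp (-(C * κ)))) atTop (𝓝 0) := by
  have h1 := (Real.tendsto_pow_mul_exp_neg_atTop_nhds_zero n).comp
    (tendsto_natCast_atTop_atTop.atTop_mul_const hκ :
      Tendsto (fun C : ℕ => (C : ℝ) * κ) atTop atTop)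
  have h2 := h1.const_mul (c / κ ^ n)
  rw [mul_zero] at h2
  refine h2.congr fun C => ?_
  simp only [Function.comp_apply]
  rw [mul_pow]
  have : κ ^ n ≠ 0 := by positivity
  field_simp

/-- Once `1 / √C` takes up at most half of `λ / (4Vd)`, the rate is bounded below independently of
`C`; this makes the confidence requirement a power of `C` times a decaying exponential. -/
lemma le_kacute {V d lam : ℝ} (hV : 0 < V) {C : ℕ}
    (hC : 1 / Real.sqrt C ≤ lam / (8 * V * d)) :
    min (lam / (8 * V * d)) (lam / (4 * Real.sqrt 2 * V)) ≤ kacute V d lam C := by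
  have h : lam / (4 * V * d) = lam / (8 * V * d) + lam / (8 * V * d) := by
    rcases eq_or_ne d 0 with rfl | hd
    · simp
    · field_simp; ring
  refine min_le_min ?_ le_rfl
  rw [kmax, h]
  linarith

/-- The constants can be chosen such that the requirements hold and, moreover, the given bounds
for the failure probabilities are small. -/
lemma exists_admissible (L : ℕ) {γ : ℝ} (hγ0 : 0 < γ) (hγ1 : γ ≤ 1) {V d : ℝ} (hV : 0 < V)
    (hd : 0 < d) {δr : ℝ → ℕ → ℝ} (hδr : ∀ ν : ℝ, 0 < ν → Tendsto (δr ν) atTop (𝓝 0)) (K : ℕ)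
    {ε δ : ℝ} (hε : 0 < ε) (hδ : 0 < δ) {η D : ℝ} (hη : 0 < η) (hD : 0 < D)
    {Γ₁ Γ₂ : ℝ≥0∞} (hΓ₁ : Γ₁ ≠ ⊤) (hΓ₂ : Γ₂ ≠ ⊤) (R : ℝ) :
    ∃ (lam ν : ℝ) (C Nr : ℕ) (ν' : ℝ), Admissible L γ V d δr K ε δ lam ν C Nr ∧ 0 < ν' ∧
      ((C * K + 1 : ℕ) : ℝ≥0∞) ^ L * (Γ₁ * Model.hoeffdingBound C η D) ≤
        ENNReal.ofReal (δ / 2) ∧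
      ((C * K + 1 : ℕ) : ℝ≥0∞) ^ L * (Γ₂ * (ENNReal.ofReal ν' +
        ENNReal.ofReal (2 * R) * ENNReal.ofReal (δr ν' Nr))) ≤ ENNReal.ofReal (δ / 2) := by
  -- With `ν = λ` the precision terms sum to at most `(2n + 1)λ + (2n + 2)λ ≤ 4(L + 1)λ`.
  set lam : ℝ := ε / (4 * (L + 1)) with hlam
  have hlam0 : 0 < lam := by positivity
  have hlamε : 4 * (L + 1) * lam = ε := by rw [hlam]; field_simp
  set x₀ : ℝ := lam / (8 * V * d) with hx₀
  have hx₀pos : 0 < x₀ := by positivity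
  set k₀ : ℝ := min x₀ (lam / (4 * Real.sqrt 2 * V)) with hk₀
  have hk₀pos : 0 < k₀ := lt_min hx₀pos (by positivity)
  have hsqrt : ∀ᶠ C : ℕ in atTop, 1 / Real.sqrt C ≤ x₀ := by
    have h : Tendsto (fun C : ℕ => 1 / Real.sqrt C) atTop (𝓝 0) := by
      simp_rw [one_div]
      exact (Real.tendsto_sqrt_atTop.comp tendsto_natCast_atTop_atTop).inv_tendsto_atTop
    exact (h.eventually (gt_mem_nhds hx₀pos)).mono fun C hC => hC.le
  have hconf : ∀ᶠ C : ℕ in atTop,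
      5 * (4 * (K : ℝ)) ^ (L + 1) * ((C : ℝ) ^ (L + 1) * Real.exp (-(C * k₀ ^ 2))) < δ / 2 :=
    (tendsto_natCast_pow_mul_exp_neg (L + 1) (by positivity)
      (5 * (4 * (K : ℝ)) ^ (L + 1))).eventually (gt_mem_nhds (by positivity))
  have hfail : ∀ᶠ C : ℕ in atTop,
      (K + 1 : ℝ) ^ L * Γ₁.toReal * 2 * ((C : ℝ) ^ L * Real.exp (-(C * (η ^ 2 / (2 * D ^ 2))))) <
        δ / 2 :=
    (tendsto_natCast_pow_mul_exp_neg L (by positivity)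
      ((K + 1 : ℝ) ^ L * Γ₁.toReal * 2)).eventually (gt_mem_nhds (by positivity))
  obtain ⟨C, hCs, hCc, hCf, hC1⟩ :=
    (hsqrt.and (hconf.and (hfail.and (eventually_ge_atTop 1)))).exists
  have hC1' : (1 : ℝ) ≤ C := by exact_mod_cast hC1
  -- The tree has order `C^L` leaves, so the reward threshold `ν'` can be chosen only after `C`, and
  -- the sample number only after `ν'`. The `+ 1` in `ν'` guards against `Q = 0`.
  set Q : ℝ≥0∞ := ((C * K + 1 : ℕ) : ℝ≥0∞) ^ L * Γ₂ with hQ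
  have hQt : Q ≠ ⊤ := ENNReal.mul_ne_top (ENNReal.pow_ne_top (ENNReal.natCast_ne_top _)) hΓ₂
  set ν' : ℝ := δ / 4 / (Q.toReal + 1) with hν'
  have hν'0 : 0 < ν' := by
    have := ENNReal.toReal_nonneg (a := Q)
    positivity
  have hQν : Q.toReal * ν' ≤ δ / 4 := by
    have hq := ENNReal.toReal_nonneg (a := Q)
    rw [hν', mul_div_assoc', div_le_iff₀ (by positivity)]
    nlinarith
  have hN1 : ∀ᶠ N in atTop, 5 * (4 * (K : ℝ) * C) ^ (L + 1) * δr lam N < δ / 2 := by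
    have h := (hδr lam hlam0).const_mul (5 * (4 * (K : ℝ) * C) ^ (L + 1))
    rw [mul_zero] at h
    exact h.eventually (gt_mem_nhds (by positivity))
  -- Absolute values, because neither `R` nor `δr` is assumed nonnegative here.
  have hN2 : ∀ᶠ N in atTop, Q.toReal * (|2 * R| * |δr ν' N|) < δ / 4 := by
    have h := ((hδr ν' hν'0).abs.const_mul |2 * R|).const_mul Q.toReal
    rw [abs_zero, mul_zero, mul_zero] at h
    exact h.eventually (gt_mem_nhds (by positivity))
  obtain ⟨N, hN1, hN2⟩ := (hN1.and hN2).exists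
  have hkac : k₀ ≤ kacute V d lam C := le_kacute hV hCs
  refine ⟨lam, lam, C, N, ν', ⟨hlam0, hlam0, hC1, ?_, ?_, ?_⟩, hν'0, ?_, ?_⟩
  · exact hk₀pos.trans_le (hkac.trans (min_le_left _ _))
  · intro n hn
    have h1 := (alpha_le hγ0.le hγ1 hlam0.le n).2
    have h2 := (beta_le hγ0.le hγ1 hlam0.le n).2
    have hn' : (n : ℝ) ≤ L := by exact_mod_cast hn
    nlinarith
  · have hexp : Real.exp (-(C * kacute V d lam C ^ 2)) ≤ Real.exp (-(C * k₀ ^ 2)) := by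
      refine Real.exp_le_exp.mpr (neg_le_neg ?_)
      gcongr
    have hpow : (0 : ℝ) ≤ 5 * (4 * (K : ℝ) * C) ^ (L + 1) := by positivity
    have h1 := mul_le_mul_of_nonneg_left hexp hpow
    have h2 : 5 * (4 * (K : ℝ) * C) ^ (L + 1) * Real.exp (-(C * k₀ ^ 2)) =
        5 * (4 * (K : ℝ)) ^ (L + 1) * ((C : ℝ) ^ (L + 1) * Real.exp (-(C * k₀ ^ 2))) := by
      rw [mul_pow]; ring
    rw [mul_add]
    linarith
  -- Uses `C ≥ 1`; the branching number is thus linear in `C`, and `hfail` applies.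
  · have hle : ((C * K + 1 : ℕ) : ℝ) ≤ (K + 1) * C := by
      push_cast
      nlinarith
    rw [Model.hoeffdingBound, ← ENNReal.ofReal_toReal hΓ₁, ← ENNReal.ofReal_natCast,
      ← ENNReal.ofReal_pow (by positivity), ← ENNReal.ofReal_mul ENNReal.toReal_nonneg,
      ← ENNReal.ofReal_mul (by positivity)]
    refine ENNReal.ofReal_le_ofReal (le_trans ?_ hCf.le)
    have hp : ((C * K + 1 : ℕ) : ℝ) ^ L ≤ (K + 1 : ℝ) ^ L * (C : ℝ) ^ L := by
      rw [← mul_pow]; gcongr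
    calc _ ≤ (K + 1 : ℝ) ^ L * (C : ℝ) ^ L * (Γ₁.toReal *
          (2 * Real.exp (-(C * (η ^ 2 / (2 * D ^ 2)))))) := by gcongr
      _ = _ := by ring
  · rw [← mul_assoc, ← hQ, ← ENNReal.ofReal_toReal hQt]
    calc ENNReal.ofReal Q.toReal * (ENNReal.ofReal ν' +
          ENNReal.ofReal (2 * R) * ENNReal.ofReal (δr ν' N))
        ≤ ENNReal.ofReal Q.toReal * (ENNReal.ofReal ν' +
          ENNReal.ofReal |2 * R| * ENNReal.ofReal |δr ν' N|) := by
          gcongr <;> exact le_abs_self _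
      _ = ENNReal.ofReal (Q.toReal * (ν' + |2 * R| * |δr ν' N|)) := by
          rw [← ENNReal.ofReal_mul (abs_nonneg _), ← ENNReal.ofReal_add hν'0.le (by positivity),
            ← ENNReal.ofReal_mul ENNReal.toReal_nonneg]
      _ ≤ _ := ENNReal.ofReal_le_ofReal (by rw [mul_add]; linarith)

lemma holdsWithProb_of_compl_le {Ω : Type*} [MeasurableSpace Ω] {P : Measure Ω}
    [IsProbabilityMeasure P] {δ : ℝ} (hδ : 0 ≤ δ) {G S : Set Ω} (hG : MeasurableSet G)
    (hGS : G ⊆ S) (hP : P Gᶜ ≤ ENNReal.ofReal δ) : HoldsWithProb P (1 - δ) S := by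
  refine ⟨G, hG, hGS, ?_⟩
  rw [ENNReal.ofReal_sub _ hδ, ENNReal.ofReal_one, tsub_le_iff_right,
    ← prob_add_prob_compl (μ := P) hG]
  gcongr

end PBMDP

namespace PBMDP

namespace Model

/-! ### Finiteness of the constants -/

lemma excessConst_ne_top {B D : ℝ≥0∞} (hB : B ≠ ⊤) (hD : D ≠ ⊤) (K n : ℕ) :
    excessConst B D K n ≠ ⊤ := by
  induction n with
  | zero => exact ENNReal.mul_ne_top ENNReal.ofNat_ne_top hB
  | succ n ih =>
    exact ENNReal.add_ne_top.mpr ⟨ENNReal.mul_ne_top ENNReal.ofNat_ne_top hB,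
      ENNReal.mul_ne_top (ENNReal.natCast_ne_top K)
        (ENNReal.mul_ne_top (ENNReal.mul_ne_top ENNReal.ofNat_ne_top hD) ih)⟩

lemma branchSum_ne_top (K n : ℕ) : branchSum K n ≠ ⊤ := by
  induction n with
  | zero => simp [branchSum]
  | succ n ih => simp [branchSum, ENNReal.mul_eq_top, ih]

/-- The factor by which the probability that a path of the tree is bad exceeds the Hoeffding
bound. -/
def pathConst (B D θ : ℝ≥0∞) (K J L : ℕ) : ℝ≥0∞ :=
  (∑ l ∈ Finset.range (L + 1), (2 * D) ^ l) *
    (1 + J * ((∑ l ∈ Finset.range (L + 1), excessConst B D K l) / θ))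

lemma pathConst_ne_top {B D θ : ℝ≥0∞} (hB : B ≠ ⊤) (hD : D ≠ ⊤) (hθ : θ ≠ 0) (K J L : ℕ) :
    pathConst B D θ K J L ≠ ⊤ := by
  refine ENNReal.mul_ne_top (ENNReal.sum_ne_top.mpr fun l _ => ENNReal.pow_ne_top
    (ENNReal.mul_ne_top ENNReal.ofNat_ne_top hD)) (ENNReal.add_ne_top.mpr ⟨ENNReal.one_ne_top,
      ENNReal.mul_ne_top (ENNReal.natCast_ne_top J) (ENNReal.div_ne_top
        (ENNReal.sum_ne_top.mpr fun l _ => excessConst_ne_top hB hD K l) hθ)⟩)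

/-- The factor by which the probability that a reward error on a path of the tree is large exceeds
the expected reward error. -/
def errorConst (θ : ℝ≥0∞) (K J L : ℕ) : ℝ≥0∞ :=
  (L + 1 : ℕ) * (J * ((∑ l ∈ Finset.range (L + 1), branchSum K l) / θ))

lemma errorConst_ne_top {θ : ℝ≥0∞} (hθ : θ ≠ 0) (K J L : ℕ) : errorConst θ K J L ≠ ⊤ :=
  ENNReal.mul_ne_top (ENNReal.natCast_ne_top _) (ENNReal.mul_ne_top (ENNReal.natCast_ne_top J)
    (ENNReal.div_ne_top (ENNReal.sum_ne_top.mpr fun l _ => branchSum_ne_top K l) hθ))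

/-! ### Good trees -/

variable {X A Z : Type*} [MeasurableSpace X] [MeasurableSpace A] [MeasurableSpace Z]
  (M : Model X A Z) (σ : ℕ → ObsChoice) {C t : ℕ} {ι J E : Type*} [Fintype ι]

/-- At a node of depth `m` the particle belief approximates well, and the excess is small for the
actions `acts`. -/
def NodeGood (L : ℕ) (η : ℝ) (B θ : ℝ≥0∞) (s : ι → (t : ℕ) → Hist A Z t → A)
    (acts : J → (m : ℕ) → Hist A Z (t + m) → A) (m : ℕ) (h : Hist A Z (t + m))
    (b : PBelief X C) : Prop :=
  M.WeightGood σ η (t + m) h b ∧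
    ∀ j, M.excess σ η B s (L - (t + m)) (t + m) h b (acts j m h) ≤ θ

/-- The reward errors at all nodes of a tree are small. -/
def ErrorGood (L : ℕ) (θ : ℝ≥0∞) (s : ι → (t : ℕ) → Hist A Z t → A)
    (acts : J → (m : ℕ) → Hist A Z (t + m) → A) (e : ℕ → X → A → ℝ≥0∞) {n : ℕ}
    (T : (Fin n → E) → Node X A Z C t n) : Prop :=
  ∀ (v : Fin n → E) (k : Fin (n + 1)) (j : J), M.rewardError σ e s (L - (t + k)) (t + k)
    ((T v).hist k) ((T v).pbelief k) (acts j k ((T v).hist k)) ≤ θ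

variable {s : ι → (t : ℕ) → Hist A Z t → A} {acts : J → (m : ℕ) → Hist A Z (t + m) → A}
  {rule : (n : ℕ) → Hist A Z (t + n) → E → A} {L : ℕ}

lemma errorGood_compl_eq {Ω : Type*} (θ : ℝ≥0∞) (e : Ω → ℕ → X → A → ℝ≥0∞) (n : ℕ) :
    {q : Ω × ((Fin n → E) → Node X A Z C t n) |
      M.ErrorGood σ L θ s acts (e q.1) q.2}ᶜ =
    ⋃ (v : Fin n → E) (k : Fin (n + 1)) (j : J), {q | θ < M.rewardError σ (e q.1) s
      (L - (t + k)) (t + k) ((q.2 v).hist k) ((q.2 v).pbelief k)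
        (acts j k ((q.2 v).hist k))} := by
  ext q
  simp [ErrorGood]

variable [NeZero C]

lemma measurableSet_nodeGood [Finite J] (hs : ∀ k t, Measurable (s k t))
    (hacts : ∀ j m, Measurable (acts j m)) (η : ℝ) (B θ : ℝ≥0∞) (m : ℕ) :
    MeasurableSet {p : Hist A Z (t + m) × PBelief X C |
      M.NodeGood σ L η B θ s acts m p.1 p.2} := by
  refine (M.measurableSet_weightGood σ η (t + m)).inter ?_
  have : {p : Hist A Z (t + m) × PBelief X C |
      ∀ j, M.excess σ η B s (L - (t + m)) (t + m) p.1 p.2 (acts j m p.1) ≤ θ} =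
      ⋂ j, {p | M.excess σ η B s (L - (t + m)) (t + m) p.1 p.2 (acts j m p.1) ≤ θ} := by
    ext p; simp
  change MeasurableSet {p : Hist A Z (t + m) × PBelief X C |
      ∀ j, M.excess σ η B s (L - (t + m)) (t + m) p.1 p.2 (acts j m p.1) ≤ θ}
  rw [this]
  exact MeasurableSet.iInter fun j => measurableSet_le
    ((M.measurable_excess σ η B hs _ _).comp (measurable_fst.prodMk
      (measurable_snd.prodMk ((hacts j m).comp measurable_fst)))) measurable_const

variable {d R : ℝ}

/-- Hoeffding for the weight, and for each action Markov's inequality at level `θ` for the excess.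
Summing `excessConst` over all horizons gives one constant for nodes of every depth. -/
lemma sisLaw_not_nodeGood_le [Fintype J] (hM : M.LikelihoodRatioBound σ L d) (hd : 0 < d)
    (hR : 1 ≤ R) (hr : ∀ i ≤ L, ∀ x a, |M.r i x a| ≤ R) {η : ℝ} (hη0 : 0 ≤ η) (hη : η ≤ 1 / 2)
    (hs : ∀ k t, Measurable (s k t)) (B : ℝ≥0∞) {θ : ℝ≥0∞} (hθ0 : θ ≠ 0) (hθ : θ ≠ ⊤) (m : ℕ)
    (hm : t + m ≤ L) {h : Hist A Z (t + m)} (hh : M.Nondeg σ (t + m) h) :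
    M.sisLaw σ C (t + m) h {b | ¬ M.NodeGood σ L η B θ s acts m h b} ≤
      (1 + Fintype.card J * ((∑ l ∈ Finset.range (L + 1),
        excessConst B (ENNReal.ofReal d) (Fintype.card ι) l) / θ)) *
          hoeffdingBound C η (d * R) := by
  set c := ∑ l ∈ Finset.range (L + 1), excessConst B (ENNReal.ofReal d) (Fintype.card ι) l with hc
  have hsub : {b | ¬ M.NodeGood σ L η B θ s acts m h b} ⊆
      {b : PBelief X C | ¬ M.WeightGood σ η (t + m) h b} ∪
        ⋃ j, {b | θ ≤ M.excess σ η B s (L - (t + m)) (t + m) h b (acts j m h)} := by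
    intro b hb
    by_cases h1 : M.WeightGood σ η (t + m) h b
    · obtain ⟨j, hj⟩ := not_forall.mp fun h2 => hb ⟨h1, h2⟩
      exact Or.inr (Set.mem_iUnion.mpr ⟨j, (not_le.mp hj).le⟩)
    · exact Or.inl h1
  have hj (j : J) : M.sisLaw σ C (t + m) h
      {b | θ ≤ M.excess σ η B s (L - (t + m)) (t + m) h b (acts j m h)} ≤
      hoeffdingBound C η (d * R) * (c / θ) := by
    have hmeas : Measurable fun b : PBelief X C =>
        M.excess σ η B s (L - (t + m)) (t + m) h b (acts j m h) :=
      (M.measurable_excess σ η B hs _ _).comp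
        (measurable_const.prodMk (measurable_id'.prodMk measurable_const))
    refine (meas_ge_le_lintegral_div hmeas.aemeasurable hθ0 hθ).trans ?_
    rw [← mul_div_assoc]
    gcongr
    refine (lintegral_excess_le hM hd hR hr hη0 hη B hs _ _ (by omega) hh _).trans ?_
    gcongr
    exact Finset.single_le_sum (f := fun l => excessConst B (ENNReal.ofReal d) (Fintype.card ι) l)
      (fun _ _ => zero_le) (Finset.mem_range.mpr (by omega))
  calc _ ≤ hoeffdingBound C η (d * R) + ∑ _j : J, hoeffdingBound C η (d * R) * (c / θ) :=
        (measure_mono hsub).trans ((measure_union_le _ _).trans (add_le_add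
          (sisLaw_not_weightGood_le hM hd hR hη0 hm hh) ((measure_iUnion_fintype_le _ _).trans
            (Finset.sum_le_sum fun j _ => hj j))))
    _ = _ := by
        rw [Finset.sum_const, Finset.card_univ, nsmul_eq_mul]
        ring

/-- The base `N + 1` is at least one even if there are no edges, so that the power is monotone in
the depth. -/
lemma card_path_le [Fintype E] {N : ℕ} (hE : Fintype.card E ≤ N + 1) {n : ℕ} (hn : n ≤ L) :
    (Fintype.card (Fin n → E) : ℝ≥0∞) ≤ ((N + 1 : ℕ) : ℝ≥0∞) ^ L := by
  rw [← Nat.cast_pow, Fintype.card_fun, Fintype.card_fin]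
  exact_mod_cast (Nat.pow_le_pow_left hE n).trans (Nat.pow_le_pow_right (Nat.succ_pos N) hn)

lemma measurableSet_forall_pathGood [Finite J] [Finite E] (hs : ∀ k t, Measurable (s k t))
    (hacts : ∀ j m, Measurable (acts j m)) (η : ℝ) (B θ : ℝ≥0∞) (n : ℕ) :
    MeasurableSet {T : (Fin n → E) → Node X A Z C t n |
      ∀ v, (T v).PathGood (M.NodeGood σ L η B θ s acts)} := by
  have hN : MeasurableSet {N : Node X A Z C t n | N.PathGood (M.NodeGood σ L η B θ s acts)} :=
    Node.measurableSet_pathGood fun m => M.measurableSet_nodeGood σ hs hacts η B θ m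
  have : {T : (Fin n → E) → Node X A Z C t n |
      ∀ v, (T v).PathGood (M.NodeGood σ L η B θ s acts)} =
      ⋂ v, (fun T => T v) ⁻¹' {N | N.PathGood (M.NodeGood σ L η B θ s acts)} := by
    ext T; simp
  rw [this]
  exact MeasurableSet.iInter fun v => (measurable_pi_apply v) hN

/-- Union bound over the leaves, since every internal node lies on the path to a leaf or has no
descendants to record it. The factor beside the Hoeffding bound in `pathConst` is free of `C`. -/
lemma treeLaw_not_forall_pathGood_le [Fintype J] [Fintype E]
    (hM : M.LikelihoodRatioBound σ L d) (hd : 0 < d) (hR : 1 ≤ R)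
    (hr : ∀ i ≤ L, ∀ x a, |M.r i x a| ≤ R) {η : ℝ} (hη0 : 0 ≤ η) (hη : η ≤ 1 / 2)
    (hs : ∀ k t, Measurable (s k t)) (hacts : ∀ j m, Measurable (acts j m))
    (hrule : ∀ n e, Measurable fun h => rule n h e) (B : ℝ≥0∞) {θ : ℝ≥0∞} (hθ0 : θ ≠ 0)
    (hθ : θ ≠ ⊤) {h : Hist A Z t} (hh : M.Nondeg σ t h) {N : ℕ}
    (hE : Fintype.card E ≤ N + 1) {n : ℕ} (hn : t + n ≤ L) :
    M.treeLaw σ C t h rule n {T | ∀ v, (T v).PathGood (M.NodeGood σ L η B θ s acts)}ᶜ ≤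
      ((N + 1 : ℕ) : ℝ≥0∞) ^ L *
        (pathConst B (ENNReal.ofReal d) θ (Fintype.card ι) (Fintype.card J) L *
          hoeffdingBound C η (d * R)) := by
  have hsub : {T : (Fin n → E) → Node X A Z C t n |
      ∀ v, (T v).PathGood (M.NodeGood σ L η B θ s acts)}ᶜ =
      ⋃ v, {T | ¬ (T v).PathGood (M.NodeGood σ L η B θ s acts)} := by
    ext T; simp
  rw [hsub]
  refine (measure_iUnion_fintype_le _ _).trans ?_
  calc _ ≤ ∑ _v : Fin n → E,
        pathConst B (ENNReal.ofReal d) θ (Fintype.card ι) (Fintype.card J) L *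
          hoeffdingBound C η (d * R) := by
        refine Finset.sum_le_sum fun v _ => (M.treeLaw_not_pathGood_le σ hM hη hrule
          (fun m => M.measurableSet_nodeGood σ hs hacts η B θ m) (fun m h b hb => hb.1) hh
          (fun m hm h' hh' => M.sisLaw_not_nodeGood_le σ hM hd hR hr hη0 hη hs B hθ0 hθ m hm hh')
          n hn v).trans ?_
        rw [pathConst, mul_assoc]
        gcongr
        omega
    _ ≤ _ := by
        rw [Finset.sum_const, Finset.card_univ, nsmul_eq_mul]
        gcongr
        exact card_path_le hE (by omega)

/-! ### The reward errors on a tree -/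

variable {Ω : Type*} [MeasurableSpace Ω]

lemma measurable_rewardError_tree {e : Ω → ℕ → X → A → ℝ≥0∞}
    (he : ∀ i, Measurable fun q : Ω × X × A => e q.1 i q.2.1 q.2.2)
    (hs : ∀ k t, Measurable (s k t)) (hacts : ∀ j m, Measurable (acts j m)) {n : ℕ}
    (v : Fin n → E) (k : Fin (n + 1)) (j : J) :
    Measurable fun q : Ω × ((Fin n → E) → Node X A Z C t n) =>
      M.rewardError σ (e q.1) s (L - (t + k)) (t + k) ((q.2 v).hist k) ((q.2 v).pbelief k)
        (acts j k ((q.2 v).hist k)) := by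
  have hv : Measurable fun q : Ω × ((Fin n → E) → Node X A Z C t n) => q.2 v :=
    (measurable_pi_apply v).comp measurable_snd
  have hk := (Node.measurable_hist (X := X) (C := C) k).comp hv
  exact (M.measurable_rewardError σ he hs _ _).comp (measurable_fst.prodMk
    (hk.prodMk (((Node.measurable_pbelief k).comp hv).prodMk ((hacts j k).comp hk))))

lemma measurableSet_errorGood [Finite J] [Finite E] {e : Ω → ℕ → X → A → ℝ≥0∞}
    (he : ∀ i, Measurable fun q : Ω × X × A => e q.1 i q.2.1 q.2.2)
    (hs : ∀ k t, Measurable (s k t)) (hacts : ∀ j m, Measurable (acts j m)) (θ : ℝ≥0∞) (n : ℕ) :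
    MeasurableSet {q : Ω × ((Fin n → E) → Node X A Z C t n) |
      M.ErrorGood σ L θ s acts (e q.1) q.2} := by
  refine MeasurableSet.of_compl ?_
  rw [errorGood_compl_eq]
  exact MeasurableSet.iUnion fun v => MeasurableSet.iUnion fun k => MeasurableSet.iUnion fun j =>
    measurableSet_lt measurable_const (M.measurable_rewardError_tree σ he hs hacts v k j)

/-- For each fixed tree the mean over `ω` is bounded by `lintegral_rewardError_le`. Markov's
inequality and a union over leaves, depths and actions follow; `μ` may be any law of trees, as no
change of measure is involved. -/
lemma prod_not_errorGood_le [Fintype J] [Fintype E] (P : Measure Ω) [IsProbabilityMeasure P]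
    {e : Ω → ℕ → X → A → ℝ≥0∞}
    (he : ∀ i, Measurable fun q : Ω × X × A => e q.1 i q.2.1 q.2.2) {κ : ℝ≥0∞}
    (hκ : ∀ i ≤ L, ∀ x a, ∫⁻ ω, e ω i x a ∂P ≤ κ)
    (hs : ∀ k t, Measurable (s k t)) (hacts : ∀ j m, Measurable (acts j m)) {θ : ℝ≥0∞}
    (hθ0 : θ ≠ 0) (hθ : θ ≠ ⊤) {N : ℕ} (hE : Fintype.card E ≤ N + 1) {n : ℕ} (hn : t + n ≤ L)
    (μ : Measure ((Fin n → E) → Node X A Z C t n)) [IsProbabilityMeasure μ] :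
    P.prod μ {q | M.ErrorGood σ L θ s acts (e q.1) q.2}ᶜ ≤
      ((N + 1 : ℕ) : ℝ≥0∞) ^ L * (errorConst θ (Fintype.card ι) (Fintype.card J) L * κ) := by
  set c := ∑ l ∈ Finset.range (L + 1), branchSum (Fintype.card ι) l with hc
  have hvkj (v : Fin n → E) (k : Fin (n + 1)) (j : J) : P.prod μ {q | θ < M.rewardError σ (e q.1)
      s (L - (t + k)) (t + k) ((q.2 v).hist k) ((q.2 v).pbelief k)
        (acts j k ((q.2 v).hist k))} ≤ κ * (c / θ) := by
    have hmeas := M.measurable_rewardError_tree (C := C) (L := L) σ he hs hacts v k j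
    have hk := k.2
    refine le_trans (measure_mono fun q (hq : θ < _) => hq.le)
      ((meas_ge_le_lintegral_div hmeas.aemeasurable hθ0 hθ).trans ?_)
    rw [← mul_div_assoc, lintegral_prod_symm _ hmeas.aemeasurable]
    gcongr
    refine (lintegral_mono (g := fun _ => κ * c) fun T => ?_).trans (by simp)
    refine (M.lintegral_rewardError_le σ P he hκ hs (L - (t + k)) (t + k) (by omega)
      ((T v).hist k) ((T v).pbelief k) (acts j k ((T v).hist k))).trans (mul_le_mul_right ?_ κ)
    exact Finset.single_le_sum (f := fun l => branchSum (Fintype.card ι) l)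
      (fun _ _ => zero_le) (Finset.mem_range.mpr (by omega))
  rw [errorGood_compl_eq]
  calc _ ≤ ∑ _v : Fin n → E, ∑ _k : Fin (n + 1), ∑ _j : J, κ * (c / θ) :=
        (measure_iUnion_fintype_le _ _).trans (Finset.sum_le_sum fun v _ =>
          (measure_iUnion_fintype_le _ _).trans (Finset.sum_le_sum fun k _ =>
            (measure_iUnion_fintype_le _ _).trans (Finset.sum_le_sum fun j _ => hvkj v k j)))
    _ = Fintype.card (Fin n → E) * (((n + 1 : ℕ) * (Fintype.card J * (c / θ))) * κ) := by
        simp only [Finset.sum_const, Finset.card_univ, nsmul_eq_mul, Fintype.card_fin]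
        ring
    _ ≤ _ := by
        rw [errorConst]
        gcongr
        · exact card_path_le hE (by omega)
        · omega

/-! ### The value gap on a good tree -/

/-- One `ε` pays for the accumulated deviations of order `η`, the other for the excess. -/
lemma gap_le {γ : ℝ} (hγ0 : 0 ≤ γ) (hγ1 : γ ≤ 1) (hR : 0 ≤ R)
    (hr : ∀ i ≤ L, ∀ x a, |M.r i x a| ≤ R) {η : ℝ} (hη0 : 0 ≤ η) (hη : η ≤ 1 / 2)
    (hs : ∀ k t, Measurable (s k t)) {π : Policy A Z}
    (hπ : ∀ t h, ∃ k, π.act t h = s k t h) {W : ℝ} (hW : (L + 1) * R ≤ W) {ε : ℝ} (hε : 0 ≤ ε)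
    (hηε : (L + 1) * (η * (2 * (1 + R) + 4 * W)) ≤ ε) {n : ℕ} (hn : t + n ≤ L)
    {N : Node X A Z C t n} (hN : N.PathGood
      (M.NodeGood σ L η (ENNReal.ofReal (2 * W)) (ENNReal.ofReal ε) s acts))
    (k : Fin (n + 1)) (j : J) :
    M.gap σ L γ M.r π N k (acts j k (N.hist k)) ≤ 2 * ε := by
  have hk := k.2
  have hW0 : 0 ≤ W := le_trans (by positivity) hW
  have h1 := M.abs_pomdpQAux_sub_pbmdpQAux_le σ hγ0 hγ1 hR hr hη0 hη hs hπ hW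
    (L - (t + k)) (t + k) (by omega) (N.hist k) (N.pbelief k) (acts j k (N.hist k))
  have hle : ((L - (t + k) : ℕ) : ℝ) ≤ L := by exact_mod_cast Nat.sub_le _ _
  have h2 : (((L - (t + k) : ℕ) : ℝ) + 1) * (η * (2 * (1 + R) + 4 * W)) ≤ ε :=
    (mul_le_mul_of_nonneg_right (by linarith) (by positivity)).trans hηε
  have h3 := h1.trans (add_le_add (ENNReal.ofReal_le_ofReal h2) ((hN k).2 j))
  rw [← ENNReal.ofReal_add hε hε, ENNReal.ofReal_le_ofReal_iff (by positivity)] at h3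
  rw [two_mul]
  exact h3

lemma gap_estimate_le {γ : ℝ} (hγ0 : 0 ≤ γ) (hγ1 : γ ≤ 1) (hR : 0 ≤ R)
    (hr : ∀ i ≤ L, ∀ x a, |M.r i x a| ≤ R) {rr : ℕ → X → A → ℝ}
    (hrr : ∀ i ≤ L, ∀ x a, |rr i x a| ≤ R)
    (hm : ∀ i, Measurable fun p : X × A => rr i p.1 p.2)
    (hs : ∀ k t, Measurable (s k t)) {π : Policy A Z} (hπ : ∀ t h, ∃ k, π.act t h = s k t h)
    {n : ℕ} (hn : t + n ≤ L) {ε : ℝ} (hε : 0 ≤ ε) {T : (Fin n → E) → Node X A Z C t n}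
    (hT : M.ErrorGood σ L (ENNReal.ofReal ε) s acts
      (fun i x a => ENNReal.ofReal |M.r i x a - rr i x a|) T)
    (v : Fin n → E) (k : Fin (n + 1)) (j : J) :
    M.gap σ L γ rr π (T v) k (acts j k ((T v).hist k)) ≤
      M.gap σ L γ M.r π (T v) k (acts j k ((T v).hist k)) + ε := by
  have hk := k.2
  have h1 := (M.abs_pbmdpQAux_sub_le σ hγ0 hγ1 hR hr hrr M.measurable_r hm hs hπ
    (L - (t + k)) (t + k) (by omega) ((T v).hist k) ((T v).pbelief k)
      (acts j k ((T v).hist k))).trans (hT v k j)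
  rw [ENNReal.ofReal_le_ofReal_iff hε] at h1
  exact (abs_sub_le _ _ _).trans (add_le_add le_rfl h1)

end Model

/-! ### The constants, the good event and the theorem. -/

lemma HoldsWithProb.mono {Ω : Type*} [MeasurableSpace Ω] {P : Measure Ω} {p : ℝ} {S S' : Set Ω}
    (h : HoldsWithProb P p S) (hS : S ⊆ S') : HoldsWithProb P p S' := by
  obtain ⟨G, hG, hGS, hP⟩ := h
  exact ⟨G, hG, hGS.trans hS, hP⟩

/-- The constants can be chosen, before the model, such that with high probability the value gap is
small at all nodes of the tree, for all policies whose actions are among those that the selectors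
`s` propose. -/
theorem exists_admissible_holdsWithProb {X A Z Ω ι J : Type*} [MeasurableSpace X]
    [MeasurableSpace A] [MeasurableSpace Z] [MeasurableSpace Ω] [Fintype ι] [Fintype J]
    (E : ℕ → Type*) [∀ C, Fintype (E C)] (K : ℕ) (hE : ∀ C, Fintype.card (E C) ≤ C * K + 1)
    (L : ℕ) {γ : ℝ} (hγ0 : 0 < γ) (hγ1 : γ ≤ 1)
    (Rmax Rest : ℕ → ℝ) (hV : 0 < Vmax L γ Rmax) {d : ℝ} (hd : 0 < d)
    {δr : ℝ → ℕ → ℝ} (hδr : ∀ ν : ℝ, 0 < ν → Tendsto (δr ν) atTop (𝓝 0))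
    {ε δ : ℝ} (hε : 0 < ε) (hδ : 0 < δ) :
    ∃ (lam ν : ℝ) (C Nr : ℕ), Admissible L γ (Vmax L γ Rmax) d δr K ε δ lam ν C Nr ∧
      ∀ (M : Model X A Z) (σ : ℕ → ObsChoice), (∀ i ≤ L, ∀ x a, |M.r i x a| ≤ Rmax i) →
        M.LikelihoodRatioBound σ L d →
        ∀ t ≤ L, ∀ h : Hist A Z t, M.evidence σ t h ≠ 0 → M.evidence σ t h ≠ ⊤ →
        ∀ (s : ι → (t : ℕ) → Hist A Z t → A), (∀ k t, Measurable (s k t)) →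
        ∀ (acts : J → (m : ℕ) → Hist A Z (t + m) → A), (∀ j m, Measurable (acts j m)) →
        ∀ (rule : (n : ℕ) → Hist A Z (t + n) → E C → A),
          (∀ n e, Measurable fun h => rule n h e) →
          HoldsWithProb (M.treeLaw σ C t h rule (L - t)) (1 - δ)
            {T | ∀ π : Policy A Z, (∀ t h, ∃ k, π.act t h = s k t h) → ∀ v k j,
              M.gap σ L γ M.r π (T v) k (acts j k ((T v).hist k)) ≤ ε} ∧
          ∀ (P : Measure Ω) [IsProbabilityMeasure P] (est : ℕ → Ω → ℕ → X → A → ℝ),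
            M.IsRewardEstimator P est L δr Rest →
            HoldsWithProb (P.prod (M.treeLaw σ C t h rule (L - t))) (1 - δ)
              {q | ∀ π : Policy A Z, (∀ t h, ∃ k, π.act t h = s k t h) → ∀ v k j,
                M.gap σ L γ (est Nr q.1) π (q.2 v) k (acts j k ((q.2 v).hist k)) ≤ ε} := by
  -- One bound for rewards and estimates at all times, fixed before the model; the `1` gives `R ≥
  -- 1`, which the common Hoeffding range `d * R` needs.
  set R : ℝ := 1 + ∑ i ∈ Finset.range (L + 1), (|Rmax i| + |Rest i|) with hRdef
  have hR1 : 1 ≤ R := le_add_of_nonneg_right (Finset.sum_nonneg fun i _ => by positivity)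
  have hR0 : 0 ≤ R := zero_le_one.trans hR1
  have hi (i : ℕ) (hi : i ≤ L) : |Rmax i| + |Rest i| ≤ R :=
    (Finset.single_le_sum (f := fun i => |Rmax i| + |Rest i|) (fun i _ => by positivity)
      (Finset.mem_range.mpr (by omega))).trans (le_add_of_nonneg_left zero_le_one)
  have hRmax (i : ℕ) (h : i ≤ L) : Rmax i ≤ R := by
    linarith [hi i h, le_abs_self (Rmax i), abs_nonneg (Rest i)]
  have hRest (i : ℕ) (h : i ≤ L) : Rest i ≤ R := by
    linarith [hi i h, le_abs_self (Rest i), abs_nonneg (Rmax i)]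
  set W : ℝ := (L + 1) * R with hW
  have hW0 : 0 ≤ W := by positivity
  set c : ℝ := 2 * (1 + R) + 4 * W with hc
  have hc0 : 0 < c := by positivity
  -- Three quarters of `ε` get used: one for the deviations of order `η`, one for the excess, one
  -- for the reward estimate. The failure probability is split into two halves.
  set η : ℝ := min (1 / 2) (ε / 4 / ((L + 1) * c)) with hη
  have hη0 : 0 < η := lt_min (by norm_num) (by positivity)
  have hη2 : η ≤ 1 / 2 := min_le_left _ _
  have hηε : (L + 1) * (η * c) ≤ ε / 4 := by
    have h1 : η ≤ ε / 4 / ((L + 1) * c) := min_le_right _ _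
    rw [le_div_iff₀ (by positivity)] at h1
    linarith
  have hε4 : 0 < ε / 4 := by positivity
  have hθ0 : ENNReal.ofReal (ε / 4) ≠ 0 := by simpa using hε
  have hθ : ENNReal.ofReal (ε / 4) ≠ ⊤ := ENNReal.ofReal_ne_top
  obtain ⟨lam, ν, C, Nr, ν', hadm, hν', hbad, herr⟩ := exists_admissible L hγ0 hγ1 hV hd hδr K hε
    hδ hη0 (mul_pos hd (zero_lt_one.trans_le hR1))
    (Model.pathConst_ne_top (B := ENNReal.ofReal (2 * W)) (D := ENNReal.ofReal d)
      ENNReal.ofReal_ne_top ENNReal.ofReal_ne_top hθ0 (Fintype.card ι) (Fintype.card J) L)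
    (Model.errorConst_ne_top hθ0 (Fintype.card ι) (Fintype.card J) L) R
  have : NeZero C := ⟨hadm.C_pos.ne'⟩
  refine ⟨lam, ν, C, Nr, hadm, fun M σ hr hM t ht h hh0 hht s hs acts hacts rule hrule => ?_⟩
  have hr' : ∀ i ≤ L, ∀ x a, |M.r i x a| ≤ R := fun i hi x a => (hr i hi x a).trans (hRmax i hi)
  have hn : t + (L - t) ≤ L := by omega
  have := M.isProbabilityMeasure_treeLaw σ (C := C) hrule h (L - t)
  -- The good event mentions the selectors but no policy. It is therefore a single measurable event
  -- for all admitted policies, although an intersection over policies need not be measurable.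
  set G : Set ((Fin (L - t) → E C) → Node X A Z C t (L - t)) := {T | ∀ v, (T v).PathGood
    (M.NodeGood σ L η (ENNReal.ofReal (2 * W)) (ENNReal.ofReal (ε / 4)) s acts)} with hG
  have hGm : MeasurableSet G := M.measurableSet_forall_pathGood σ hs hacts η _ _ _
  have hGc : M.treeLaw σ C t h rule (L - t) Gᶜ ≤ ENNReal.ofReal (δ / 2) :=
    (M.treeLaw_not_forall_pathGood_le σ hM hd hR1 hr' hη0.le hη2 hs hacts hrule _ hθ0 hθ
      ⟨hh0, hht⟩ (hE C) hn).trans hbad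
  have hgap {T : (Fin (L - t) → E C) → Node X A Z C t (L - t)} (hT : T ∈ G) {π : Policy A Z}
      (hπ : ∀ t h, ∃ k, π.act t h = s k t h) (v : Fin (L - t) → E C) (k : Fin (L - t + 1))
      (j : J) : M.gap σ L γ M.r π (T v) k (acts j k ((T v).hist k)) ≤ 2 * (ε / 4) :=
    M.gap_le σ hγ0.le hγ1 hR0 hr' hη0.le hη2 hs hπ hW.ge hε4.le hηε hn (hT v) k j
  refine ⟨holdsWithProb_of_compl_le hδ.le hGm (fun T hT π hπ v k j => ?_)
    (hGc.trans (ENNReal.ofReal_le_ofReal (by linarith))), fun P _ est hest => ?_⟩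
  · linarith [hgap hT hπ v k j]
  · set e : Ω → ℕ → X → A → ℝ≥0∞ :=
      fun ω i x a => ENNReal.ofReal |M.r i x a - est Nr ω i x a| with he
    have hem (i : ℕ) : Measurable fun q : Ω × X × A => e q.1 i q.2.1 q.2.2 :=
      (continuous_abs.measurable.comp (((M.measurable_r i).comp measurable_snd).sub
        (hest.measurable_est Nr i))).ennreal_ofReal
    have hEm := M.measurableSet_errorGood (C := C) (t := t) (L := L) (E := E C) σ hem hs hacts
      (ENNReal.ofReal (ε / 4)) (L - t)
    have hEc := (M.prod_not_errorGood_le σ P hem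
      (hest.lintegral_abs_sub_le hr' hRest hν' Nr) hs hacts hθ0 hθ (hE C) hn
      (M.treeLaw σ C t h rule (L - t))).trans herr
    refine holdsWithProb_of_compl_le hδ.le (hEm.inter (measurable_snd hGm))
      (fun q hq π hπ v k j => ?_) ?_
    · have hω : Measurable fun p : X × A => (q.1, p) := measurable_const.prodMk measurable_id'
      have h1 := M.gap_estimate_le σ hγ0.le hγ1 hR0 hr'
        (fun i hi x a => (hest.bounded Nr q.1 i hi x a).trans (hRest i hi))
        (fun i => (hest.measurable_est Nr i).comp hω) hs hπ hn hε4.le hq.1 v k j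
      linarith [hgap hq.2 hπ v k j]
    · rw [Set.compl_inter]
      refine (measure_union_le _ _).trans ?_
      have h2 : P.prod (M.treeLaw σ C t h rule (L - t)) (Prod.snd ⁻¹' G)ᶜ ≤
          ENNReal.ofReal (δ / 2) := by
        -- The tree is independent of the estimate, so its failure probability is unchanged in the
        -- product.
        rw [← Set.preimage_compl, ← Set.univ_prod, Measure.prod_prod, measure_univ, one_mul]
        exact hGc
      refine (add_le_add hEc h2).trans (le_of_eq ?_)
      rw [← ENNReal.ofReal_add (by positivity) (by positivity), add_halves]

end PBMDP

end

theorem mainTheorem6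
    {X A Z Ω : Type*} [MeasurableSpace X] [MeasurableSpace A] [MeasurableSpace Z]
    [MeasurableSpace Ω]
    (L : ℕ) (γ : ℝ) (hγ0 : 0 < γ) (hγ1 : γ ≤ 1)
    (Rmax Rest : ℕ → ℝ) (hV : 0 < PBMDP.Vmax L γ Rmax)
    (d : ℝ) (hd : 0 < d)
    (δr : ℝ → ℕ → ℝ) (hδr : ∀ ν : ℝ, 0 < ν → Tendsto (δr ν) atTop (𝓝 0))
    (ε δ : ℝ) (hε : 0 < ε) (hδ : 0 < δ) :
    -- a given policy, arbitrary action space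
    (∃ (lam ν : ℝ) (C Nr : ℕ),
      PBMDP.Admissible L γ (PBMDP.Vmax L γ Rmax) d δr 1 ε δ lam ν C Nr ∧
      ∀ (M : PBMDP.Model X A Z) (σ : ℕ → PBMDP.ObsChoice),
        (∀ i ≤ L, ∀ x a, |M.r i x a| ≤ Rmax i) →
        M.LikelihoodRatioBound σ L d →
        ∀ t ≤ L, ∀ h : PBMDP.Hist A Z t, M.evidence σ t h ≠ 0 → M.evidence σ t h ≠ ⊤ →
        ∀ (π : PBMDP.Policy A Z) (a : A),
          PBMDP.HoldsWithProb
            (M.treeLaw σ C t h (PBMDP.policyRule C t π a) (L - t)) (1 - δ)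
            {T | M.policyTreeGood σ L γ ε M.r π a T} ∧
          ∀ (P : Measure Ω) [IsProbabilityMeasure P] (est : ℕ → Ω → ℕ → X → A → ℝ),
            M.IsRewardEstimator P est L δr Rest →
            PBMDP.HoldsWithProb
              (P.prod (M.treeLaw σ C t h (PBMDP.policyRule C t π a) (L - t))) (1 - δ)
              {q | M.policyTreeGood σ L γ ε (est Nr q.1) π a q.2}) ∧
    -- all policies simultaneously, finite action space
    (∀ [Fintype A], ∃ (lam ν : ℝ) (C Nr : ℕ),
      PBMDP.Admissible L γ (PBMDP.Vmax L γ Rmax) d δr (Fintype.card A) ε δ lam ν C Nr ∧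
      ∀ (M : PBMDP.Model X A Z) (σ : ℕ → PBMDP.ObsChoice),
        (∀ i ≤ L, ∀ x a, |M.r i x a| ≤ Rmax i) →
        M.LikelihoodRatioBound σ L d →
        ∀ t ≤ L, ∀ h : PBMDP.Hist A Z t, M.evidence σ t h ≠ 0 → M.evidence σ t h ≠ ⊤ →
          PBMDP.HoldsWithProb
            (M.treeLaw σ C t h (PBMDP.fullRule A Z C t) (L - t)) (1 - δ)
            {T | M.fullTreeGood σ L γ ε M.r T} ∧
          ∀ (P : Measure Ω) [IsProbabilityMeasure P] (est : ℕ → Ω → ℕ → X → A → ℝ),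
            M.IsRewardEstimator P est L δr Rest →
            PBMDP.HoldsWithProb
              (P.prod (M.treeLaw σ C t h (PBMDP.fullRule A Z C t) (L - t))) (1 - δ)
              {q | M.fullTreeGood σ L γ ε (est Nr q.1) q.2}) := by
  constructor
  -- The only selector is the policy itself; `acts` has the root action `a` at depth zero and the
  -- policy elsewhere, as in `policyRule`.
  · obtain ⟨lam, ν, C, Nr, hadm, H⟩ := PBMDP.exists_admissible_holdsWithProb (X := X) (A := A)
      (Z := Z) (Ω := Ω) (ι := Unit) (J := Unit) (fun C => Fin C) 1 (by simp) L hγ0 hγ1 Rmax Rest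
      hV hd hδr hε hδ
    refine ⟨lam, ν, C, Nr, hadm, fun M σ hr hM t ht h hh0 hht π a => ?_⟩
    have hact (m : ℕ) : Measurable fun h : PBMDP.Hist A Z (t + m) =>
        if m = 0 then a else π.act (t + m) h := by
      split_ifs
      · exact measurable_const
      · exact π.measurable_act _
    obtain ⟨h1, h2⟩ := H M σ hr hM t ht h hh0 hht (fun _ => π.act) (fun _ => π.measurable_act)
      (fun _ m h => if m = 0 then a else π.act (t + m) h) (fun _ => hact)
      (PBMDP.policyRule C t π a) (fun m _ => hact m)
    exact ⟨h1.mono fun T hT v k _ => hT π (fun _ _ => ⟨(), rfl⟩) v k (),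
      fun P _ est hest => (h2 P est hest).mono
        fun q hq v k _ => hq π (fun _ _ => ⟨(), rfl⟩) v k ()⟩
  · intro _
    -- The selectors are the constant actions. At each history any policy agrees with one of them,
    -- so the quantifier over policies stays inside the event.
    obtain ⟨lam, ν, C, Nr, hadm, H⟩ := PBMDP.exists_admissible_holdsWithProb (X := X) (A := A)
      (Z := Z) (Ω := Ω) (ι := A) (J := A) (fun C => A × Fin C) (Fintype.card A)
      (fun C => by rw [Fintype.card_prod, Fintype.card_fin, mul_comm]; exact Nat.le_succ _) L
      hγ0 hγ1 Rmax Rest hV hd hδr hε hδ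
    refine ⟨lam, ν, C, Nr, hadm, fun M σ hr hM t ht h hh0 hht => ?_⟩
    obtain ⟨h1, h2⟩ := H M σ hr hM t ht h hh0 hht (fun a _ _ => a) (fun _ _ => measurable_const)
      (fun a _ _ => a) (fun _ _ => measurable_const) (PBMDP.fullRule A Z C t)
      (fun _ _ => measurable_const)
    exact ⟨h1.mono fun T hT π v k a => hT π (fun t h => ⟨π.act t h, rfl⟩) v k a,
      fun P _ est hest => (h2 P est hest).mono
        fun q hq π v k a => hq π (fun t h => ⟨π.act t h, rfl⟩) v k a⟩
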